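/- Let $d>2$ and let $\Omega\subset\mathbb R^d$ be a bounded open convex polytope. For $k\in\mathbb N$ let $P_k\subset\mathbb R^d$ be a finite point set such that the interior of the closed convex hull of $P_k$ is $\Omega$, and let $h_k>0$ with $h_k\to0$. Suppose that there are constants $\tau,\gamma,\eta>0$, independent of $k$, such that for every $k$: (i) $P_k$ is an $h_k$-covering of $\Omega$: every $x\in\Omega$ lies in a closed $d$-simplex with vertices in $P_k$ whose size (the diameter of the smallest ball containing it) is less than $h_k$; (ii) $P_k$ has $h_k$-density bounded by $\tau$: $\#\big(P_k\cap\bar B(x,h_k)\big)\le\tau$ for every $x\in\mathbb R^d$; (iii) for every (closed) $(d-1)$-face $A$ of $\partial\Omega$, no $a\in P_k$ satisfies $0<\operatorname{dist}(a,A)<\eta h_k$. Let $\beta_k=\gamma/h_k^2$ and let $X_k=\operatorname{span}\{w_a : a\in P_k\}$ be the space spanned by the local maximum-entropy (LME) shape functions of $P_k$ with parameter $\beta_k$: for each $x$ in the closed convex hull of $P_k$, $(w_a(x))_{a\in P_k}$ is the unique minimizer of $$\sum_{a\in P_k} w_a|x-a|^2+\frac1{\beta_k}\sum_{a\in P_k}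 w_a\log w_a\qquad(0\log 0=0)$$ subject to $w_a\ge0$, $\sum_a w_a=1$, $\sum_a w_a\,a=x$. Then for every $u\in H^1(\Omega)$ there are a sequence $\chi_k\in H^1(\Omega)$ with $\chi_k\to1$ in $H^1(\Omega)$ and a sequence $u_k\in X_k$ such that $\chi_ku_k\in H^1(\Omega)$ for every $k$ and $\chi_ku_k\to u$ in $H^1(\Omega)$. -/

import Mathlib

open MeasureTheory Filter Topology
open scoped ContDiff

/-- The size of a bounded set: the diameter of the smallest ball containing it. -/
noncomputable def setSize {d : ℕ} (A : Set (EuclideanSpace ℝ (Fin d))) : ℝ :=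
  2 * sInf {r : ℝ | 0 ≤ r ∧ ∃ c, A ⊆ Metric.closedBall c r}

/-- `P` is an `h`-covering of `A`: every point of `A` lies in a (closed) `d`-simplex of size `< h`
with vertices in `P`. -/
def IsHCovering {d : ℕ} (P : Finset (EuclideanSpace ℝ (Fin d))) (h : ℝ)
    (A : Set (EuclideanSpace ℝ (Fin d))) : Prop :=
  ∀ x ∈ A, ∃ T : Affine.Simplex ℝ (EuclideanSpace ℝ (Fin d)) d,
    (∀ i, T.points i ∈ P) ∧
      setSize (convexHull ℝ (Set.range T.points)) < h ∧
      x ∈ convexHull ℝ (Set.range T.points)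

/-- `P` has `h`-density bounded by `τ`. -/
def HasHDensityLE {d : ℕ} (P : Finset (EuclideanSpace ℝ (Fin d))) (h τ : ℝ) : Prop :=
  ∀ x : EuclideanSpace ℝ (Fin d), (((P : Set _) ∩ Metric.closedBall x h).ncard : ℝ) ≤ τ

/-- `Ω` is an open bounded convex polytope. -/
def IsOpenPolytope {d : ℕ} (Ω : Set (EuclideanSpace ℝ (Fin d))) : Prop :=
  ∃ V : Finset (EuclideanSpace ℝ (Fin d)),
    Ω = interior (convexHull ℝ (V : Set (EuclideanSpace ℝ (Fin d))))

/-- `A` is a (closed) `(d-1)`-dimensional face of the convex polytope `Ω`. -/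
def IsFacet {d : ℕ} (Ω A : Set (EuclideanSpace ℝ (Fin d))) : Prop :=
  IsExposed ℝ (closure Ω) A ∧ Module.finrank ℝ (vectorSpan ℝ A) + 1 = d

/-! ### Local maximum-entropy shape functions -/

/-- Nonnegative weights on the nodes that sum to one and have barycenter `x`. -/
def lmeFeasible {d : ℕ} (P : Finset (EuclideanSpace ℝ (Fin d)))
    (x : EuclideanSpace ℝ (Fin d)) : Set (P → ℝ) :=
  {w | (∀ a, 0 ≤ w a) ∧ ∑ a, w a = 1 ∧ ∑ a, w a • (a : EuclideanSpace ℝ (Fin d)) = x}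

/-- The pointwise objective `∑ w_a |x - x_a|² + β⁻¹ ∑ w_a log w_a` (with `0 log 0 = 0`). -/
noncomputable def lmeObjective {d : ℕ} (β : ℝ) (P : Finset (EuclideanSpace ℝ (Fin d)))
    (x : EuclideanSpace ℝ (Fin d)) (w : P → ℝ) : ℝ :=
  ∑ a, w a * ‖x - (a : EuclideanSpace ℝ (Fin d))‖ ^ 2 + 1 / β * ∑ a, w a * Real.log (w a)

/-- `w` solves the minimization problem that defines the shape functions at `x`. -/
def IsLMEWeights {d : ℕ} (β : ℝ) (P : Finset (EuclideanSpace ℝ (Fin d)))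
    (x : EuclideanSpace ℝ (Fin d)) (w : P → ℝ) : Prop :=
  w ∈ lmeFeasible P x ∧ ∀ w' ∈ lmeFeasible P x, lmeObjective β P x w ≤ lmeObjective β P x w'

open Classical in
/-- The shape function of the node `a`; it is given the value `0` where the minimization problem has
no solution, that is, outside the convex hull of `P`. -/
noncomputable def lmeShape {d : ℕ} (β : ℝ) (P : Finset (EuclideanSpace ℝ (Fin d))) (a : P)
    (x : EuclideanSpace ℝ (Fin d)) : ℝ :=
  if h : ∃ w, IsLMEWeights β P x w then h.choose a else 0

/-- The approximation space: the span of the shape functions. -/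
noncomputable def lmeSpace {d : ℕ} (β : ℝ) (P : Finset (EuclideanSpace ℝ (Fin d))) :
    Submodule ℝ (EuclideanSpace ℝ (Fin d) → ℝ) :=
  Submodule.span ℝ (Set.range (lmeShape β P))

/-- The minimization problem has exactly one solution at each point of the convex hull of `P`, so
that `lmeShape` involves no choice there. -/
theorem existsUnique_isLMEWeights {d : ℕ} {β : ℝ} (hβ : 0 < β)
    (P : Finset (EuclideanSpace ℝ (Fin d))) {x : EuclideanSpace ℝ (Fin d)}
    (hx : x ∈ convexHull ℝ (P : Set (EuclideanSpace ℝ (Fin d)))) :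
    ∃! w, IsLMEWeights β P x w := by
  have hcont : Continuous (lmeObjective β P x) := by
    unfold lmeObjective
    refine Continuous.add (by fun_prop) (continuous_const.mul ?_)
    exact continuous_finsetSum _ fun a _ =>
      Real.continuous_mul_log.comp (continuous_apply a)
  have hclosed : IsClosed (lmeFeasible P x) := by
    have h1 : IsClosed {w : P → ℝ | ∀ a, 0 ≤ w a} := by
      simp only [Set.ofPred_forall]
      exact isClosed_iInter fun a => isClosed_le continuous_const (continuous_apply a)
    have h2 : IsClosed {w : P → ℝ | ∑ a, w a = 1} :=
      isClosed_eq (by fun_prop) continuous_const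
    have h3 : IsClosed {w : P → ℝ | ∑ a, w a • (a : EuclideanSpace ℝ (Fin d)) = x} :=
      isClosed_eq (by fun_prop) continuous_const
    exact h1.inter (h2.inter h3)
  have hcomp : IsCompact (lmeFeasible P x) := by
    refine (isCompact_univ_pi fun _ : P => isCompact_Icc (a := (0 : ℝ)) (b := 1)).of_isClosed_subset
      hclosed ?_
    rintro w ⟨h0, h1, -⟩ a -
    exact ⟨h0 a, h1 ▸ Finset.single_le_sum (fun b _ => h0 b) (Finset.mem_univ a)⟩
  have hne : (lmeFeasible P x).Nonempty := by
    obtain ⟨w, h0, h1, h2⟩ := Finset.mem_convexHull'.1 hx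
    refine ⟨fun a => w a, fun a => h0 a a.2, ?_, ?_⟩
    · rw [Finset.sum_coe_sort P w, h1]
    · rw [Finset.sum_coe_sort P fun a => w a • a, h2]
  obtain ⟨w, hw, hmin⟩ := hcomp.exists_isMinOn hne hcont.continuousOn
  refine ⟨w, ⟨hw, fun w' hw' => hmin hw'⟩, ?_⟩
  rintro w' ⟨hw', hmin'⟩
  by_contra hne'
  obtain ⟨b, hb⟩ := Function.ne_iff.1 hne'
  have hmid : (fun a => (1 / 2 : ℝ) * w' a + 1 / 2 * w a) ∈ lmeFeasible P x := by
    refine ⟨fun a => ?_, ?_, ?_⟩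
    · have := hw.1 a; have := hw'.1 a; positivity
    · rw [Finset.sum_add_distrib, ← Finset.mul_sum, ← Finset.mul_sum, hw.2.1, hw'.2.1]; norm_num
    · simp only [add_smul, mul_smul]
      rw [Finset.sum_add_distrib, ← Finset.smul_sum, ← Finset.smul_sum, hw.2.2, hw'.2.2, ← add_smul]
      norm_num
  have hent : ∑ a, ((1 / 2 : ℝ) * w' a + 1 / 2 * w a) * Real.log (1 / 2 * w' a + 1 / 2 * w a) <
      ∑ a, (1 / 2 * (w' a * Real.log (w' a)) + 1 / 2 * (w a * Real.log (w a))) := by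
    refine Finset.sum_lt_sum (fun a _ => ?_) ⟨b, Finset.mem_univ b, ?_⟩
    · exact Real.convexOn_mul_log.2 (hw'.1 a) (hw.1 a) (by norm_num) (by norm_num) (by norm_num)
    · exact Real.strictConvexOn_mul_log.2 (hw'.1 b) (hw.1 b) hb (by norm_num) (by norm_num)
        (by norm_num)
  have h1 := hmin' _ hmid
  have h2 : lmeObjective β P x w ≤ _ := hmin hmid
  have hβ' : 0 < 1 / β := by positivity
  have h3 := mul_lt_mul_of_pos_left hent hβ'
  rw [Finset.sum_add_distrib, ← Finset.mul_sum, ← Finset.mul_sum] at h3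
  simp only [lmeObjective] at h1 h2
  have h4 : ∑ a : P, ((1 / 2 : ℝ) * w' a + 1 / 2 * w a) *
      ‖x - (a : EuclideanSpace ℝ (Fin d))‖ ^ 2 =
      1 / 2 * ∑ a : P, w' a * ‖x - (a : EuclideanSpace ℝ (Fin d))‖ ^ 2 +
      1 / 2 * ∑ a : P, w a * ‖x - (a : EuclideanSpace ℝ (Fin d))‖ ^ 2 := by
    rw [Finset.mul_sum, Finset.mul_sum, ← Finset.sum_add_distrib]
    exact Finset.sum_congr rfl fun a _ => by ring
  rw [h4] at h1 h2
  linarith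

/-! ### The Sobolev space `H¹(Ω)` -/

/-- `u ∈ L²(Ω)` and `u` has the weak gradient `g ∈ L²(Ω)`. -/
structure HasH1Gradient {d : ℕ} (Ω : Set (EuclideanSpace ℝ (Fin d)))
    (u : EuclideanSpace ℝ (Fin d) → ℝ)
    (g : EuclideanSpace ℝ (Fin d) → EuclideanSpace ℝ (Fin d)) : Prop where
  memLp : MemLp u 2 (volume.restrict Ω)
  memLp_gradient : MemLp g 2 (volume.restrict Ω)
  integral_eq : ∀ φ : EuclideanSpace ℝ (Fin d) → ℝ, ContDiff ℝ ∞ φ → HasCompactSupport φ →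
    tsupport φ ⊆ Ω → ∀ v : EuclideanSpace ℝ (Fin d),
      ∫ x in Ω, u x * fderiv ℝ φ x v = -∫ x in Ω, inner ℝ (g x) v * φ x

/-- `u ∈ H¹(Ω)`. -/
def MemH1 {d : ℕ} (Ω : Set (EuclideanSpace ℝ (Fin d))) (u : EuclideanSpace ℝ (Fin d) → ℝ) : Prop :=
  ∃ g, HasH1Gradient Ω u g

/-- `f k ∈ H¹(Ω)` for all `k`, `u ∈ H¹(Ω)`, and `f k → u` in `H¹(Ω)`. (Weak gradients are unique
almost everywhere in an open set, so it does not matter which ones are taken.) -/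
def TendstoH1 {d : ℕ} (Ω : Set (EuclideanSpace ℝ (Fin d)))
    (f : ℕ → EuclideanSpace ℝ (Fin d) → ℝ) (u : EuclideanSpace ℝ (Fin d) → ℝ) : Prop :=
  ∃ (G : ℕ → EuclideanSpace ℝ (Fin d) → EuclideanSpace ℝ (Fin d))
    (g : EuclideanSpace ℝ (Fin d) → EuclideanSpace ℝ (Fin d)),
    (∀ k, HasH1Gradient Ω (f k) (G k)) ∧ HasH1Gradient Ω u g ∧
      Tendsto (fun k => eLpNorm (f k - u) 2 (volume.restrict Ω)) atTop (𝓝 0) ∧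
      Tendsto (fun k => eLpNorm (G k - g) 2 (volume.restrict Ω)) atTop (𝓝 0)

/-! Functions smooth on the whole space are dense in `H¹(Ω)`: contract toward an interior point,
then mollify (`HasH1Gradient.exists_contDiff_eLpNorm_sub_le`). So it suffices to approximate a
smooth `U`, and the candidate is the nodal interpolant `v = ∑ U(a) w_a`.

At an interior point `x` the weights form an exponential family, `w_a = exp(c + l·(a-x) -
γ|a-x|²/h²)`: a Gaussian with an affine tilt. Since weights are at most one and every point of the
hull is a combination of nodes within distance `h`, the tilt grows at most linearly in `|a-x|/h`.
The Gaussian beats it, and the moments of `b_a = (a-x)/h` up to order nine are bounded uniformly in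
`x` and `h` (`exists_tilt_and_moment_bound`). Exactness on affine functions then gives `|v - U| ≤ C
h²`. Differentiating along the natural parameter of the family shows that `G = (∇v - ∇U)/h` solves a
linear system whose matrix is the covariance of the `b_a` and whose right-hand side comes from
Taylor remainders (`gradient_error_system`).

Where `x` has room of size `ρh` in every direction, the covariance is bounded below, because each
direction contains a node of non-negligible weight (`IsTiltedGaussian.exists_node`), and the
gradient error is `O(h)`. At a small height `t` over a single facet, the barycenter condition lets
the covariance in the normal direction become as small as a multiple of `t/h`. Condition (iii)
prevents worse: nodes off the facet stay at height at least a multiple of `h`. Separating tangential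
and normal parts of the system yields an error `C h (t/h)^(-1/4)`
(`exists_norm_le_of_degenerate_covariance_system`). Its square is integrable up to the facet
(`lintegral_inv_sqrt_lt_top`).

Where two facets are close at once no gradient bound is available. Such regions have volume
quadratic in the distance, so the limiting set has zero `H¹`-capacity, and averaging cutoffs over
many geometric scales gives a smooth `χ` that is `H¹`-close to one and vanishes there
(`exists_cutoff`, `exists_polytope_cutoff`). For fixed `U` and `χ` the products `χ v` converge to `χ
U` as `h → 0`; a diagonal choice (`exists_tendsto_zero_of_eventually`) then produces the two
sequences. -/

/-! ### The shape functions as an exponential family -/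

section Gibbs

variable {d : ℕ} (β : ℝ) (P : Finset (EuclideanSpace ℝ (Fin d)))

/-- Unnormalized Gibbs weight of the node `a` at the parameter `μ`. -/
noncomputable def gibbsFactor (μ : EuclideanSpace ℝ (Fin d)) (a : P) : ℝ :=
  Real.exp (inner ℝ (a : EuclideanSpace ℝ (Fin d)) μ - β * ‖(a : EuclideanSpace ℝ (Fin d))‖ ^ 2)

/-- The partition function. -/
noncomputable def gibbsPartition (μ : EuclideanSpace ℝ (Fin d)) : ℝ :=
  ∑ a : P, gibbsFactor β P μ a

/-- Normalized Gibbs weight of the node `a` at the parameter `μ`. -/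
noncomputable def gibbsWeight (a : P) (μ : EuclideanSpace ℝ (Fin d)) : ℝ :=
  gibbsFactor β P μ a / gibbsPartition β P μ

/-- The barycenter of the Gibbs weights. -/
noncomputable def gibbsMean (μ : EuclideanSpace ℝ (Fin d)) : EuclideanSpace ℝ (Fin d) :=
  ∑ a : P, gibbsWeight β P a μ • (a : EuclideanSpace ℝ (Fin d))

variable {β P}

theorem gibbsFactor_pos (μ : EuclideanSpace ℝ (Fin d)) (a : P) : 0 < gibbsFactor β P μ a :=
  Real.exp_pos _

theorem gibbsPartition_pos (hP : P.Nonempty) (μ : EuclideanSpace ℝ (Fin d)) :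
    0 < gibbsPartition β P μ := by
  have : Nonempty P := hP.to_subtype
  exact Finset.sum_pos (fun a _ => gibbsFactor_pos μ a) Finset.univ_nonempty

theorem gibbsWeight_pos (hP : P.Nonempty) (μ : EuclideanSpace ℝ (Fin d)) (a : P) :
    0 < gibbsWeight β P a μ :=
  div_pos (gibbsFactor_pos μ a) (gibbsPartition_pos hP μ)

theorem sum_gibbsWeight (hP : P.Nonempty) (μ : EuclideanSpace ℝ (Fin d)) :
    ∑ a, gibbsWeight β P a μ = 1 := by
  simp only [gibbsWeight, ← Finset.sum_div]
  exact div_self (gibbsPartition_pos hP μ).ne'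

theorem contDiff_gibbsFactor (a : P) : ContDiff ℝ ∞ fun μ => gibbsFactor β P μ a := by
  unfold gibbsFactor
  exact ((contDiff_const.inner ℝ contDiff_id).sub contDiff_const).exp

theorem contDiff_gibbsWeight (hP : P.Nonempty) (a : P) : ContDiff ℝ ∞ (gibbsWeight β P a) := by
  refine (contDiff_gibbsFactor a).div ?_ fun μ => (gibbsPartition_pos hP μ).ne'
  exact ContDiff.sum fun b _ => contDiff_gibbsFactor b

theorem contDiff_gibbsMean (hP : P.Nonempty) : ContDiff ℝ ∞ (gibbsMean β P) := by
  unfold gibbsMean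
  exact ContDiff.sum fun b _ => (contDiff_gibbsWeight hP b).smul contDiff_const

theorem hasFDerivAt_gibbsFactor (μ : EuclideanSpace ℝ (Fin d)) (a : P) :
    HasFDerivAt (fun μ => gibbsFactor β P μ a)
      (gibbsFactor β P μ a • innerSL ℝ (a : EuclideanSpace ℝ (Fin d))) μ := by
  unfold gibbsFactor
  refine HasFDerivAt.exp (f := fun μ => inner ℝ (a : EuclideanSpace ℝ (Fin d)) μ -
    β * ‖(a : EuclideanSpace ℝ (Fin d))‖ ^ 2) ?_
  exact ((innerSL ℝ (a : EuclideanSpace ℝ (Fin d))).hasFDerivAt).sub_const _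

theorem fderiv_gibbsWeight (hP : P.Nonempty) (μ y : EuclideanSpace ℝ (Fin d)) (a : P) :
    fderiv ℝ (gibbsWeight β P a) μ y =
      gibbsWeight β P a μ * inner ℝ ((a : EuclideanSpace ℝ (Fin d)) - gibbsMean β P μ) y := by
  have hZ := gibbsPartition_pos (β := β) hP μ
  have h1 : HasFDerivAt (gibbsPartition β P)
      (∑ b : P, gibbsFactor β P μ b • innerSL ℝ (b : EuclideanSpace ℝ (Fin d))) μ := by
    unfold gibbsPartition
    exact HasFDerivAt.fun_sum fun b _ => hasFDerivAt_gibbsFactor μ b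
  have h2 := (hasFDerivAt_gibbsFactor (β := β) μ a).mul
    ((hasDerivAt_inv hZ.ne').comp_hasFDerivAt μ h1)
  have h3 : gibbsWeight β P a = fun μ => gibbsFactor β P μ a * (gibbsPartition β P μ)⁻¹ := by
    ext; simp [gibbsWeight, div_eq_mul_inv]
  rw [h3, (show HasFDerivAt (fun μ => gibbsFactor β P μ a * (gibbsPartition β P μ)⁻¹) _ μ from
    h2).fderiv]
  have h4 : inner ℝ (gibbsMean β P μ) y = (∑ b : P, gibbsFactor β P μ b *
      inner ℝ (b : EuclideanSpace ℝ (Fin d)) y) / gibbsPartition β P μ := by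
    simp only [gibbsMean, sum_inner, inner_smul_left, gibbsWeight, Finset.sum_div]
    refine Finset.sum_congr rfl fun b _ => ?_
    simp
    ring
  rw [inner_sub_left, h4]
  simp
  field_simp
  ring

/-- The derivative of the mean of an exponential family is the covariance of its weights. The second
factor may be centred at the mean because the derivatives of the weights sum to zero. -/
theorem fderiv_gibbsMean (hP : P.Nonempty) (μ y : EuclideanSpace ℝ (Fin d)) :
    fderiv ℝ (gibbsMean β P) μ y = ∑ a : P, (gibbsWeight β P a μ *
      inner ℝ ((a : EuclideanSpace ℝ (Fin d)) - gibbsMean β P μ) y) •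
        ((a : EuclideanSpace ℝ (Fin d)) - gibbsMean β P μ) := by
  have hd : ∀ b : P, DifferentiableAt ℝ (gibbsWeight β P b) μ := fun b =>
    (contDiff_gibbsWeight hP b).contDiffAt.differentiableAt (by simp)
  have h1 : HasFDerivAt (gibbsMean β P) (∑ b : P, (fderiv ℝ (gibbsWeight β P b) μ).smulRight
      (b : EuclideanSpace ℝ (Fin d))) μ := by
    unfold gibbsMean
    exact HasFDerivAt.fun_sum fun b _ => (hd b).hasFDerivAt.smul_const _
  rw [h1.fderiv]
  simp only [sum_apply, ContinuousLinearMap.smulRight_apply,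
    fderiv_gibbsWeight hP]
  simp only [smul_sub, Finset.sum_sub_distrib, ← Finset.sum_smul]
  have h2 : ∑ a : P, gibbsWeight β P a μ *
      inner ℝ ((a : EuclideanSpace ℝ (Fin d)) - gibbsMean β P μ) y = 0 := by
    simp only [inner_sub_left, mul_sub, Finset.sum_sub_distrib, ← Finset.sum_mul,
      sum_gibbsWeight hP]
    have h5 : inner ℝ (gibbsMean β P μ) y =
        ∑ a : P, gibbsWeight β P a μ * inner ℝ (a : EuclideanSpace ℝ (Fin d)) y := by
      simp [gibbsMean, sum_inner, real_inner_smul_left]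
    rw [h5, one_mul, sub_self]
  rw [h2]
  simp

theorem exists_inner_ge_of_mem_convexHull {y μ : EuclideanSpace ℝ (Fin d)}
    (hy : y ∈ convexHull ℝ (P : Set (EuclideanSpace ℝ (Fin d)))) :
    ∃ a ∈ P, inner ℝ y μ ≤ inner ℝ a μ := by
  by_contra! hcon
  have hsub : convexHull ℝ (P : Set (EuclideanSpace ℝ (Fin d))) ⊆
      {z | inner ℝ z μ < inner ℝ y μ} := by
    refine convexHull_min (fun a ha => hcon a ha) ?_
    refine convex_halfSpace_lt ⟨fun a b => inner_add_left _ _ _, fun c a => ?_⟩ _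
    simp [inner_smul_left]
  have h := hsub hy
  rw [Set.mem_ofPred_eq] at h
  exact lt_irrefl _ h

/-- Convex duality: the parameter minimises `Φ(μ) = exp(-x·μ) Z(μ)`, with `Z` the partition
function, whose critical points are the parameters with mean `x`. A minimiser exists because a ball
around `x` lies in the hull, so for each `μ` some node has `(a - x)·μ ≥ (ε/2)|μ|`, which makes `Φ`
coercive. -/
theorem exists_gibbsMean_eq {x : EuclideanSpace ℝ (Fin d)}
    (hx : x ∈ interior (convexHull ℝ (P : Set (EuclideanSpace ℝ (Fin d))))) :
    ∃ μ, gibbsMean β P μ = x := by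
  have hP : P.Nonempty := by
    have := convexHull_nonempty_iff.1 ⟨x, interior_subset hx⟩
    simpa using this
  have hne : Nonempty P := hP.to_subtype
  obtain ⟨ε, hε, hball⟩ := Metric.isOpen_iff.1 isOpen_interior x hx
  let Φ : EuclideanSpace ℝ (Fin d) → ℝ := fun μ => ∑ a : P,
    Real.exp (inner ℝ ((a : EuclideanSpace ℝ (Fin d)) - x) μ -
      β * ‖(a : EuclideanSpace ℝ (Fin d))‖ ^ 2)
  have hΦc : Continuous Φ := by
    unfold Φ
    fun_prop
  let B : ℝ := ∑ a : P, |β| * ‖(a : EuclideanSpace ℝ (Fin d))‖ ^ 2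
  have hB : ∀ a : P, -B ≤ -(β * ‖(a : EuclideanSpace ℝ (Fin d))‖ ^ 2) := by
    intro a
    have h1 : |β| * ‖(a : EuclideanSpace ℝ (Fin d))‖ ^ 2 ≤ B :=
      Finset.single_le_sum (f := fun a : P => |β| * ‖(a : EuclideanSpace ℝ (Fin d))‖ ^ 2)
        (fun b _ => by positivity) (Finset.mem_univ a)
    have h2 := mul_le_mul_of_nonneg_right (le_abs_self β)
      (sq_nonneg ‖(a : EuclideanSpace ℝ (Fin d))‖)
    linarith
  have hΦ : ∀ (μ : EuclideanSpace ℝ (Fin d)) (a : P),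
      Real.exp (inner ℝ ((a : EuclideanSpace ℝ (Fin d)) - x) μ -
        β * ‖(a : EuclideanSpace ℝ (Fin d))‖ ^ 2) ≤ Φ μ := fun μ a =>
    Finset.single_le_sum (f := fun a : P =>
      Real.exp (inner ℝ ((a : EuclideanSpace ℝ (Fin d)) - x) μ -
        β * ‖(a : EuclideanSpace ℝ (Fin d))‖ ^ 2))
      (fun b _ => (Real.exp_pos _).le) (Finset.mem_univ a)
  have hlow : ∀ μ, Real.exp (ε / 2 * ‖μ‖ - B) ≤ Φ μ := by
    intro μ
    by_cases hμ : μ = 0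
    · subst hμ
      obtain ⟨a⟩ := hne
      refine le_trans (Real.exp_le_exp.2 ?_) (hΦ 0 a)
      have := hB a
      simp only [norm_zero, mul_zero, inner_zero_right]
      linarith
    · have hμ' : 0 < ‖μ‖ := norm_pos_iff.2 hμ
      have hy : x + (ε / 2 / ‖μ‖) • μ ∈ convexHull ℝ (P : Set (EuclideanSpace ℝ (Fin d))) := by
        refine interior_subset (hball ?_)
        simp only [Metric.mem_ball, dist_self_add_left, norm_smul, norm_div, norm_norm]
        rw [div_mul_cancel₀ _ hμ'.ne', Real.norm_of_nonneg (by positivity)]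
        norm_num
        linarith
      obtain ⟨a, ha, hle⟩ := exists_inner_ge_of_mem_convexHull (μ := μ) hy
      refine le_trans (Real.exp_le_exp.2 ?_) (hΦ μ ⟨a, ha⟩)
      have := hB ⟨a, ha⟩
      rw [inner_add_left, real_inner_smul_left, real_inner_self_eq_norm_sq] at hle
      have h3 : ε / 2 / ‖μ‖ * ‖μ‖ ^ 2 = ε / 2 * ‖μ‖ := by field_simp
      rw [inner_sub_left]
      linarith
  have htend : Tendsto Φ (cocompact (EuclideanSpace ℝ (Fin d))) atTop := by
    refine tendsto_atTop_mono hlow (Real.tendsto_exp_atTop.comp ?_)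
    refine tendsto_atTop_add_const_right _ _ ?_
    exact (tendsto_norm_cocompact_atTop).const_mul_atTop (by positivity)
  obtain ⟨μ, hμ⟩ := hΦc.exists_forall_le htend
  refine ⟨μ, ?_⟩
  have hder : HasFDerivAt Φ (∑ a : P,
      Real.exp (inner ℝ ((a : EuclideanSpace ℝ (Fin d)) - x) μ -
      β * ‖(a : EuclideanSpace ℝ (Fin d))‖ ^ 2) •
        innerSL ℝ ((a : EuclideanSpace ℝ (Fin d)) - x)) μ := by
    refine HasFDerivAt.fun_sum fun a _ => ?_
    refine HasFDerivAt.exp (f := fun μ => inner ℝ ((a : EuclideanSpace ℝ (Fin d)) - x) μ -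
      β * ‖(a : EuclideanSpace ℝ (Fin d))‖ ^ 2) ?_
    exact ((innerSL ℝ ((a : EuclideanSpace ℝ (Fin d)) - x)).hasFDerivAt).sub_const _
  have hzero := IsLocalMin.hasFDerivAt_eq_zero (Filter.Eventually.of_forall hμ) hder
  have hfac : ∀ a : P, Real.exp (inner ℝ ((a : EuclideanSpace ℝ (Fin d)) - x) μ -
      β * ‖(a : EuclideanSpace ℝ (Fin d))‖ ^ 2) =
      Real.exp (-inner ℝ x μ) * gibbsPartition β P μ * gibbsWeight β P a μ := by
    intro a
    rw [gibbsWeight, mul_assoc, mul_div_cancel₀ _ (gibbsPartition_pos hP μ).ne', gibbsFactor,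
      ← Real.exp_add, inner_sub_left]
    congr 1
    ring
  have hsum : ∑ a : P, gibbsWeight β P a μ • ((a : EuclideanSpace ℝ (Fin d)) - x) = 0 := by
    refine ext_inner_right ℝ fun y => ?_
    have h1 := congrArg (fun L => L y) hzero
    simp only [hfac, sum_apply, smul_apply,
      innerSL_apply_apply, smul_eq_mul, zero_apply, mul_assoc] at h1
    rw [← Finset.mul_sum, ← Finset.mul_sum] at h1
    have h2 := (mul_eq_zero.1 h1).resolve_left (Real.exp_pos _).ne'
    have h3 := (mul_eq_zero.1 h2).resolve_left (gibbsPartition_pos hP μ).ne'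
    simpa [sum_inner, real_inner_smul_left] using h3
  simp only [smul_sub, Finset.sum_sub_distrib, ← Finset.sum_smul, sum_gibbsWeight hP,
    one_smul] at hsum
  exact sub_eq_zero.1 hsum

/-- On feasible weights the objective with `log w` replaced by the logarithm of the Gibbs weight is
a constant, since that logarithm is affine in the node up to the term `-β|a|²`. The comparison of
objectives thus reduces to the nonnegativity of relative entropy. -/
theorem isLMEWeights_gibbsWeight (hβ : 0 < β) (hP : P.Nonempty) (μ : EuclideanSpace ℝ (Fin d)) :
    IsLMEWeights β P (gibbsMean β P μ) (fun a => gibbsWeight β P a μ) := by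
  set x := gibbsMean β P μ with hx
  have hfeas : (fun a => gibbsWeight β P a μ) ∈ lmeFeasible P x :=
    ⟨fun a => (gibbsWeight_pos hP μ a).le, sum_gibbsWeight hP μ, rfl⟩
  have hlog : ∀ a : P, Real.log (gibbsWeight β P a μ) =
      inner ℝ (a : EuclideanSpace ℝ (Fin d)) μ - β * ‖(a : EuclideanSpace ℝ (Fin d))‖ ^ 2 -
        Real.log (gibbsPartition β P μ) := by
    intro a
    rw [gibbsWeight, Real.log_div (gibbsFactor_pos μ a).ne' (gibbsPartition_pos hP μ).ne',
      gibbsFactor, Real.log_exp]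
  have key : ∀ w ∈ lmeFeasible P x, ∑ a, w a * ‖x - (a : EuclideanSpace ℝ (Fin d))‖ ^ 2 +
      1 / β * ∑ a, w a * Real.log (gibbsWeight β P a μ) =
      -‖x‖ ^ 2 + 1 / β * (inner ℝ x μ - Real.log (gibbsPartition β P μ)) := by
    rintro w ⟨h0, h1, h2⟩
    have e1 : ∑ a, w a * inner ℝ (a : EuclideanSpace ℝ (Fin d)) μ = inner ℝ x μ := by
      rw [← h2, sum_inner]
      simp [real_inner_smul_left]
    have e2 : ∑ a, w a * inner ℝ x (a : EuclideanSpace ℝ (Fin d)) = ‖x‖ ^ 2 := by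
      rw [← real_inner_self_eq_norm_sq, ← h2, inner_sum, h2]
      simp [real_inner_smul_right]
    simp only [hlog, norm_sub_sq_real, mul_sub, mul_add, Finset.sum_sub_distrib,
      Finset.sum_add_distrib, ← Finset.sum_mul, h1, e1]
    have e3 : ∑ a, w a * (2 * inner ℝ x (a : EuclideanSpace ℝ (Fin d))) = 2 * ‖x‖ ^ 2 := by
      rw [← e2, Finset.mul_sum]
      exact Finset.sum_congr rfl fun a _ => by ring
    have e4 : ∑ a, w a * (β * ‖(a : EuclideanSpace ℝ (Fin d))‖ ^ 2) =
        β * ∑ a, w a * ‖(a : EuclideanSpace ℝ (Fin d))‖ ^ 2 := by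
      rw [Finset.mul_sum]
      exact Finset.sum_congr rfl fun a _ => by ring
    rw [e3, e4]
    field_simp
    ring
  refine ⟨hfeas, fun w hw => ?_⟩
  have hgibbs : ∑ a, w a * Real.log (gibbsWeight β P a μ) ≤ ∑ a, w a * Real.log (w a) := by
    -- This is `log z ≤ z - 1` at the ratio of the two weights; the linear corrections cancel in the
    -- sum, both families having total mass one.
    have : ∀ a : P, w a * Real.log (gibbsWeight β P a μ) + (w a - gibbsWeight β P a μ) ≤
        w a * Real.log (w a) := by
      intro a
      have hp := gibbsWeight_pos (β := β) hP μ a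
      rcases (hw.1 a).eq_or_lt with h | h
      · simp [← h, hp.le]
      · have := Real.log_le_sub_one_of_pos (div_pos hp h)
        rw [Real.log_div hp.ne' h.ne'] at this
        have h' := mul_le_mul_of_nonneg_left this h.le
        have e : w a * (gibbsWeight β P a μ / w a - 1) = gibbsWeight β P a μ - w a := by
          field_simp
        linarith
    have h := Finset.sum_le_sum fun a (_ : a ∈ Finset.univ) => this a
    rw [Finset.sum_add_distrib, Finset.sum_sub_distrib, hw.2.1, sum_gibbsWeight hP] at h
    linarith
  have h1 := key _ hfeas
  have h2 := key w hw
  have h3 := mul_le_mul_of_nonneg_left hgibbs (by positivity : 0 ≤ 1 / β)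
  simp only [lmeObjective]
  linarith

theorem gibbsMean_mem_convexHull (hP : P.Nonempty) (μ : EuclideanSpace ℝ (Fin d)) :
    gibbsMean β P μ ∈ convexHull ℝ (P : Set (EuclideanSpace ℝ (Fin d))) :=
  (convex_convexHull ℝ _).sum_mem (fun a _ => (gibbsWeight_pos hP μ a).le) (sum_gibbsWeight hP μ)
    fun a _ => subset_convexHull ℝ _ a.2

theorem lmeShape_gibbsMean (hβ : 0 < β) (hP : P.Nonempty) (μ : EuclideanSpace ℝ (Fin d)) (a : P) :
    lmeShape β P a (gibbsMean β P μ) = gibbsWeight β P a μ := by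
  have h := isLMEWeights_gibbsWeight hβ hP μ
  have hex : ∃ w, IsLMEWeights β P (gibbsMean β P μ) w := ⟨_, h⟩
  rw [lmeShape, dif_pos hex]
  exact congrFun ((existsUnique_isLMEWeights hβ P (gibbsMean_mem_convexHull hP μ)).unique
    hex.choose_spec h) a

/-- Around an interior point the nodes spread in every direction: for `y ≠ 0` some node satisfies
`(a - x)·y > 0`. This makes the covariance definite. -/
theorem eq_zero_of_inner_eq_zero {x y : EuclideanSpace ℝ (Fin d)}
    (hx : x ∈ interior (convexHull ℝ (P : Set (EuclideanSpace ℝ (Fin d)))))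
    (h : ∀ a ∈ P, inner ℝ (a - x) y = 0) : y = 0 := by
  obtain ⟨ε, hε, hball⟩ := Metric.isOpen_iff.1 isOpen_interior x hx
  by_contra hy
  have hy' : 0 < ‖y‖ := norm_pos_iff.2 hy
  have hz : x + (ε / 2 / ‖y‖) • y ∈ convexHull ℝ (P : Set (EuclideanSpace ℝ (Fin d))) := by
    refine interior_subset (hball ?_)
    simp only [Metric.mem_ball, dist_self_add_left, norm_smul, norm_div, norm_norm]
    rw [div_mul_cancel₀ _ hy'.ne', Real.norm_of_nonneg (by positivity)]
    norm_num
    linarith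
  obtain ⟨a, ha, hle⟩ := exists_inner_ge_of_mem_convexHull (μ := y) hz
  have := h a ha
  rw [inner_sub_left] at this
  rw [inner_add_left, real_inner_smul_left, real_inner_self_eq_norm_sq] at hle
  have : 0 < ε / 2 / ‖y‖ * ‖y‖ ^ 2 := by positivity
  linarith

/-- Near an interior point, the shape functions are smooth functions of a smooth parameter. -/
theorem exists_gibbs_parametrization {x : EuclideanSpace ℝ (Fin d)}
    (hx : x ∈ interior (convexHull ℝ (P : Set (EuclideanSpace ℝ (Fin d))))) :
    ∃ g : EuclideanSpace ℝ (Fin d) → EuclideanSpace ℝ (Fin d), ContDiffAt ℝ ∞ g x ∧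
      ∀ᶠ y in 𝓝 x, gibbsMean β P (g y) = y := by
  have hP : P.Nonempty := by
    have := convexHull_nonempty_iff.1 ⟨x, interior_subset hx⟩
    simpa using this
  obtain ⟨μ, hμ⟩ := exists_gibbsMean_eq (β := β) hx
  let L := fderiv ℝ (gibbsMean β P) μ
  -- `L` is the covariance, so `L y · y` is a sum of positively weighted squares; if it vanishes,
  -- `y` is orthogonal to every `a - x`.
  have hinj : Function.Injective (L : EuclideanSpace ℝ (Fin d) →ₗ[ℝ] EuclideanSpace ℝ (Fin d)) := by
    rw [← LinearMap.ker_eq_bot, LinearMap.ker_eq_bot']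
    intro y hy
    have h1 : inner ℝ (L y) y = 0 := by
      rw [show L y = 0 from hy, inner_zero_left]
    rw [show L y = _ from fderiv_gibbsMean hP μ y, sum_inner, hμ] at h1
    simp only [real_inner_smul_left] at h1
    rw [Finset.sum_eq_zero_iff_of_nonneg] at h1
    · refine eq_zero_of_inner_eq_zero hx fun a ha => ?_
      have h2 := h1 ⟨a, ha⟩ (Finset.mem_univ _)
      have h3 := gibbsWeight_pos (β := β) hP μ ⟨a, ha⟩
      simp only [mul_assoc, mul_eq_zero, h3.ne', false_or, or_self] at h2
      exact h2
    · intro a _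
      have h3 := gibbsWeight_pos (β := β) hP μ a
      rw [mul_assoc]
      exact mul_nonneg h3.le (mul_self_nonneg _)
  let e := (LinearEquiv.ofInjectiveEndo _ hinj).toContinuousLinearEquiv
  have he : (e : EuclideanSpace ℝ (Fin d) →L[ℝ] EuclideanSpace ℝ (Fin d)) = L := by
    ext y
    rfl
  have hc : ContDiffAt ℝ ∞ (gibbsMean β P) μ := (contDiff_gibbsMean hP).contDiffAt
  have hd : HasFDerivAt (gibbsMean β P)
      (e : EuclideanSpace ℝ (Fin d) →L[ℝ] EuclideanSpace ℝ (Fin d)) μ := by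
    rw [he]
    exact (hc.differentiableAt (by simp)).hasFDerivAt
  have h1 := hc.to_localInverse hd (by simp)
  have h2 := (hc.hasStrictFDerivAt' hd (by simp)).eventually_right_inverse
  rw [hμ] at h1 h2
  exact ⟨_, h1, h2⟩

theorem contDiffAt_lmeShape (hβ : 0 < β) {x : EuclideanSpace ℝ (Fin d)}
    (hx : x ∈ interior (convexHull ℝ (P : Set (EuclideanSpace ℝ (Fin d))))) (a : P) :
    ContDiffAt ℝ ∞ (lmeShape β P a) x := by
  have hP : P.Nonempty := ⟨a, a.2⟩
  obtain ⟨g, hg, hev⟩ := exists_gibbs_parametrization (β := β) hx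
  refine ((contDiff_gibbsWeight (β := β) hP a).contDiffAt.comp x hg).congr_of_eventuallyEq ?_
  filter_upwards [hev] with y hy
  conv_lhs => rw [← hy]
  exact lmeShape_gibbsMean hβ hP _ a

/-- The gradient of a combination of shape functions solves a linear system with the covariance
matrix of the weights. -/
theorem fderiv_sum_lmeShape (hβ : 0 < β) {x : EuclideanSpace ℝ (Fin d)}
    (hx : x ∈ interior (convexHull ℝ (P : Set (EuclideanSpace ℝ (Fin d))))) (c : P → ℝ)
    (y : EuclideanSpace ℝ (Fin d)) :
    fderiv ℝ (fun z => ∑ a, c a * lmeShape β P a z) x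
      (∑ a, (lmeShape β P a x * inner ℝ ((a : EuclideanSpace ℝ (Fin d)) - x) y) •
        ((a : EuclideanSpace ℝ (Fin d)) - x)) =
      ∑ a, c a * (lmeShape β P a x * inner ℝ ((a : EuclideanSpace ℝ (Fin d)) - x) y) := by
  have hP : P.Nonempty := by
    have := convexHull_nonempty_iff.1 ⟨x, interior_subset hx⟩
    simpa using this
  obtain ⟨μ, rfl⟩ := exists_gibbsMean_eq (β := β) hx
  have hv : DifferentiableAt ℝ (fun z => ∑ a, c a * lmeShape β P a z) (gibbsMean β P μ) :=
    DifferentiableAt.fun_sum fun a _ =>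
      ((contDiffAt_lmeShape hβ hx a).differentiableAt (by simp)).const_mul _
  have hm : DifferentiableAt ℝ (gibbsMean β P) μ :=
    (contDiff_gibbsMean hP).contDiffAt.differentiableAt (by simp)
  -- Composed with the mean map, the shape functions become Gibbs weights with explicit derivatives.
  -- The chain rule then yields the system without inverting the covariance.
  have h1 := fderiv_comp μ hv hm
  have h2 : (fun z => ∑ a, c a * lmeShape β P a z) ∘ gibbsMean β P =
      fun μ => ∑ a, c a * gibbsWeight β P a μ := by
    ext μ
    simp [lmeShape_gibbsMean hβ hP]
  have hd : ∀ b : P, DifferentiableAt ℝ (gibbsWeight β P b) μ := fun b =>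
    (contDiff_gibbsWeight hP b).contDiffAt.differentiableAt (by simp)
  have h3 : HasFDerivAt (fun μ => ∑ a, c a * gibbsWeight β P a μ)
      (∑ a, c a • fderiv ℝ (gibbsWeight β P a) μ) μ :=
    HasFDerivAt.fun_sum fun b _ => (hd b).hasFDerivAt.const_mul _
  rw [h2, h3.fderiv] at h1
  have h4 := congrArg (fun L => L y) h1
  simp only [sum_apply, smul_apply, smul_eq_mul,
    ContinuousLinearMap.comp_apply, fderiv_gibbsWeight hP, fderiv_gibbsMean hP] at h4
  simp only [lmeShape_gibbsMean hβ hP]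
  exact h4.symm

/-- At an interior point the weights are a Gaussian times the exponential of an affine function. -/
theorem exists_lmeShape_eq_exp (hβ : 0 < β) {x : EuclideanSpace ℝ (Fin d)}
    (hx : x ∈ interior (convexHull ℝ (P : Set (EuclideanSpace ℝ (Fin d))))) :
    ∃ (c : ℝ) (l : EuclideanSpace ℝ (Fin d)), ∀ a : P, lmeShape β P a x =
      Real.exp (c + inner ℝ l ((a : EuclideanSpace ℝ (Fin d)) - x) -
        β * ‖(a : EuclideanSpace ℝ (Fin d)) - x‖ ^ 2) := by
  have hP : P.Nonempty := by
    have := convexHull_nonempty_iff.1 ⟨x, interior_subset hx⟩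
    simpa using this
  obtain ⟨μ, hμ⟩ := exists_gibbsMean_eq (β := β) hx
  -- Completing the square around `x` changes the tilt from `μ` to `μ - 2βx` and leaves the rest in
  -- the constant.
  refine ⟨inner ℝ x μ - β * ‖x‖ ^ 2 - Real.log (gibbsPartition β P μ), μ - (2 * β) • x, ?_⟩
  intro a
  have h := lmeShape_gibbsMean hβ hP μ a
  rw [hμ] at h
  rw [h, gibbsWeight, gibbsFactor]
  nth_rw 1 [← Real.exp_log (gibbsPartition_pos (β := β) hP μ)]
  rw [← Real.exp_sub]
  congr 1
  rw [norm_sub_sq_real, inner_sub_left, inner_sub_right, inner_sub_right, real_inner_smul_left,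
    real_inner_smul_left, real_inner_comm x (a : EuclideanSpace ℝ (Fin d)),
    real_inner_comm x μ, real_inner_comm μ (a : EuclideanSpace ℝ (Fin d)),
    real_inner_self_eq_norm_sq]
  rw [real_inner_comm (a : EuclideanSpace ℝ (Fin d)) x]
  ring

theorem lmeShape_mem_lmeFeasible (hβ : 0 < β) {x : EuclideanSpace ℝ (Fin d)}
    (hx : x ∈ interior (convexHull ℝ (P : Set (EuclideanSpace ℝ (Fin d))))) :
    (fun a => lmeShape β P a x) ∈ lmeFeasible P x := by
  have hP : P.Nonempty := by
    have := convexHull_nonempty_iff.1 ⟨x, interior_subset hx⟩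
    simpa using this
  obtain ⟨μ, rfl⟩ := exists_gibbsMean_eq (β := β) hx
  simp only [lmeShape_gibbsMean hβ hP]
  exact (isLMEWeights_gibbsWeight hβ hP μ).1

end Gibbs

/-! ### Linear systems with a weighted covariance matrix -/

section WeightedSystem

variable {E : Type*} [NormedAddCommGroup E] [InnerProductSpace ℝ E]

/-- Testing the system with `y = G` gives the quadratic form `∑ w (b·G)²` on the left. One node in
the direction of `G` bounds it below by `κ(ρ‖G‖)²`, while the third moment bounds the right-hand
side by `M K ‖G‖`. -/
theorem norm_le_of_covariance_system {ι : Type*} [Fintype ι] {w : ι → ℝ} {b : ι → E} {r : ι → ℝ}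
    {G : E} {κ ρ M K : ℝ} (hκ : 0 < κ) (hρ : 0 < ρ) (hM : 0 ≤ M) (hw : ∀ a, 0 ≤ w a)
    (hK : ∑ a, w a * ‖b a‖ ^ 3 ≤ K) (hr : ∀ a, |r a| ≤ M * ‖b a‖ ^ 2)
    (hnode : ∀ e : E, ‖e‖ = 1 → ∃ a, κ ≤ w a ∧ ρ ≤ inner ℝ e (b a))
    (hG : ∀ y : E, ∑ a, w a * inner ℝ (b a) y * inner ℝ G (b a) =
      ∑ a, r a * (w a * inner ℝ (b a) y)) :
    ‖G‖ ≤ M * K / (κ * ρ ^ 2) := by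
  have hK0 : 0 ≤ K := le_trans (Finset.sum_nonneg fun a _ => by have := hw a; positivity) hK
  by_cases hG0 : G = 0
  · rw [hG0, norm_zero]
    positivity
  have hGpos : 0 < ‖G‖ := norm_pos_iff.2 hG0
  obtain ⟨a, ha, hab⟩ := hnode (‖G‖⁻¹ • G) (norm_smul_inv_norm hG0)
  rw [real_inner_smul_left, inv_mul_eq_div, le_div_iff₀ hGpos] at hab
  have h1 : κ * (ρ * ‖G‖) ^ 2 ≤ ∑ a, w a * inner ℝ (b a) G * inner ℝ G (b a) := by
    have h2 : w a * inner ℝ (b a) G * inner ℝ G (b a) ≤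
        ∑ a, w a * inner ℝ (b a) G * inner ℝ G (b a) :=
      Finset.single_le_sum (f := fun a => w a * inner ℝ (b a) G * inner ℝ G (b a))
        (fun c _ => by
          rw [real_inner_comm G, mul_assoc]
          exact mul_nonneg (hw c) (mul_self_nonneg _)) (Finset.mem_univ a)
    refine le_trans ?_ h2
    rw [real_inner_comm G, mul_assoc, ← sq]
    have := hw a
    gcongr
  have h3 : ∑ a, r a * (w a * inner ℝ (b a) G) ≤ M * K * ‖G‖ := by
    calc ∑ a, r a * (w a * inner ℝ (b a) G) ≤ ∑ a, M * (w a * ‖b a‖ ^ 3) * ‖G‖ := by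
          refine Finset.sum_le_sum fun a _ => ?_
          calc r a * (w a * inner ℝ (b a) G) ≤ |r a * (w a * inner ℝ (b a) G)| := le_abs_self _
            _ = |r a| * (w a * |inner ℝ (b a) G|) := by
              rw [abs_mul, abs_mul, abs_of_nonneg (hw a)]
            _ ≤ M * ‖b a‖ ^ 2 * (w a * (‖b a‖ * ‖G‖)) := by
              have := hw a
              gcongr
              · exact hr a
              · exact abs_real_inner_le_norm _ _
            _ = _ := by ring
      _ = M * (∑ a, w a * ‖b a‖ ^ 3) * ‖G‖ := by
          rw [Finset.mul_sum, Finset.sum_mul]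
      _ ≤ _ := by gcongr
  rw [hG] at h1
  have h4 := h1.trans h3
  rw [le_div_iff₀ (by positivity)]
  refine le_of_mul_le_mul_right ?_ hGpos
  linarith [h4]

/-- The solution of a covariance system when the covariance degenerates in one direction `n`,
as happens at a distance `s ^ 4` from a facet that carries nodes. -/
theorem exists_norm_le_of_degenerate_covariance_system {κ ρ η M K : ℝ} (hκ : 0 < κ) (hρ : 0 < ρ)
    (hη : 0 < η) (hM : 0 ≤ M) (hK : 0 ≤ K) :
    ∃ C : ℝ, 0 ≤ C ∧ ∀ {ι : Type} [Fintype ι] (w : ι → ℝ) (b : ι → E) (r : ι → ℝ) (G n : E)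
      (s : ℝ), 0 < s → s ≤ 1 → s ^ 4 ≤ η / 2 → ‖n‖ = 1 → (∀ a, 0 ≤ w a) → ∑ a, w a = 1 →
      ∑ a, w a • b a = 0 → ∑ a, w a * (1 + ‖b a‖) ^ 9 ≤ K →
      (∀ a, |r a| ≤ M * ‖b a‖ ^ 2) →
      (∀ a, inner ℝ n (b a) + s ^ 4 = 0 ∨ η ≤ inner ℝ n (b a) + s ^ 4) →
      (∀ e : E, ‖e‖ = 1 → inner ℝ n e = 0 →
        ∃ a, κ ≤ w a ∧ inner ℝ n (b a) + s ^ 4 = 0 ∧ ρ ≤ inner ℝ e (b a)) →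
      (∀ y : E, ∑ a, w a * inner ℝ (b a) y * inner ℝ G (b a) =
        ∑ a, r a * (w a * inner ℝ (b a) y)) →
      ‖G‖ ≤ C / s := by
  set c₁ := κ * ρ ^ 2 with hc₁
  set c₂ := η / 4 / (1 + K / c₁) with hc₂
  set B := M * (1 + 2 * K) with hB
  have hc₁0 : 0 < c₁ := by positivity
  have hc₂0 : 0 < c₂ := by positivity
  have hB0 : 0 ≤ B := by positivity
  set c := min c₁ c₂ with hc
  have hc0 : 0 < c := lt_min hc₁0 hc₂0
  set D := 4 * B / c with hD
  have hD0 : 0 ≤ D := by positivity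
  refine ⟨D + 2 * (B + D * (1 + K)) / η, by positivity, ?_⟩
  intro ι _ w b r G n s hs hs1 hsη hn hw hw1 hwb hmom hr hν hnode hG
  set t := s ^ 4 with ht
  have ht0 : 0 < t := by positivity
  have hts : t ≤ s ^ 3 := by
    rw [ht, pow_succ]
    exact mul_le_of_le_one_right (by positivity) hs1
  -- In the application `ν a` is the height of the node over the facet in units of `h`, and `t` is
  -- that of the barycenter; hence `ν` has mean `t`.
  set ν : ι → ℝ := fun a => inner ℝ n (b a) + t with hνdef
  have hν0 : ∀ a, 0 ≤ ν a := fun a => by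
    rcases hν a with h | h
    · exact h.ge
    · exact hη.le.trans h
  have hνb : ∀ a, ν a ≤ 1 + ‖b a‖ := by
    intro a
    have h1 : inner ℝ n (b a) ≤ ‖b a‖ := by
      have := real_inner_le_norm n (b a)
      rwa [hn, one_mul] at this
    have h2 : t ≤ 1 := pow_le_one₀ hs.le hs1
    simp only [hνdef]
    linarith
  -- moments
  have hmom' : ∀ f : ι → ℝ, (∀ a, f a ≤ (1 + ‖b a‖) ^ 9) → ∑ a, w a * f a ≤ K := fun f hf =>
    le_trans (Finset.sum_le_sum fun a _ => mul_le_mul_of_nonneg_left (hf a) (hw a)) hmom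
  have hpow : ∀ a (j : ℕ), j ≤ 9 → ‖b a‖ ^ j ≤ (1 + ‖b a‖) ^ 9 := fun a j hj =>
    (pow_le_pow_left₀ (norm_nonneg _) (by linarith) j).trans
      (pow_le_pow_right₀ (by linarith [norm_nonneg (b a)]) hj)
  have hmj : ∀ j : ℕ, j ≤ 9 → ∑ a, w a * ‖b a‖ ^ j ≤ K := fun j hj => hmom' _ fun a => hpow a j hj
  have hF0 : ∑ a, w a * ν a = t := by
    have h1 : inner ℝ n (∑ a, w a • b a) = ∑ a, w a * inner ℝ n (b a) := by
      simp [inner_sum, real_inner_smul_right]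
    rw [hwb, inner_zero_right] at h1
    simp only [hνdef, mul_add, Finset.sum_add_distrib, ← Finset.sum_mul, hw1, ← h1]
    ring
  -- The mean of `ν` is `s⁴`. To insert a factor `f = ‖b‖^j`, use `f ≤ s⁻¹ + s³ f⁴`, which costs one
  -- power of `s`. Since `ν ≤ 1 + ‖b‖` and `j ≤ 2`, the degree reaches `1 + 8 = 9`, whence the
  -- moment of order nine.
  have hF1 : ∀ j : ℕ, j ≤ 2 → ∑ a, w a * (ν a * ‖b a‖ ^ j) ≤ (1 + K) * s ^ 3 := by
    intro j hj
    have h1 : ∀ a, w a * (ν a * ‖b a‖ ^ j) ≤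
        w a * ν a * s⁻¹ + s ^ 3 * (w a * ((1 + ‖b a‖) * (1 + ‖b a‖) ^ 8)) := by
      intro a
      have h2 : ∀ f : ℝ, 0 ≤ f → f ≤ s⁻¹ + s ^ 3 * f ^ 4 := by
        intro f hf
        rcases le_total f s⁻¹ with h | h
        · have : 0 ≤ s ^ 3 * f ^ 4 := by positivity
          linarith
        · have h3 : 1 ≤ s * f := by
            have := mul_le_mul_of_nonneg_left h hs.le
            rwa [mul_inv_cancel₀ hs.ne'] at this
          have h4 : 1 ≤ (s * f) ^ 3 := one_le_pow₀ h3
          have h5 : s ^ 3 * f ^ 4 = (s * f) ^ 3 * f := by ring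
          have h6 : f ≤ (s * f) ^ 3 * f := le_mul_of_one_le_left hf h4
          have : 0 < s⁻¹ := by positivity
          linarith
      have h3 : (‖b a‖ ^ j) ^ 4 ≤ (1 + ‖b a‖) ^ 8 := by
        rw [← pow_mul]
        exact (pow_le_pow_left₀ (norm_nonneg _) (by linarith) _).trans
          (pow_le_pow_right₀ (by linarith [norm_nonneg (b a)]) (by omega))
      have h4 : ν a * (‖b a‖ ^ j) ≤ ν a * s⁻¹ + s ^ 3 * ((1 + ‖b a‖) * (1 + ‖b a‖) ^ 8) := by
        calc ν a * ‖b a‖ ^ j ≤ ν a * (s⁻¹ + s ^ 3 * (‖b a‖ ^ j) ^ 4) :=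
              mul_le_mul_of_nonneg_left (h2 _ (by positivity)) (hν0 a)
          _ = ν a * s⁻¹ + s ^ 3 * (ν a * (‖b a‖ ^ j) ^ 4) := by ring
          _ ≤ _ := by
              have := hνb a
              gcongr
      have := mul_le_mul_of_nonneg_left h4 (hw a)
      linarith
    refine (Finset.sum_le_sum fun a _ => h1 a).trans ?_
    rw [Finset.sum_add_distrib, ← Finset.sum_mul, hF0, ← Finset.mul_sum]
    have h5 : ∑ a, w a * ((1 + ‖b a‖) * (1 + ‖b a‖) ^ 8) ≤ K := hmom' _ fun a => by
      rw [← pow_succ']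
    have h6 : t * s⁻¹ = s ^ 3 := by rw [ht]; field_simp
    rw [h6]
    have := mul_le_mul_of_nonneg_left h5 (by positivity : 0 ≤ s ^ 3)
    linarith
  set V := ∑ a, w a * (ν a - t) ^ 2 with hV
  -- The gap enters here: `ν` is zero or at least `η`, so `ν² ≥ ην` and the variance is bounded
  -- below by a multiple of the mean.
  have hF2 : η * t / 2 ≤ V := by
    have h1 : ∑ a, w a * (η * ν a) ≤ ∑ a, w a * ν a ^ 2 := by
      refine Finset.sum_le_sum fun a _ => mul_le_mul_of_nonneg_left ?_ (hw a)
      rcases hν a with h | h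
      · rw [show ν a = 0 from h]
        simp
      · rw [sq]
        exact mul_le_mul_of_nonneg_right h (hν0 a)
    have h2 : V = ∑ a, w a * ν a ^ 2 - t ^ 2 := by
      have : ∀ a, w a * (ν a - t) ^ 2 = w a * ν a ^ 2 - 2 * t * (w a * ν a) + t ^ 2 * w a :=
        fun a => by ring
      rw [hV, Finset.sum_congr rfl fun a _ => this a, Finset.sum_add_distrib,
        Finset.sum_sub_distrib, ← Finset.mul_sum, ← Finset.mul_sum, hF0, hw1]
      ring
    have h3 : ∑ a, w a * (η * ν a) = η * t := by
      rw [← hF0, Finset.mul_sum]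
      exact Finset.sum_congr rfl fun a _ => by ring
    have h4 : t ^ 2 ≤ η / 2 * t := by
      rw [sq]
      exact mul_le_mul_of_nonneg_right hsη ht0.le
    rw [h3] at h1
    linarith
  -- decomposition of `G`
  set g := inner ℝ n G with hg
  set T := G - g • n with hT
  set A := ‖T‖ with hA
  have hA0 : 0 ≤ A := norm_nonneg _
  have hnT : inner ℝ n T = 0 := by
    rw [hT, inner_sub_right, real_inner_smul_right, real_inner_self_eq_norm_sq, hn]
    simp [hg]
  have hGT : G = T + g • n := by rw [hT]; abel
  have hbG : ∀ a, inner ℝ (b a) G = inner ℝ (b a) T + g * (ν a - t) := by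
    intro a
    conv_lhs => rw [hGT]
    rw [inner_add_right, real_inner_smul_right, real_inner_comm]
    simp [hνdef, real_inner_comm]
  have hGb : ∀ a, inner ℝ G (b a) = inner ℝ (b a) T + g * (ν a - t) := fun a => by
    rw [real_inner_comm, hbG]
  have hbT : ∀ a, |inner ℝ (b a) T| ≤ ‖b a‖ * A := fun a => abs_real_inner_le_norm _ _
  set Q := ∑ a, w a * (inner ℝ (b a) T + g * (ν a - t)) ^ 2 with hQ
  have hQG : Q = ∑ a, r a * (w a * (inner ℝ (b a) T + g * (ν a - t))) := by
    have := hG G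
    simp only [hGb, hbG] at this
    rw [← this, hQ]
    exact Finset.sum_congr rfl fun a _ => by ring
  have hQ1 : c₁ * A ^ 2 ≤ Q := by
    rcases hA0.eq_or_lt with h | h
    · rw [← h]
      simp only [ne_eq, OfNat.ofNat_ne_zero, not_false_eq_true, zero_pow, mul_zero]
      exact Finset.sum_nonneg fun a _ => mul_nonneg (hw a) (sq_nonneg _)
    · have hT0 : T ≠ 0 := norm_pos_iff.1 h
      have h1 : ∃ a, κ ≤ w a ∧ (ρ * A) ^ 2 ≤ (inner ℝ (b a) T + g * (ν a - t)) ^ 2 := by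
        -- A node on the facet contributes `b·T - g t`. Its direction is taken as `T` or `-T`
        -- according to the sign of `g`, so that the two terms reinforce each other.
        rcases le_total 0 g with hg0 | hg0
        · obtain ⟨a, h2, h3, h4⟩ := hnode (-(‖T‖⁻¹ • T))
            (by rw [norm_neg]; exact norm_smul_inv_norm hT0)
            (by rw [inner_neg_right, real_inner_smul_right, hnT]; simp)
          refine ⟨a, h2, ?_⟩
          rw [inner_neg_left, real_inner_smul_left, ← mul_neg, inv_mul_eq_div,
            le_div_iff₀ h, real_inner_comm] at h4
          rw [show ν a = 0 from h3]
          have : 0 ≤ g * t := by positivity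
          rw [← neg_sq (inner ℝ (b a) T + _)]
          have : 0 ≤ ρ * A := by positivity
          gcongr
          linarith
        · obtain ⟨a, h2, h3, h4⟩ := hnode (‖T‖⁻¹ • T)
            (norm_smul_inv_norm hT0)
            (by rw [real_inner_smul_right, hnT]; simp)
          refine ⟨a, h2, ?_⟩
          rw [real_inner_smul_left, inv_mul_eq_div, le_div_iff₀ h, real_inner_comm] at h4
          rw [show ν a = 0 from h3]
          have : 0 ≤ -g * t := mul_nonneg (by linarith) ht0.le
          have : 0 ≤ ρ * A := by positivity
          gcongr
          linarith
      obtain ⟨a, h2, h3⟩ := h1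
      calc c₁ * A ^ 2 = κ * (ρ * A) ^ 2 := by rw [hc₁]; ring
        _ ≤ w a * (inner ℝ (b a) T + g * (ν a - t)) ^ 2 := by
          have := hw a
          gcongr
        _ ≤ Q := Finset.single_le_sum
          (f := fun a => w a * (inner ℝ (b a) T + g * (ν a - t)) ^ 2)
          (fun a _ => mul_nonneg (hw a) (sq_nonneg _)) (Finset.mem_univ a)
  have hQ0 : 0 ≤ Q := le_trans (by positivity) hQ1
  have hQ2 : c₂ * (g ^ 2 * t) ≤ Q := by
    -- By `(p + q)² ≥ q²/2 - p²`; the tangential loss is then absorbed by `hQ1`.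
    have h1 : g ^ 2 / 2 * V - K * A ^ 2 ≤ Q := by
      have h2 : ∑ a, w a * inner ℝ (b a) T ^ 2 ≤ K * A ^ 2 := by
        calc ∑ a, w a * inner ℝ (b a) T ^ 2 ≤ ∑ a, w a * ‖b a‖ ^ 2 * A ^ 2 := by
              refine Finset.sum_le_sum fun a _ => ?_
              rw [mul_assoc, ← mul_pow]
              refine mul_le_mul_of_nonneg_left ?_ (hw a)
              exact sq_le_sq' (abs_le.1 (hbT a)).1 (abs_le.1 (hbT a)).2
          _ = (∑ a, w a * ‖b a‖ ^ 2) * A ^ 2 := by rw [Finset.sum_mul]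
          _ ≤ _ := by
            have := hmj 2 (by norm_num)
            gcongr
      have h3 : g ^ 2 / 2 * V - ∑ a, w a * inner ℝ (b a) T ^ 2 ≤ Q := by
        rw [hV, hQ, Finset.mul_sum, ← Finset.sum_sub_distrib]
        refine Finset.sum_le_sum fun a _ => ?_
        have h4 : 0 ≤ w a * (2 * inner ℝ (b a) T + g * (ν a - t)) ^ 2 :=
          mul_nonneg (hw a) (sq_nonneg _)
        linarith
      linarith
    have h2 : K * A ^ 2 ≤ K / c₁ * Q := by
      have := mul_le_mul_of_nonneg_left hQ1 (by positivity : 0 ≤ K / c₁)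
      rwa [← mul_assoc, div_mul_cancel₀ _ hc₁0.ne'] at this
    have h3 : g ^ 2 / 2 * (η * t / 2) ≤ g ^ 2 / 2 * V := by gcongr
    have h4 : g ^ 2 * t * (η / 4) ≤ (1 + K / c₁) * Q := by linarith
    rw [hc₂, div_mul_eq_mul_div, div_le_iff₀ (by positivity)]
    linarith
  have hrw : ∀ f : ι → ℝ, |∑ a, r a * (w a * f a)| ≤ M * ∑ a, w a * (‖b a‖ ^ 2 * |f a|) := by
    intro f
    refine (Finset.abs_sum_le_sum_abs _ _).trans ?_
    rw [Finset.mul_sum]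
    refine Finset.sum_le_sum fun a _ => ?_
    rw [abs_mul, abs_mul, abs_of_nonneg (hw a)]
    have := mul_le_mul_of_nonneg_right (hr a) (mul_nonneg (hw a) (abs_nonneg (f a)))
    linarith
  have hrν : |∑ a, r a * (w a * (ν a - t))| ≤ B * s ^ 3 := by
    have h1 : ∑ a, w a * (‖b a‖ ^ 2 * |ν a - t|) ≤ (1 + K) * s ^ 3 + K * s ^ 3 := by
      calc ∑ a, w a * (‖b a‖ ^ 2 * |ν a - t|) ≤
            ∑ a, (w a * (ν a * ‖b a‖ ^ 2) + w a * ‖b a‖ ^ 2 * t) := by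
            refine Finset.sum_le_sum fun a _ => ?_
            have h2 : |ν a - t| ≤ ν a + t := by
              have := hν0 a
              rw [abs_le]
              constructor <;> linarith
            have := mul_le_mul_of_nonneg_left h2 (mul_nonneg (hw a) (sq_nonneg ‖b a‖))
            linarith
        _ = ∑ a, w a * (ν a * ‖b a‖ ^ 2) + (∑ a, w a * ‖b a‖ ^ 2) * t := by
            rw [Finset.sum_add_distrib, Finset.sum_mul]
        _ ≤ (1 + K) * s ^ 3 + K * s ^ 3 := by
            have h3 := hF1 2 le_rfl
            have h4 := hmj 2 (by norm_num)
            gcongr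
    refine (hrw _).trans ?_
    have := mul_le_mul_of_nonneg_left h1 hM
    rw [hB]
    linarith
  have hQ3 : Q ≤ B * (A + |g| * s ^ 2) := by
    have h1 : Q = ∑ a, r a * (w a * inner ℝ (b a) T) + g * ∑ a, r a * (w a * (ν a - t)) := by
      rw [hQG, Finset.mul_sum, ← Finset.sum_add_distrib]
      exact Finset.sum_congr rfl fun a _ => by ring
    have h2 : |∑ a, r a * (w a * inner ℝ (b a) T)| ≤ M * (K * A) := by
      refine (hrw _).trans (mul_le_mul_of_nonneg_left ?_ hM)
      calc ∑ a, w a * (‖b a‖ ^ 2 * |inner ℝ (b a) T|) ≤ ∑ a, w a * ‖b a‖ ^ 3 * A := by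
            refine Finset.sum_le_sum fun a _ => ?_
            have := mul_le_mul_of_nonneg_left (hbT a) (mul_nonneg (hw a) (sq_nonneg ‖b a‖))
            linarith
        _ = (∑ a, w a * ‖b a‖ ^ 3) * A := by rw [Finset.sum_mul]
        _ ≤ _ := by
            have := hmj 3 (by norm_num)
            gcongr
    have h3 : g * ∑ a, r a * (w a * (ν a - t)) ≤ |g| * (B * s ^ 3) := by
      refine (le_abs_self _).trans ?_
      rw [abs_mul]
      gcongr
    have h4 : |g| * (B * s ^ 3) ≤ |g| * (B * s ^ 2) := by
      have : s ^ 3 ≤ s ^ 2 := pow_le_pow_of_le_one hs.le hs1 (by norm_num)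
      gcongr
    have h5 : M * (K * A) ≤ B * A := by
      rw [hB]
      have : 0 ≤ M * A := by positivity
      have : 0 ≤ M * K * A := by positivity
      linarith
    have := le_abs_self (∑ a, r a * (w a * inner ℝ (b a) T))
    linarith
  -- The normal term has been weakened from `s³` to `s²` because `X² = g² t` is what `hQ2` controls.
  -- So `A + X` satisfies a quadratic inequality and is bounded.
  set X := |g| * s ^ 2 with hX
  have hX0 : 0 ≤ X := by positivity
  have hAX : A + X ≤ D := by
    have h1 : c * A ^ 2 ≤ Q := le_trans (by gcongr; exact min_le_left _ _) hQ1
    have h2 : c * X ^ 2 ≤ Q := by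
      refine le_trans ?_ hQ2
      have : X ^ 2 = g ^ 2 * t := by rw [hX, mul_pow, sq_abs, ht]; ring
      rw [this]
      have : c ≤ c₂ := min_le_right _ _
      gcongr
    have h3 : c * (A + X) ^ 2 ≤ 4 * B * (A + X) := by
      have : 0 ≤ c * (A - X) ^ 2 := by positivity
      linarith
    rcases (add_nonneg hA0 hX0).eq_or_lt with h | h
    · rw [← h]
      exact hD0
    · rw [hD, le_div_iff₀ hc0]
      refine le_of_mul_le_mul_right ?_ h
      linarith
  have hAD : A ≤ D := by linarith
  -- The quadratic form alone gives only `|g| ≤ D / s²`. Testing with `y = n`, now that `A` is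
  -- bounded, gains one power of `s`: the right side is of order `s³`, while `V` is at least a
  -- multiple of `s⁴`.
  have hgV : |g| * V ≤ (B + D * (1 + K)) * s ^ 3 := by
    have h1 := hG n
    have hbn : ∀ a, inner ℝ (b a) n = ν a - t := fun a => by
      simp [hνdef, real_inner_comm]
    simp only [hbn, hGb] at h1
    have h2 : ∑ a, w a * inner ℝ (b a) T = 0 := by
      have : inner ℝ (∑ a, w a • b a) T = ∑ a, w a * inner ℝ (b a) T := by
        simp [sum_inner, real_inner_smul_left]
      rw [← this, hwb, inner_zero_left]
    have h3 : g * V = ∑ a, r a * (w a * (ν a - t)) - ∑ a, w a * (ν a * inner ℝ (b a) T) := by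
      have h4 : ∀ a, w a * (ν a - t) * (inner ℝ (b a) T + g * (ν a - t)) =
          w a * (ν a * inner ℝ (b a) T) - t * (w a * inner ℝ (b a) T) +
            g * (w a * (ν a - t) ^ 2) := fun a => by ring
      rw [← h1, Finset.sum_congr rfl fun a _ => h4 a, Finset.sum_add_distrib,
        Finset.sum_sub_distrib, ← Finset.mul_sum, ← Finset.mul_sum, h2]
      ring
    have h5 : |∑ a, w a * (ν a * inner ℝ (b a) T)| ≤ (1 + K) * s ^ 3 * A := by
      refine (Finset.abs_sum_le_sum_abs _ _).trans ?_
      calc ∑ a, |w a * (ν a * inner ℝ (b a) T)| ≤ ∑ a, w a * (ν a * ‖b a‖ ^ 1) * A := by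
            refine Finset.sum_le_sum fun a _ => ?_
            rw [abs_mul, abs_mul, abs_of_nonneg (hw a), abs_of_nonneg (hν0 a), pow_one]
            have := mul_le_mul_of_nonneg_left (hbT a) (mul_nonneg (hw a) (hν0 a))
            linarith
        _ = (∑ a, w a * (ν a * ‖b a‖ ^ 1)) * A := by rw [Finset.sum_mul]
        _ ≤ _ := by
            have := hF1 1 (by norm_num)
            gcongr
    have hV0 : 0 ≤ V := Finset.sum_nonneg fun a _ => mul_nonneg (hw a) (sq_nonneg _)
    have h6 : |g| * V = |g * V| := by rw [abs_mul, abs_of_nonneg hV0]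
    rw [h6, h3]
    refine (abs_sub _ _).trans ?_
    have h7 : (1 + K) * s ^ 3 * A ≤ (1 + K) * s ^ 3 * D := by gcongr
    linarith
  have hgs : |g| ≤ 2 * (B + D * (1 + K)) / η / s := by
    have h1 : |g| * (η * t / 2) ≤ (B + D * (1 + K)) * s ^ 3 :=
      le_trans (by gcongr) hgV
    rw [le_div_iff₀ hs, le_div_iff₀ hη]
    refine le_of_mul_le_mul_right ?_ (by positivity : 0 < s ^ 3)
    have : |g| * s * η * s ^ 3 = 2 * (|g| * (η * t / 2)) := by rw [ht]; ring
    linarith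
  have h8 : D ≤ D / s := by
    rw [le_div_iff₀ hs]
    exact mul_le_of_le_one_right hD0 hs1
  calc ‖G‖ ≤ ‖T‖ + ‖g • n‖ := by
        conv_lhs => rw [hGT]
        exact norm_add_le _ _
    _ = A + |g| := by rw [norm_smul, hn, mul_one, Real.norm_eq_abs]
    _ ≤ D / s + 2 * (B + D * (1 + K)) / η / s := by linarith
    _ = _ := by rw [← add_div]

end WeightedSystem

/-! ### Locality of Gaussian weights with an affine tilt -/

section TiltedWeights

variable {E : Type*} [NormedAddCommGroup E] [InnerProductSpace ℝ E]

/-- Weights with barycenter `x` that are a Gaussian around `x` times the exponential of an affine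
function. -/
structure IsTiltedGaussian (P : Finset E) (γ h : ℝ) (x : E) (w : P → ℝ) (c : ℝ) (l : E) :
    Prop where
  sum_eq_one : ∑ a, w a = 1
  sum_smul : ∑ a, w a • ((a : E) - x) = 0
  eq_exp : ∀ a : P, w a = Real.exp (c + inner ℝ l ((a : E) - x) - γ * (‖(a : E) - x‖ / h) ^ 2)

/-- Every point of the convex hull is a convex combination of at most `m` points of `P` at distance
at most `h`. -/
def IsLocallyGenerated (P : Finset E) (h : ℝ) (m : ℕ) : Prop :=
  ∀ y ∈ convexHull ℝ (P : Set E), ∃ S ⊆ P, S.card ≤ m ∧ y ∈ convexHull ℝ (S : Set E) ∧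
    ∀ a ∈ S, ‖a - y‖ ≤ h

namespace IsTiltedGaussian

variable {P : Finset E} {γ h : ℝ} {x : E} {w : P → ℝ} {c : ℝ} {l : E} {m : ℕ}

theorem pos (H : IsTiltedGaussian P γ h x w c l) (a : P) : 0 < w a := by
  rw [H.eq_exp]
  exact Real.exp_pos _

theorem le_one (H : IsTiltedGaussian P γ h x w c l) (a : P) : w a ≤ 1 := by
  rw [← H.sum_eq_one]
  exact Finset.single_le_sum (fun b _ => (H.pos b).le) (Finset.mem_univ a)

theorem sum_mul_inner (H : IsTiltedGaussian P γ h x w c l) (y : E) :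
    ∑ a, w a * inner ℝ y ((a : E) - x) = 0 := by
  have : inner ℝ y (∑ a, w a • ((a : E) - x)) = ∑ a, w a * inner ℝ y ((a : E) - x) := by
    simp [inner_sum, real_inner_smul_right]
  rw [← this, H.sum_smul, inner_zero_right]

theorem exponent_le (H : IsTiltedGaussian P γ h x w c l) {a : E} (ha : a ∈ P) :
    c + inner ℝ l (a - x) ≤ γ * (‖a - x‖ / h) ^ 2 := by
  have h1 := H.le_one ⟨a, ha⟩
  rw [H.eq_exp, Real.exp_le_one_iff] at h1
  simpa using h1

/-- Weights at most one bound the affine part of the exponent at each node by the Gaussian part. A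
point of the hull is a combination of nodes within `h`, at which the bound reads `γ(R + 1)²`, and an
affine function inherits it. -/
theorem exponent_le_of_mem_convexHull (H : IsTiltedGaussian P γ h x w c l) (hγ : 0 < γ)
    (hh : 0 < h) (hP : IsLocallyGenerated P h m) {y : E} (hy : y ∈ convexHull ℝ (P : Set E))
    {R : ℝ} (hyR : ‖y - x‖ ≤ R * h) : c + inner ℝ l (y - x) ≤ γ * (R + 1) ^ 2 := by
  obtain ⟨S, hSP, -, hyS, hS⟩ := hP y hy
  have hconv : Convex ℝ {z : E | c + inner ℝ l (z - x) ≤ γ * (R + 1) ^ 2} := by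
    have : {z : E | c + inner ℝ l (z - x) ≤ γ * (R + 1) ^ 2} =
        {z : E | inner ℝ l z ≤ γ * (R + 1) ^ 2 - c + inner ℝ l x} := by
      ext z
      simp only [Set.mem_ofPred_eq, inner_sub_right]
      constructor <;> intro <;> linarith
    rw [this]
    exact convex_halfSpace_le ⟨fun a b => inner_add_right _ _ _,
      fun r a => by simp [real_inner_smul_right]⟩ _
  refine convexHull_min (fun a ha => ?_) hconv hyS
  rw [Set.mem_ofPred_eq]
  refine (H.exponent_le (hSP ha)).trans ?_
  have h1 : ‖a - x‖ / h ≤ R + 1 := by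
    rw [div_le_iff₀ hh]
    calc ‖a - x‖ ≤ ‖a - y‖ + ‖y - x‖ := norm_sub_le_norm_sub_add_norm_sub _ _ _
      _ ≤ h + R * h := add_le_add (hS a ha) hyR
      _ = _ := by ring
  gcongr

theorem mem_convexHull (H : IsTiltedGaussian P γ h x w c l) : x ∈ convexHull ℝ (P : Set E) := by
  have h1 : ∑ a, w a • (a : E) = x := by
    have h2 := H.sum_smul
    simp only [smul_sub, Finset.sum_sub_distrib, ← Finset.sum_smul, H.sum_eq_one, one_smul] at h2
    exact sub_eq_zero.1 h2
  rw [← h1]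
  exact (convex_convexHull ℝ _).sum_mem (fun a _ => (H.pos a).le) H.sum_eq_one
    fun a _ => subset_convexHull ℝ _ a.2

theorem const_le (H : IsTiltedGaussian P γ h x w c l) (hγ : 0 < γ)
    (hh : 0 < h) (hP : IsLocallyGenerated P h m) : c ≤ γ := by
  simpa using H.exponent_le_of_mem_convexHull hγ hh hP H.mem_convexHull (R := 0) (by simp)

/-- Averaging `1 - l·(a - x)` against the weights gives exactly one, the barycenter being `x`. Then
`1 - z ≤ exp(-z)` cancels the tilt and leaves untilted Gaussians, which bounds `c` from below
whatever `l` is. -/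
theorem exp_neg_const_le (H : IsTiltedGaussian P γ h x w c l) :
    Real.exp (-c) ≤ ∑ a : P, Real.exp (-(γ * (‖(a : E) - x‖ / h) ^ 2)) := by
  calc Real.exp (-c) = ∑ a, w a * (Real.exp (-c) * (1 - inner ℝ l ((a : E) - x))) := by
        have : ∀ a, w a * (Real.exp (-c) * (1 - inner ℝ l ((a : E) - x))) =
            Real.exp (-c) * (w a - w a * inner ℝ l ((a : E) - x)) := fun a => by ring
        rw [Finset.sum_congr rfl fun a _ => this a, ← Finset.mul_sum, Finset.sum_sub_distrib,
          H.sum_eq_one, H.sum_mul_inner]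
        simp
    _ ≤ _ := by
        refine Finset.sum_le_sum fun a _ => ?_
        have h1 : Real.exp (-(γ * (‖(a : E) - x‖ / h) ^ 2)) =
            w a * (Real.exp (-c) * Real.exp (-inner ℝ l ((a : E) - x))) := by
          rw [H.eq_exp, ← Real.exp_add, ← Real.exp_add]
          congr 1
          ring
        rw [h1]
        have h2 := Real.add_one_le_exp (-inner ℝ l ((a : E) - x))
        have := (H.pos a).le
        gcongr
        linarith

/-- For a node farther than `h`, the point at distance `h` on the segment from `x` lies in the hull
and bounds the slope, with `4γ = γ(1 + 1)²`. Linear growth replaces the quadratic bound, which would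
only cancel the Gaussian. -/
theorem exponent_le_linear (H : IsTiltedGaussian P γ h x w c l) (hγ : 0 < γ)
    (hh : 0 < h) (hP : IsLocallyGenerated P h m) {L : ℝ} (hL : 0 ≤ L) (hc : -L ≤ c) {a : E}
    (ha : a ∈ P) : c + inner ℝ l (a - x) ≤ γ + (4 * γ + L) * (‖a - x‖ / h) := by
  set s := ‖a - x‖ / h with hs
  have hs0 : 0 ≤ s := by positivity
  rcases le_total s 1 with h1 | h1
  · have h2 := H.exponent_le ha
    have h3 : γ * s ^ 2 ≤ γ * 1 := by
      have : s ^ 2 ≤ 1 := pow_le_one₀ hs0 h1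
      gcongr
    have : 0 ≤ (4 * γ + L) * s := by positivity
    linarith
  · have hs1 : 0 < s := by linarith
    have hy : x + s⁻¹ • (a - x) ∈ convexHull ℝ (P : Set E) :=
      (convex_convexHull ℝ _).add_smul_sub_mem H.mem_convexHull (subset_convexHull ℝ _ ha)
        ⟨by positivity, inv_le_one_of_one_le₀ h1⟩
    have hn : ‖a - x‖ = s * h := by rw [hs]; field_simp
    have h2 := H.exponent_le_of_mem_convexHull hγ hh hP hy (R := 1) (by
      rw [add_sub_cancel_left, norm_smul, hn, norm_inv, Real.norm_of_nonneg hs0, ← mul_assoc,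
        inv_mul_cancel₀ hs1.ne'])
    rw [add_sub_cancel_left, real_inner_smul_right, inv_mul_eq_div] at h2
    have h3 : inner ℝ l (a - x) / s ≤ 4 * γ + L := by linarith
    rw [div_le_iff₀ hs1] at h3
    have := H.const_le hγ hh hP
    linarith

/-- The weights control some node in a prescribed direction, on every face that the direction
stays in. -/
theorem exists_node (H : IsTiltedGaussian P γ h x w c l) (hγ : 0 < γ)
    (hh : 0 < h) (hP : IsLocallyGenerated P h m) {L ρ : ℝ} (hL : 0 ≤ L) (hρ : 0 < ρ) (hρ1 : ρ ≤ 1)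
    {y e : E} (hyL : -L ≤ c + inner ℝ l (y - x)) (hyx : ‖y - x‖ ≤ h) (he : ‖e‖ = 1)
    (hy₁ : y + (ρ * h) • e ∈ convexHull ℝ (P : Set E))
    (hy₂ : y - (ρ * h) • e ∈ convexHull ℝ (P : Set E)) :
    ∃ a : P, Real.exp (-((2 * L + 18 * γ) * (2 * m / ρ)) - 9 * γ) ≤ w a ∧
      ρ / m * h ≤ inner ℝ e ((a : E) - y) ∧
      ∀ (n : E) (b : ℝ), (∀ z ∈ P, b ≤ inner ℝ n z) → inner ℝ n (y + (ρ * h) • e) = b →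
        inner ℝ n (a : E) = b := by
  obtain ⟨S, hSP, hcard, hyS, hS⟩ := hP _ hy₁
  obtain ⟨θ, hθ0, hθ1, hθ⟩ := Finset.mem_convexHull'.1 hyS
  have hSne : S.Nonempty := by
    rw [Finset.nonempty_iff_ne_empty]
    rintro rfl
    simp at hθ1
  have hm : 0 < (m : ℝ) := by
    have := Finset.card_pos.2 hSne
    exact_mod_cast this.trans_le hcard
  have hρh : ‖(ρ * h) • e‖ ≤ h := by
    rw [norm_smul, he, mul_one, Real.norm_of_nonneg (by positivity)]
    exact mul_le_of_le_one_left hh.le hρ1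
  have hdist : ∀ a ∈ S, ‖a - y‖ ≤ 2 * h := by
    intro a ha
    calc ‖a - y‖ = ‖(a - (y + (ρ * h) • e)) + (ρ * h) • e‖ := by congr 1; abel
      _ ≤ h + h := (norm_add_le _ _).trans (add_le_add (hS a ha) hρh)
      _ = _ := by ring
  have hsum : ∑ a ∈ S, θ a * inner ℝ e (a - y) = ρ * h := by
    have h1 : ∑ a ∈ S, θ a • (a - y) = (ρ * h) • e := by
      simp only [smul_sub, Finset.sum_sub_distrib, ← Finset.sum_smul, hθ1, hθ, one_smul]
      abel
    have h2 : inner ℝ e (∑ a ∈ S, θ a • (a - y)) = ∑ a ∈ S, θ a * inner ℝ e (a - y) := by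
      simp [inner_sum, real_inner_smul_right]
    rw [← h2, h1, real_inner_smul_right, real_inner_self_eq_norm_sq, he]
    ring
  -- Pigeonhole: the total `ρh` is shared by at most `m` nodes.
  obtain ⟨a, haS, ha⟩ : ∃ a ∈ S, ρ * h / m ≤ θ a * inner ℝ e (a - y) := by
    by_contra! hcon
    have h1 : ∑ a ∈ S, θ a * inner ℝ e (a - y) < ∑ a ∈ S, ρ * h / m :=
      Finset.sum_lt_sum_of_nonempty hSne hcon
    rw [hsum, Finset.sum_const, nsmul_eq_mul] at h1
    have h2 : (S.card : ℝ) * (ρ * h / m) ≤ m * (ρ * h / m) := by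
      have : (S.card : ℝ) ≤ m := by exact_mod_cast hcard
      gcongr
    rw [mul_div_cancel₀ _ hm.ne'] at h2
    linarith
  have hpos : 0 < ρ * h / m := by positivity
  have hθa0 := hθ0 a haS
  have hθa1 : θ a ≤ 1 := by
    rw [← hθ1]
    exact Finset.single_le_sum hθ0 haS
  have hinner : inner ℝ e (a - y) ≤ 2 * h := by
    have h1 := real_inner_le_norm e (a - y)
    rw [he, one_mul] at h1
    exact h1.trans (hdist a haS)
  have hip : 0 < inner ℝ e (a - y) := by
    by_contra! hcon
    have := mul_nonpos_of_nonneg_of_nonpos hθa0 hcon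
    linarith
  have hθlow : ρ / (2 * m) ≤ θ a := by
    have h1 : ρ * h / m ≤ θ a * (2 * h) := ha.trans (by gcongr)
    refine le_of_mul_le_mul_right ?_ (by positivity : 0 < 2 * h)
    calc ρ / (2 * m) * (2 * h) = ρ * h / m := by field_simp
      _ ≤ _ := h1
  have hθpos : 0 < θ a := lt_of_lt_of_le (by positivity) hθlow
  have hax : ∀ b ∈ S, ‖b - x‖ / h ≤ 3 := by
    intro b hb
    rw [div_le_iff₀ hh]
    have := norm_sub_le_norm_sub_add_norm_sub b y x
    have := hdist b hb
    linarith
  have hup : ∀ b ∈ S, c + inner ℝ l (b - x) ≤ 9 * γ := by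
    intro b hb
    refine (H.exponent_le (hSP hb)).trans ?_
    have h1 : (‖b - x‖ / h) ^ 2 ≤ 3 ^ 2 := by
      have := hax b hb
      gcongr
    have := mul_le_mul_of_nonneg_left h1 hγ.le
    linarith
  -- An affine function at `y + ρhe` is twice its value at `y` minus its value at `y - ρhe`. The
  -- latter is bounded above by `γ(2 + 1)²`.
  have hlow : -(2 * L + 9 * γ) ≤ c + inner ℝ l (y + (ρ * h) • e - x) := by
    have h1 := H.exponent_le_of_mem_convexHull hγ hh hP hy₂ (R := 2) (by
      calc ‖y - (ρ * h) • e - x‖ = ‖(y - x) - (ρ * h) • e‖ := by congr 1; abel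
        _ ≤ h + h := (norm_sub_le _ _).trans (add_le_add hyx hρh)
        _ = _ := by ring)
    simp only [inner_sub_right, inner_add_right] at h1 hyL ⊢
    linarith
  have hcomb : ∑ b ∈ S, θ b * (c + inner ℝ l (b - x)) = c + inner ℝ l (y + (ρ * h) • e - x) := by
    have h1 : ∑ b ∈ S, θ b * (c + inner ℝ l (b - x)) =
        (∑ b ∈ S, θ b) * c + inner ℝ l (∑ b ∈ S, θ b • b) - (∑ b ∈ S, θ b) * inner ℝ l x := by
      simp only [inner_sum, real_inner_smul_right, Finset.sum_mul, ← Finset.sum_add_distrib,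
        ← Finset.sum_sub_distrib, inner_sub_right]
      exact Finset.sum_congr rfl fun b _ => by ring
    rw [h1, hθ1, hθ, inner_sub_right]
    ring
  -- The average of the exponents is bounded below and each is at most `9γ`, so no single share can
  -- be very negative. Dividing by `θ a ≥ ρ/(2m)` later gives the bound on the exponent itself.
  have hphi : -(2 * L + 18 * γ) ≤ θ a * (c + inner ℝ l (a - x)) := by
    classical
    rw [← Finset.add_sum_erase _ _ haS] at hcomb
    have h1 : ∑ b ∈ S.erase a, θ b * (c + inner ℝ l (b - x)) ≤ ∑ b ∈ S.erase a, θ b * (9 * γ) :=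
      Finset.sum_le_sum fun b hb => mul_le_mul_of_nonneg_left (hup b (Finset.mem_of_mem_erase hb))
        (hθ0 b (Finset.mem_of_mem_erase hb))
    have h2 : ∑ b ∈ S.erase a, θ b * (9 * γ) ≤ 9 * γ := by
      rw [← Finset.sum_mul]
      refine mul_le_of_le_one_left (by positivity) ?_
      rw [← hθ1]
      exact Finset.sum_le_sum_of_subset_of_nonneg (Finset.erase_subset _ _) fun b hb _ => hθ0 b hb
    linarith
  refine ⟨⟨a, hSP haS⟩, ?_, ?_, ?_⟩
  · rw [H.eq_exp, Real.exp_le_exp]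
    have h1 : γ * (‖a - x‖ / h) ^ 2 ≤ γ * 3 ^ 2 := by
      have := hax a haS
      gcongr
    have h2 : -((2 * L + 18 * γ) * (2 * m / ρ)) ≤ c + inner ℝ l (a - x) := by
      by_cases hneg : 0 ≤ c + inner ℝ l (a - x)
      · have : 0 ≤ (2 * L + 18 * γ) * (2 * m / ρ) := by positivity
        linarith
      · have h3 : ρ / (2 * m) * -(c + inner ℝ l (a - x)) ≤ 2 * L + 18 * γ := by
          have := mul_le_mul_of_nonneg_right hθlow (by linarith : 0 ≤ -(c + inner ℝ l (a - x)))
          linarith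
        have h4 : -(c + inner ℝ l (a - x)) ≤ (2 * L + 18 * γ) * (2 * m / ρ) := by
          have := mul_le_mul_of_nonneg_right h3 (by positivity : 0 ≤ 2 * m / ρ)
          calc -(c + inner ℝ l (a - x)) =
              ρ / (2 * m) * -(c + inner ℝ l (a - x)) * (2 * m / ρ) := by field_simp
            _ ≤ _ := this
        linarith
    simp only
    linarith
  · calc ρ / m * h = ρ * h / m := by ring
      _ ≤ θ a * inner ℝ e (a - y) := ha
      _ ≤ _ := mul_le_of_le_one_left hip.le hθa1
  -- A convex combination lying on the boundary of a half-space uses, with positive coefficients,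
  -- only points of the boundary hyperplane.
  · intro n b hb hnb
    have h1 : ∑ z ∈ S, θ z * (inner ℝ n z - b) = 0 := by
      have : ∑ z ∈ S, θ z * (inner ℝ n z - b) =
          inner ℝ n (∑ z ∈ S, θ z • z) - (∑ z ∈ S, θ z) * b := by
        simp only [inner_sum, real_inner_smul_right, Finset.sum_mul, ← Finset.sum_sub_distrib,
          mul_sub]
      rw [this, hθ, hθ1, hnb]
      ring
    rw [Finset.sum_eq_zero_iff_of_nonneg] at h1
    · have h2 := (mul_eq_zero.1 (h1 a haS)).resolve_left hθpos.ne'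
      exact sub_eq_zero.1 h2
    · intro z hz
      exact mul_nonneg (hθ0 z hz) (sub_nonneg.2 (hb z (hSP hz)))

end IsTiltedGaussian

theorem exists_exp_mul_pow_le {γ : ℝ} (hγ : 0 < γ) (A B : ℝ) (N : ℕ) :
    ∃ C : ℝ, 0 < C ∧ ∀ s : ℝ, 0 ≤ s → Real.exp (A + B * s - γ * s ^ 2) * (1 + s) ^ N ≤ C := by
  refine ⟨N.factorial * Real.exp (A + 1 + (B + 1) ^ 2 / (4 * γ)), by positivity, fun s hs => ?_⟩
  have h1 : (1 + s) ^ N ≤ N.factorial * Real.exp (1 + s) := by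
    have := Real.pow_div_factorial_le_exp (1 + s) (by positivity) N
    rwa [div_le_iff₀' (by positivity)] at this
  calc Real.exp (A + B * s - γ * s ^ 2) * (1 + s) ^ N
      ≤ Real.exp (A + B * s - γ * s ^ 2) * (N.factorial * Real.exp (1 + s)) := by gcongr
    _ = N.factorial * Real.exp (A + B * s - γ * s ^ 2 + (1 + s)) := by
      rw [Real.exp_add _ (1 + s)]
      ring
    _ ≤ _ := by
      refine mul_le_mul_of_nonneg_left (Real.exp_le_exp.2 ?_) (by positivity)
      have h2 : (B + 1) * s - γ * s ^ 2 ≤ (B + 1) ^ 2 / (4 * γ) := by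
        rw [le_div_iff₀ (by positivity)]
        nlinarith [sq_nonneg (B + 1 - 2 * γ * s)]
      linarith

/-- Constants that bound the tilt and the moments of the weights. -/
theorem exists_tilt_and_moment_bound {γ C₀ : ℝ} (hγ : 0 < γ) (hC₀ : 0 < C₀) (N : ℕ) :
    ∃ L K : ℝ, 0 ≤ L ∧ 0 ≤ K ∧ ∀ (P : Finset E) (h : ℝ) (x : E) (w : P → ℝ) (c : ℝ) (l : E) (m : ℕ),
      0 < h → IsTiltedGaussian P γ h x w c l → IsLocallyGenerated P h m →
      ∑ a : P, ((1 + ‖(a : E) - x‖ / h) ^ N)⁻¹ ≤ C₀ →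
      -L ≤ c ∧ ∑ a, w a * (1 + ‖(a : E) - x‖ / h) ^ 9 ≤ K := by
  obtain ⟨C₁, hC₁, h1⟩ := exists_exp_mul_pow_le hγ 0 0 N
  set L := |Real.log (C₁ * C₀)| with hL
  -- The power `9` is for the moment, and `N` for the decay that makes the sum over nodes converge.
  obtain ⟨C₂, hC₂, h2⟩ := exists_exp_mul_pow_le hγ γ (4 * γ + L) (9 + N)
  refine ⟨L, C₂ * C₀, abs_nonneg _, by positivity, ?_⟩
  intro P h x w c l m hh H hP hsum
  have hc : -L ≤ c := by
    have h3 := H.exp_neg_const_le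
    have h4 : ∑ a : P, Real.exp (-(γ * (‖(a : E) - x‖ / h) ^ 2)) ≤ C₁ * C₀ := by
      refine le_trans ?_ (mul_le_mul_of_nonneg_left hsum hC₁.le)
      rw [Finset.mul_sum]
      refine Finset.sum_le_sum fun a _ => ?_
      rw [← div_eq_mul_inv, le_div_iff₀ (by positivity)]
      have := h1 (‖(a : E) - x‖ / h) (by positivity)
      simpa using this
    have h5 := (Real.le_log_iff_exp_le (by positivity)).2 (h3.trans h4)
    have := le_abs_self (Real.log (C₁ * C₀))
    linarith
  refine ⟨hc, le_trans ?_ (mul_le_mul_of_nonneg_left hsum hC₂.le)⟩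
  rw [Finset.mul_sum]
  refine Finset.sum_le_sum fun a _ => ?_
  rw [← div_eq_mul_inv, le_div_iff₀ (by positivity), mul_assoc, ← pow_add]
  refine le_trans ?_ (h2 (‖(a : E) - x‖ / h) (by positivity))
  rw [H.eq_exp]
  have := H.exponent_le_linear hγ hh hP (abs_nonneg _) hc a.2
  gcongr

end TiltedWeights

/-! ### Node counting, local generation, and the system for the gradient error -/

section PointwiseEstimate

variable {d : ℕ}

/-- A point set of bounded density has bounded algebraically weighted counting sums. -/
theorem exists_sum_inv_pow_le (d : ℕ) (τ : ℝ) :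
    ∃ C : ℝ, 0 < C ∧ ∀ (P : Finset (EuclideanSpace ℝ (Fin d))) (h : ℝ), 0 < h →
      HasHDensityLE P h τ → ∀ x : EuclideanSpace ℝ (Fin d),
      ∑ a : P, ((1 + ‖(a : EuclideanSpace ℝ (Fin d)) - x‖ / h) ^ (d + 1))⁻¹ ≤ C := by
  let F : EuclideanSpace ℝ (Fin d) → ℝ := fun z => 2 ^ (d + 1) * ((1 + ‖z‖) ^ (d + 1))⁻¹
  have hF0 : ∀ z, 0 ≤ F z := fun z => by positivity
  have hF : Integrable F := by
    have h1 : Integrable fun z : EuclideanSpace ℝ (Fin d) => (1 + ‖z‖) ^ (-((d + 1 : ℕ) : ℝ)) :=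
      integrable_one_add_norm (by simp)
    have h2 : F = fun z => 2 ^ (d + 1) * (1 + ‖z‖) ^ (-((d + 1 : ℕ) : ℝ)) := by
      ext z
      simp only [F]
      rw [Real.rpow_neg (by positivity), Real.rpow_natCast]
    rw [h2]
    exact h1.const_mul _
  set V := volume.real (Metric.closedBall (0 : EuclideanSpace ℝ (Fin d)) 1) with hV
  have hV0 : 0 < V := by
    refine ENNReal.toReal_pos ?_ measure_closedBall_lt_top.ne
    exact (Metric.measure_closedBall_pos _ _ one_pos).ne'
  refine ⟨|τ| * (∫ z, F z) / V + 1, ?_, ?_⟩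
  · have : 0 ≤ ∫ z, F z := integral_nonneg hF0
    positivity
  intro P h hh hdens x
  -- Each term is compared with the integral of `F` over the unit ball around the rescaled node; the
  -- factor `2 ^ (d + 1)` in `F` absorbs `1 + ‖z‖ ≤ 2(1 + ‖b‖)`.
  have hterm : ∀ a : P, ((1 + ‖(a : EuclideanSpace ℝ (Fin d)) - x‖ / h) ^ (d + 1))⁻¹ * V ≤
      ∫ z, (Metric.closedBall (h⁻¹ • ((a : EuclideanSpace ℝ (Fin d)) - x)) 1).indicator F z := by
    intro a
    set b := h⁻¹ • ((a : EuclideanSpace ℝ (Fin d)) - x) with hb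
    have hbn : ‖(a : EuclideanSpace ℝ (Fin d)) - x‖ / h = ‖b‖ := by
      rw [hb, norm_smul, norm_inv, Real.norm_of_nonneg hh.le, inv_mul_eq_div]
    rw [hbn, integral_indicator measurableSet_closedBall]
    have hVb : volume.real (Metric.closedBall b 1) = V := by
      rw [hV, measureReal_def, measureReal_def, Measure.addHaar_closedBall_center]
    rw [mul_comm, ← hVb]
    have h1 : ∫ _ in Metric.closedBall b 1, ((1 + ‖b‖) ^ (d + 1))⁻¹ =
        volume.real (Metric.closedBall b 1) * ((1 + ‖b‖) ^ (d + 1))⁻¹ := by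
      rw [setIntegral_const, smul_eq_mul]
    rw [← h1]
    refine setIntegral_mono_on (integrableOn_const measure_closedBall_lt_top.ne) hF.integrableOn
      measurableSet_closedBall fun z hz => ?_
    have h2 : 1 + ‖z‖ ≤ 2 * (1 + ‖b‖) := by
      have h3 : ‖z - b‖ ≤ 1 := by simpa [dist_eq_norm] using hz
      have := norm_le_norm_add_norm_sub' z b
      have := norm_nonneg b
      linarith
    simp only [F]
    rw [← div_eq_mul_inv, inv_eq_one_div, div_le_div_iff₀ (by positivity) (by positivity), one_mul,
      ← mul_pow]
    gcongr
  -- The density bound says that at most `τ` of these unit balls contain a given point `z`.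
  have hsum : ∑ a : P, ∫ z,
      (Metric.closedBall (h⁻¹ • ((a : EuclideanSpace ℝ (Fin d)) - x)) 1).indicator F z ≤
      |τ| * ∫ z, F z := by
    rw [← integral_finsetSum _ fun a _ => hF.indicator measurableSet_closedBall,
      ← integral_const_mul]
    refine integral_mono (integrable_finsetSum _ fun a _ =>
      hF.indicator measurableSet_closedBall) (hF.const_mul _) fun z => ?_
    classical
    simp only [Set.indicator_apply]
    rw [← Finset.sum_filter, Finset.sum_const, nsmul_eq_mul]
    refine mul_le_mul_of_nonneg_right ?_ (hF0 z)
    refine le_trans ?_ ((hdens (x + h • z)).trans (le_abs_self τ))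
    rw [Nat.cast_le, ← Set.ncard_coe_finset]
    refine Set.ncard_le_ncard_of_injOn (fun a : P => (a : EuclideanSpace ℝ (Fin d))) ?_
      (Subtype.val_injective.injOn) (P.finite_toSet.inter_of_left _)
    intro a ha
    have ha' : z ∈ Metric.closedBall (h⁻¹ • ((a : EuclideanSpace ℝ (Fin d)) - x)) 1 := by
      simpa using ha
    refine ⟨a.2, ?_⟩
    rw [Metric.mem_closedBall, dist_eq_norm] at ha' ⊢
    have h1 : (a : EuclideanSpace ℝ (Fin d)) - (x + h • z) =
        -(h • (z - h⁻¹ • ((a : EuclideanSpace ℝ (Fin d)) - x))) := by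
      rw [smul_sub, smul_smul, mul_inv_cancel₀ hh.ne', one_smul]
      abel
    rw [h1, norm_neg, norm_smul, Real.norm_of_nonneg hh.le]
    exact mul_le_of_le_one_right hh.le ha'
  have h2 := (Finset.sum_le_sum fun a (_ : a ∈ Finset.univ) => hterm a).trans hsum
  rw [← Finset.sum_mul, ← le_div_iff₀ hV0] at h2
  linarith

theorem dist_le_of_setSize_lt {A : Set (EuclideanSpace ℝ (Fin d))} {h : ℝ} (hA : Bornology.IsBounded A)
    (hh : setSize A < h) {x y : EuclideanSpace ℝ (Fin d)} (hx : x ∈ A) (hy : y ∈ A) :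
    dist x y ≤ h := by
  have hne : {r : ℝ | 0 ≤ r ∧ ∃ c, A ⊆ Metric.closedBall c r}.Nonempty := by
    obtain ⟨r, hr⟩ := hA.subset_closedBall 0
    exact ⟨max r 0, le_max_right _ _, 0, hr.trans (Metric.closedBall_subset_closedBall
      (le_max_left _ _))⟩
  have h1 : sInf {r : ℝ | 0 ≤ r ∧ ∃ c, A ⊆ Metric.closedBall c r} < h / 2 := by
    unfold setSize at hh
    linarith
  obtain ⟨r, ⟨-, c, hc⟩, hr⟩ := exists_lt_of_csInf_lt hne h1
  have hx' := hc hx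
  have hy' := hc hy
  rw [Metric.mem_closedBall] at hx' hy'
  have := dist_triangle_right x y c
  linarith

/-- The covering concerns interior points only. Boundary points follow because the hulls of the
admissible node subsets are finitely many closed sets, so their union is closed. Boundary points are
needed to find nodes lying on a facet. -/
theorem IsHCovering.isLocallyGenerated {P : Finset (EuclideanSpace ℝ (Fin d))} {h : ℝ}
    (hcov : IsHCovering P h (interior (convexHull ℝ (P : Set (EuclideanSpace ℝ (Fin d))))))
    (hne : (interior (convexHull ℝ (P : Set (EuclideanSpace ℝ (Fin d))))).Nonempty) :
    IsLocallyGenerated P h (d + 1) := by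
  classical
  let 𝒮 : Finset (Finset (EuclideanSpace ℝ (Fin d))) := P.powerset.filter fun S =>
    S.card ≤ d + 1 ∧ ∀ y ∈ convexHull ℝ (S : Set (EuclideanSpace ℝ (Fin d))), ∀ a ∈ S, ‖a - y‖ ≤ h
  have hclosed : IsClosed (⋃ S ∈ 𝒮, convexHull ℝ (S : Set (EuclideanSpace ℝ (Fin d)))) :=
    𝒮.finite_toSet.isClosed_biUnion fun S _ => S.finite_toSet.isClosed_convexHull ℝ
  have hsub : interior (convexHull ℝ (P : Set (EuclideanSpace ℝ (Fin d)))) ⊆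
      ⋃ S ∈ 𝒮, convexHull ℝ (S : Set (EuclideanSpace ℝ (Fin d))) := by
    intro x hx
    obtain ⟨T, hTP, hsize, hxT⟩ := hcov x hx
    have hb : Bornology.IsBounded (convexHull ℝ (Set.range T.points)) :=
      ((Set.finite_range T.points).isCompact_convexHull ℝ).isBounded
    simp only [Set.mem_iUnion]
    refine ⟨Finset.univ.image T.points, ?_, ?_⟩
    · simp only [𝒮, Finset.mem_filter, Finset.mem_powerset]
      refine ⟨?_, ?_, ?_⟩
      · intro a ha
        obtain ⟨i, -, rfl⟩ := Finset.mem_image.1 ha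
        exact hTP i
      · exact Finset.card_image_le.trans (by simp)
      · intro y hy a ha
        rw [Finset.coe_image, Finset.coe_univ, Set.image_univ] at hy
        obtain ⟨i, -, rfl⟩ := Finset.mem_image.1 ha
        rw [← dist_eq_norm]
        exact dist_le_of_setSize_lt hb hsize (subset_convexHull ℝ _ ⟨i, rfl⟩) hy
    · rwa [Finset.coe_image, Finset.coe_univ, Set.image_univ]
  intro y hy
  have hcl : y ∈ closure (interior (convexHull ℝ (P : Set (EuclideanSpace ℝ (Fin d))))) := by
    rw [(convex_convexHull ℝ _).closure_interior_eq_closure_of_nonempty_interior hne]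
    exact subset_closure hy
  have h1 := closure_minimal hsub hclosed hcl
  simp only [Set.mem_iUnion] at h1
  obtain ⟨S, hS, hyS⟩ := h1
  simp only [𝒮, Finset.mem_filter, Finset.mem_powerset] at hS
  exact ⟨S, hS.1, hS.2.1, hyS, hS.2.2 y hyS⟩

theorem exists_isTiltedGaussian_lmeShape {P : Finset (EuclideanSpace ℝ (Fin d))} {γ h : ℝ}
    (hγ : 0 < γ) (hh : 0 < h) {x : EuclideanSpace ℝ (Fin d)}
    (hx : x ∈ interior (convexHull ℝ (P : Set (EuclideanSpace ℝ (Fin d))))) :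
    ∃ c l, IsTiltedGaussian P γ h x (fun a => lmeShape (γ / h ^ 2) P a x) c l := by
  have hβ : 0 < γ / h ^ 2 := by positivity
  obtain ⟨c, l, hcl⟩ := exists_lmeShape_eq_exp hβ hx
  obtain ⟨-, h1, h2⟩ := lmeShape_mem_lmeFeasible hβ hx
  refine ⟨c, l, h1, ?_, fun a => ?_⟩
  · simp only [smul_sub, Finset.sum_sub_distrib, ← Finset.sum_smul, h1, h2, one_smul, sub_self]
  · rw [hcl]
    congr 2
    rw [div_pow]
    ring

/-- The quantities in which the error of an approximation by shape functions is expressed. -/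
theorem gradient_error_system {P : Finset (EuclideanSpace ℝ (Fin d))} {γ h : ℝ}
    (hγ : 0 < γ) (hh : 0 < h) {x : EuclideanSpace ℝ (Fin d)}
    (hx : x ∈ interior (convexHull ℝ (P : Set (EuclideanSpace ℝ (Fin d)))))
    (U : EuclideanSpace ℝ (Fin d) → ℝ) (D y : EuclideanSpace ℝ (Fin d)) :
    ∑ a : P, lmeShape (γ / h ^ 2) P a x *
        inner ℝ (h⁻¹ • ((a : EuclideanSpace ℝ (Fin d)) - x)) y *
        inner ℝ (h⁻¹ • (gradient (fun z => ∑ a : P, U a * lmeShape (γ / h ^ 2) P a z) x - D))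
          (h⁻¹ • ((a : EuclideanSpace ℝ (Fin d)) - x)) =
      ∑ a : P, (U a - U x - inner ℝ D ((a : EuclideanSpace ℝ (Fin d)) - x)) / h ^ 2 *
        (lmeShape (γ / h ^ 2) P a x *
          inner ℝ (h⁻¹ • ((a : EuclideanSpace ℝ (Fin d)) - x)) y) := by
  have hβ : 0 < γ / h ^ 2 := by positivity
  obtain ⟨c, l, H⟩ := exists_isTiltedGaussian_lmeShape hγ hh hx
  have h1 := fderiv_sum_lmeShape hβ hx (fun a => U a) y
  rw [← inner_gradient_left] at h1
  simp only [inner_sum, real_inner_smul_right] at h1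
  -- The first moment vanishes, so subtracting `U x` from the nodal values changes nothing in the
  -- system.
  have h2 := H.sum_mul_inner y
  simp only [real_inner_smul_left, real_inner_smul_right, inner_sub_left (gradient _ _)]
  have h3 : ∀ a : P, (U a - U x - inner ℝ D ((a : EuclideanSpace ℝ (Fin d)) - x)) / h ^ 2 *
        (lmeShape (γ / h ^ 2) P a x *
          (h⁻¹ * inner ℝ ((a : EuclideanSpace ℝ (Fin d)) - x) y)) =
      h⁻¹ * (h ^ 2)⁻¹ * (U a * (lmeShape (γ / h ^ 2) P a x *
        inner ℝ ((a : EuclideanSpace ℝ (Fin d)) - x) y)) -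
      h⁻¹ * (h ^ 2)⁻¹ * U x * (lmeShape (γ / h ^ 2) P a x *
        inner ℝ y ((a : EuclideanSpace ℝ (Fin d)) - x)) -
      h⁻¹ * (h ^ 2)⁻¹ * (lmeShape (γ / h ^ 2) P a x *
        inner ℝ ((a : EuclideanSpace ℝ (Fin d)) - x) y *
          inner ℝ D ((a : EuclideanSpace ℝ (Fin d)) - x)) := fun a => by
    rw [real_inner_comm y]
    ring
  rw [Finset.sum_congr rfl fun a _ => h3 a, Finset.sum_sub_distrib, Finset.sum_sub_distrib,
    ← Finset.mul_sum, ← Finset.mul_sum, ← Finset.mul_sum, h2, ← h1, mul_zero, sub_zero, ← mul_sub,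
    ← Finset.sum_sub_distrib, Finset.mul_sum]
  refine Finset.sum_congr rfl fun a _ => ?_
  field_simp

end PointwiseEstimate

/-! ### Error bounds in the interior and close to one facet -/

section PointwiseEstimate

/-- The error of the approximation of `U` by shape functions, at interior points and near facets
but away from the lower dimensional faces. -/
theorem exists_pointwise_estimate (d : ℕ) {γ τ η ρ M : ℝ} (hγ : 0 < γ) (hη : 0 < η) (hρ : 0 < ρ)
    (hρ1 : ρ ≤ 1) (hρη : ρ ≤ η / 2) (hM : 0 ≤ M) :
    ∃ C : ℝ, 0 ≤ C ∧ ∀ (P : Finset (EuclideanSpace ℝ (Fin d))) (h : ℝ)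
      (x D : EuclideanSpace ℝ (Fin d)) (U : EuclideanSpace ℝ (Fin d) → ℝ), 0 < h →
      HasHDensityLE P h τ → IsLocallyGenerated P h (d + 1) →
      x ∈ interior (convexHull ℝ (P : Set (EuclideanSpace ℝ (Fin d)))) →
      (∀ a ∈ P, |U a - U x - inner ℝ D (a - x)| ≤ M * ‖a - x‖ ^ 2) →
      |∑ a : P, U a * lmeShape (γ / h ^ 2) P a x - U x| ≤ C * h ^ 2 ∧
      ((∀ e : EuclideanSpace ℝ (Fin d), ‖e‖ = 1 →
          x + (ρ * h) • e ∈ convexHull ℝ (P : Set (EuclideanSpace ℝ (Fin d)))) →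
        ‖gradient (fun z => ∑ a : P, U a * lmeShape (γ / h ^ 2) P a z) x - D‖ ≤ C * h) ∧
      ∀ (n : EuclideanSpace ℝ (Fin d)) (b : ℝ), ‖n‖ = 1 →
        (∀ a ∈ P, inner ℝ n a = b ∨ b + η * h ≤ inner ℝ n a) →
        0 < inner ℝ n x - b → inner ℝ n x - b ≤ ρ * h →
        x + (ρ * h) • n ∈ convexHull ℝ (P : Set (EuclideanSpace ℝ (Fin d))) →
        (∀ e : EuclideanSpace ℝ (Fin d), ‖e‖ = 1 → inner ℝ n e = 0 →
          x - (inner ℝ n x - b) • n + (ρ * h) • e ∈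
            convexHull ℝ (P : Set (EuclideanSpace ℝ (Fin d)))) →
        ‖gradient (fun z => ∑ a : P, U a * lmeShape (γ / h ^ 2) P a z) x - D‖ ≤
          C * h / √√((inner ℝ n x - b) / h) := by
  obtain ⟨C₀, hC₀, hcount⟩ := exists_sum_inv_pow_le d τ
  obtain ⟨L, K, hL, hK, hLK⟩ := exists_tilt_and_moment_bound (E := EuclideanSpace ℝ (Fin d))
    hγ hC₀ (d + 1)
  have hd : 0 < ((d + 1 : ℕ) : ℝ) := by positivity
  -- One weight bound for both regimes: `2L + 4γ` is the tilt bound needed at the foot of the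
  -- perpendicular on the facet, and it exceeds the bound `L` valid at `x`.
  set κ := Real.exp (-((2 * (2 * L + 4 * γ) + 18 * γ) * (2 * (d + 1 : ℕ) / ρ)) - 9 * γ) with hκ
  have hκ0 : 0 < κ := Real.exp_pos _
  obtain ⟨C₁, hC₁, hfacet⟩ := exists_norm_le_of_degenerate_covariance_system
    (E := EuclideanSpace ℝ (Fin d)) hκ0 (by positivity : 0 < ρ / (d + 1 : ℕ)) hη hM hK
  set C₂ := M * K / (κ * (ρ / (d + 1 : ℕ)) ^ 2) with hC₂
  have hC₂0 : 0 ≤ C₂ := by positivity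
  refine ⟨M * K + C₂ + C₁, by positivity, ?_⟩
  intro P h x D U hh hdens hgen hx hU
  obtain ⟨c, l, H⟩ := exists_isTiltedGaussian_lmeShape hγ hh hx
  obtain ⟨hc, hmom⟩ := hLK P h x _ c l (d + 1) hh H hgen (hcount P h hh hdens x)
  set w : P → ℝ := fun a => lmeShape (γ / h ^ 2) P a x with hw
  set b : P → EuclideanSpace ℝ (Fin d) :=
    fun a => h⁻¹ • ((a : EuclideanSpace ℝ (Fin d)) - x) with hb
  set r : P → ℝ := fun a => (U a - U x - inner ℝ D ((a : EuclideanSpace ℝ (Fin d)) - x)) / h ^ 2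
    with hr
  have hbn : ∀ a : P, ‖b a‖ = ‖(a : EuclideanSpace ℝ (Fin d)) - x‖ / h := fun a => by
    rw [hb]
    simp only
    rw [norm_smul, norm_inv, Real.norm_of_nonneg hh.le, inv_mul_eq_div]
  have hw0 : ∀ a, 0 ≤ w a := fun a => (H.pos a).le
  have hrb : ∀ a, |r a| ≤ M * ‖b a‖ ^ 2 := by
    intro a
    rw [hbn, div_pow, ← mul_div_assoc]
    simp only [hr]
    rw [abs_div, abs_of_pos (by positivity : 0 < h ^ 2)]
    have := hU a a.2
    gcongr
  have hmom' : ∑ a, w a * (1 + ‖b a‖) ^ 9 ≤ K := by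
    simp only [hbn]
    exact hmom
  have hmj : ∀ j : ℕ, j ≤ 9 → ∑ a, w a * ‖b a‖ ^ j ≤ K := by
    intro j hj
    refine le_trans (Finset.sum_le_sum fun a _ => mul_le_mul_of_nonneg_left ?_ (hw0 a)) hmom'
    exact (pow_le_pow_left₀ (norm_nonneg _) (by linarith) j).trans
      (pow_le_pow_right₀ (by linarith [norm_nonneg (b a)]) hj)
  have hsys := gradient_error_system hγ hh hx U D
  set G := gradient (fun z => ∑ a : P, U a * lmeShape (γ / h ^ 2) P a z) x - D with hG
  have hGh : ‖G‖ = h * ‖h⁻¹ • G‖ := by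
    rw [norm_smul, norm_inv, Real.norm_of_nonneg hh.le, ← mul_assoc, mul_inv_cancel₀ hh.ne',
      one_mul]
  have hκ_le : ∀ L' : ℝ, L' ≤ 2 * L + 4 * γ →
      κ ≤ Real.exp (-((2 * L' + 18 * γ) * (2 * (d + 1 : ℕ) / ρ)) - 9 * γ) := by
    intro L' hL'
    rw [hκ, Real.exp_le_exp]
    have : 0 ≤ 2 * ((d + 1 : ℕ) : ℝ) / ρ := by positivity
    gcongr
  have hxconv := H.mem_convexHull
  refine ⟨?_, ?_, ?_⟩
  -- The shape functions reproduce affine functions, so the error is the weighted mean of the second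
  -- order remainders.
  · have h1 : ∑ a : P, U a * lmeShape (γ / h ^ 2) P a x - U x = h ^ 2 * ∑ a, w a * r a := by
      have h2 : ∀ a, h ^ 2 * (w a * r a) = U a * w a - U x * w a -
          w a * inner ℝ D ((a : EuclideanSpace ℝ (Fin d)) - x) := by
        intro a
        simp only [hr]
        field_simp
      rw [Finset.mul_sum, Finset.sum_congr rfl fun a _ => h2 a, Finset.sum_sub_distrib,
        Finset.sum_sub_distrib, H.sum_mul_inner, ← Finset.mul_sum, H.sum_eq_one]
      ring
    have h3 : |∑ a, w a * r a| ≤ M * K := by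
      calc |∑ a, w a * r a| ≤ ∑ a, |w a * r a| := Finset.abs_sum_le_sum_abs _ _
        _ ≤ ∑ a, M * (w a * ‖b a‖ ^ 2) := by
          refine Finset.sum_le_sum fun a _ => ?_
          rw [abs_mul, abs_of_nonneg (hw0 a)]
          have := mul_le_mul_of_nonneg_left (hrb a) (hw0 a)
          linarith
        _ ≤ M * K := by
          rw [← Finset.mul_sum]
          exact mul_le_mul_of_nonneg_left (hmj 2 (by norm_num)) hM
    rw [h1, abs_mul, abs_of_pos (by positivity : 0 < h ^ 2), mul_comm]
    have : M * K ≤ M * K + C₂ + C₁ := by linarith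
    gcongr
    exact h3.trans this
  · intro hdir
    have h1 : ‖h⁻¹ • G‖ ≤ C₂ := by
      refine norm_le_of_covariance_system (w := w) (b := b) (r := r) hκ0 (by positivity) hM hw0
        (hmj 3 (by norm_num)) hrb ?_ hsys
      intro e he
      obtain ⟨a, ha, hea, -⟩ := H.exists_node hγ hh hgen hL hρ hρ1 (y := x) (e := e)
        (by simpa using hc) (by simpa using hh.le) he (hdir e he)
        (by simpa [sub_eq_add_neg] using hdir (-e) (by rwa [norm_neg]))
      refine ⟨a, (hκ_le L (by linarith)).trans ha, ?_⟩
      simp only [hb]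
      rwa [real_inner_smul_right, inv_mul_eq_div, le_div_iff₀ hh]
    rw [hGh, mul_comm]
    have : C₂ ≤ M * K + C₂ + C₁ := by
      have : 0 ≤ M * K := by positivity
      linarith
    gcongr
    exact h1.trans this
  · intro n b₀ hn hnodes ht htρ hxn hdir
    set t := inner ℝ n x - b₀ with htdef
    have hth : 0 < t / h := by positivity
    -- The abstract estimate is stated in `s` with `s⁴ = t/h`, so its factor `1/s` is a fourth root.
    set s := √√(t / h) with hs
    have hs0 : 0 < s := Real.sqrt_pos.2 (Real.sqrt_pos.2 hth)
    have hs4 : s ^ 4 = t / h := by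
      rw [show (4 : ℕ) = 2 * 2 from rfl, pow_mul, hs, Real.sq_sqrt (Real.sqrt_nonneg _),
        Real.sq_sqrt hth.le]
    have hthρ : t / h ≤ ρ := by rwa [div_le_iff₀ hh]
    have hs1 : s ≤ 1 := by
      rw [hs, Real.sqrt_le_one, Real.sqrt_le_one]
      linarith
    have hνb : ∀ a : P, inner ℝ n (b a) + s ^ 4 =
        (inner ℝ n (a : EuclideanSpace ℝ (Fin d)) - b₀) / h := by
      intro a
      rw [hs4]
      simp only [hb]
      rw [real_inner_smul_right, inner_sub_right, htdef]
      ring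
    -- The exponent can only drop on the way from `x` down to the facet if it rises upward. But at
    -- `x + ρh n` it is at most `4γ`, and `t ≤ ρh`, so the drop is at most `4γ + L`.
    have hyL : -(2 * L + 4 * γ) ≤ c + inner ℝ l (x - t • n - x) := by
      have h1 := H.exponent_le_of_mem_convexHull hγ hh hgen hxn (R := 1) (by
        rw [add_sub_cancel_left, norm_smul, hn, Real.norm_of_nonneg (by positivity), mul_one]
        gcongr)
      rw [add_sub_cancel_left, real_inner_smul_right] at h1
      have h2 : inner ℝ l (x - t • n - x) = -(t * inner ℝ l n) := by
        rw [show x - t • n - x = -(t • n) by abel, inner_neg_right, real_inner_smul_right]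
      rw [h2]
      rcases le_total (inner ℝ l n) 0 with h3 | h3
      · have := mul_nonpos_of_nonneg_of_nonpos ht.le h3
        linarith
      · have := mul_le_mul_of_nonneg_right htρ h3
        linarith
    have h1 : ‖h⁻¹ • G‖ ≤ C₁ / s := by
      refine hfacet w b r (h⁻¹ • G) n s hs0 hs1 (by rw [hs4]; linarith) hn hw0 H.sum_eq_one ?_
        hmom' hrb ?_ ?_ hsys
      · have h2 : ∑ a, w a • b a = h⁻¹ • ∑ a : P, w a • ((a : EuclideanSpace ℝ (Fin d)) - x) := by
          rw [Finset.smul_sum]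
          exact Finset.sum_congr rfl fun a _ => smul_comm _ _ _
        rw [h2, H.sum_smul, smul_zero]
      · intro a
        rw [hνb]
        rcases hnodes a a.2 with h2 | h2
        · left
          rw [h2, sub_self, zero_div]
        · right
          rw [le_div_iff₀ hh]
          linarith
      · intro e he hne
        obtain ⟨a, ha, hea, hface⟩ := H.exists_node hγ hh hgen (by positivity) hρ hρ1
          (y := x - t • n) (e := e) hyL
          (by
            rw [show x - t • n - x = -(t • n) by abel, norm_neg, norm_smul, hn, mul_one,
              Real.norm_of_nonneg ht.le]
            exact htρ.trans (mul_le_of_le_one_left hh.le hρ1))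
          he (hdir e he hne)
          (by simpa [sub_eq_add_neg] using hdir (-e) (by rwa [norm_neg]) (by simp [hne]))
        refine ⟨a, (hκ_le _ le_rfl).trans ha, ?_, ?_⟩
        · rw [hνb, hface n b₀, sub_self, zero_div]
          · intro z hz
            rcases hnodes z hz with h2 | h2
            · exact h2.ge
            · have : 0 < η * h := by positivity
              linarith
          · rw [inner_add_right, inner_sub_right, real_inner_smul_right, real_inner_smul_right,
              real_inner_self_eq_norm_sq, hn, hne, htdef]
            ring
        · simp only [hb]
          rw [real_inner_smul_right, inv_mul_eq_div, le_div_iff₀ hh]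
          rw [show (a : EuclideanSpace ℝ (Fin d)) - (x - t • n) = (a - x) + t • n by abel,
            inner_add_right, real_inner_smul_right, real_inner_comm n e, hne, mul_zero,
            add_zero] at hea
          exact hea
    have h2 : C₁ ≤ M * K + C₂ + C₁ := by
      have : 0 ≤ M * K := by positivity
      linarith
    calc ‖G‖ = h * ‖h⁻¹ • G‖ := hGh
      _ ≤ h * (C₁ / s) := by gcongr
      _ = C₁ * h / s := by ring
      _ ≤ _ := by gcongr

end PointwiseEstimate

/-! ### Facets of a polytope through their unit inner normals -/

section Facets

variable {d : ℕ}

/-- The pairs `(n, b)` such that `n` is a unit vector and `{x | ⟪n, x⟫ = b}` supports the convex hull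
of `V` and contains points of `V` that span it. -/
def facetFunctionals (V : Finset (EuclideanSpace ℝ (Fin d))) : Set (EuclideanSpace ℝ (Fin d) × ℝ) :=
  {p | ‖p.1‖ = 1 ∧ (∀ v ∈ V, p.2 ≤ inner ℝ p.1 v) ∧
    Module.finrank ℝ (vectorSpan ℝ {v : EuclideanSpace ℝ (Fin d) | v ∈ V ∧ inner ℝ p.1 v = p.2}) + 1
      = d}

variable {V : Finset (EuclideanSpace ℝ (Fin d))}

theorem le_inner_of_mem_convexHull {n x : EuclideanSpace ℝ (Fin d)} {b : ℝ}
    (hV : ∀ v ∈ V, b ≤ inner ℝ n v)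
    (hx : x ∈ convexHull ℝ (V : Set (EuclideanSpace ℝ (Fin d)))) : b ≤ inner ℝ n x := by
  have h : convexHull ℝ (V : Set (EuclideanSpace ℝ (Fin d))) ⊆ {x | b ≤ inner ℝ n x} :=
    convexHull_min hV (convex_halfSpace_ge ⟨fun a b => inner_add_right _ _ _,
      fun r a => by simp [real_inner_smul_right]⟩ _)
  exact h hx

theorem lt_inner_of_mem_interior {n x : EuclideanSpace ℝ (Fin d)} {b : ℝ} (hn : n ≠ 0)
    (hV : ∀ v ∈ V, b ≤ inner ℝ n v)
    (hx : x ∈ interior (convexHull ℝ (V : Set (EuclideanSpace ℝ (Fin d))))) :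
    b < inner ℝ n x := by
  refine lt_of_le_of_ne (le_inner_of_mem_convexHull hV (interior_subset hx)) fun heq => hn ?_
  refine eq_zero_of_inner_eq_zero hx fun a ha => ?_
  obtain ⟨ε, hε, hball⟩ := Metric.isOpen_iff.1 isOpen_interior x hx
  by_contra hne
  have hn' : 0 < ‖n‖ := norm_pos_iff.2 hn
  have hz : x - (ε / 2 / ‖n‖) • n ∈ convexHull ℝ (V : Set (EuclideanSpace ℝ (Fin d))) := by
    refine interior_subset (hball ?_)
    simp only [Metric.mem_ball, dist_self_sub_left, norm_smul, norm_div, norm_norm]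
    rw [div_mul_cancel₀ _ hn'.ne', Real.norm_of_nonneg (by positivity)]
    norm_num
    linarith
  have h1 := le_inner_of_mem_convexHull hV hz
  rw [inner_sub_right, real_inner_smul_right, real_inner_self_eq_norm_sq] at h1
  have : 0 < ε / 2 / ‖n‖ * ‖n‖ ^ 2 := by positivity
  linarith

theorem vectorSpan_le_orthogonal {n : EuclideanSpace ℝ (Fin d)} {b : ℝ}
    {A : Set (EuclideanSpace ℝ (Fin d))} (hA : ∀ x ∈ A, inner ℝ n x = b) :
    vectorSpan ℝ A ≤ (ℝ ∙ n)ᗮ := by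
  rw [vectorSpan_def, Submodule.span_le]
  rintro _ ⟨x, hx, y, hy, rfl⟩
  rw [SetLike.mem_coe, Submodule.mem_orthogonal_singleton_iff_inner_right]
  simp only [vsub_eq_sub]
  rw [inner_sub_right, hA x hx, hA y hy, sub_self]

theorem finrank_orthogonal_singleton_add_one {n : EuclideanSpace ℝ (Fin d)} (hn : n ≠ 0) :
    Module.finrank ℝ (ℝ ∙ n)ᗮ + 1 = d := by
  have h1 := Submodule.finrank_add_finrank_orthogonal (ℝ ∙ n)
  rw [finrank_span_singleton hn, finrank_euclideanSpace_fin] at h1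
  omega

/-- The points of `V` on the hyperplane span its direction, so they determine the normal up to sign;
an interior point fixes the sign. Finiteness of the set of facets follows, as `V` has finitely many
subsets. -/
theorem facetFunctionals_eq_of_eq (hd : 1 < d)
    (hne : (interior (convexHull ℝ (V : Set (EuclideanSpace ℝ (Fin d))))).Nonempty)
    {p q : EuclideanSpace ℝ (Fin d) × ℝ} (hp : p ∈ facetFunctionals V)
    (hq : q ∈ facetFunctionals V)
    (h : {v : EuclideanSpace ℝ (Fin d) | v ∈ V ∧ inner ℝ p.1 v = p.2} =
      {v : EuclideanSpace ℝ (Fin d) | v ∈ V ∧ inner ℝ q.1 v = q.2}) : p = q := by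
  obtain ⟨hp1, hp2, hp3⟩ := hp
  obtain ⟨hq1, hq2, hq3⟩ := hq
  have hp0 : p.1 ≠ 0 := by
    intro h0
    simp [h0] at hp1
  have hq0 : q.1 ≠ 0 := by
    intro h0
    simp [h0] at hq1
  set S := {v : EuclideanSpace ℝ (Fin d) | v ∈ V ∧ inner ℝ p.1 v = p.2} with hS
  have hWp : vectorSpan ℝ S = (ℝ ∙ p.1)ᗮ := by
    refine Submodule.eq_of_le_of_finrank_eq (vectorSpan_le_orthogonal fun x hx => hx.2) ?_
    have := finrank_orthogonal_singleton_add_one hp0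
    omega
  have hWq : vectorSpan ℝ S = (ℝ ∙ q.1)ᗮ := by
    rw [h]
    refine Submodule.eq_of_le_of_finrank_eq (vectorSpan_le_orthogonal fun x hx => hx.2) ?_
    have := finrank_orthogonal_singleton_add_one hq0
    omega
  have hspan : (ℝ ∙ p.1) = (ℝ ∙ q.1) := by
    rw [← Submodule.orthogonal_orthogonal (ℝ ∙ p.1), ← hWp, hWq, Submodule.orthogonal_orthogonal]
  have hmem : q.1 ∈ (ℝ ∙ p.1) := by
    rw [hspan]
    exact Submodule.mem_span_singleton_self _
  obtain ⟨r, hr⟩ := Submodule.mem_span_singleton.1 hmem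
  have hSne : S.Nonempty := by
    by_contra hcon
    rw [Set.not_nonempty_iff_eq_empty] at hcon
    rw [hcon, vectorSpan_empty, finrank_bot] at hp3
    omega
  obtain ⟨v₀, hv₀⟩ := hSne
  have hv₀' : v₀ ∈ V ∧ inner ℝ q.1 v₀ = q.2 := by
    have : v₀ ∈ {v : EuclideanSpace ℝ (Fin d) | v ∈ V ∧ inner ℝ q.1 v = q.2} := h ▸ hv₀
    exact this
  have hq2' : q.2 = r * p.2 := by
    rw [← hv₀'.2, ← hr, real_inner_smul_left, hv₀.2]
  have habs : |r| = 1 := by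
    have := congrArg norm hr
    rw [norm_smul, hp1, hq1, mul_one] at this
    exact this
  rcases eq_or_eq_neg_of_abs_eq habs with hr1 | hr1
  · rw [hr1, one_smul] at hr
    rw [hr1, one_mul] at hq2'
    exact Prod.ext hr hq2'.symm
  · exfalso
    obtain ⟨x, hx⟩ := hne
    have h1 := lt_inner_of_mem_interior hp0 hp2 hx
    have h2 := lt_inner_of_mem_interior hq0 hq2 hx
    rw [← hr, hq2', hr1, real_inner_smul_left] at h2
    linarith

theorem finite_facetFunctionals (hd : 1 < d)
    (hne : (interior (convexHull ℝ (V : Set (EuclideanSpace ℝ (Fin d))))).Nonempty) :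
    (facetFunctionals V).Finite := by
  refine Set.Finite.of_finite_image (f := fun p : EuclideanSpace ℝ (Fin d) × ℝ =>
    {v : EuclideanSpace ℝ (Fin d) | v ∈ V ∧ inner ℝ p.1 v = p.2}) ?_ ?_
  · refine Set.Finite.subset V.finite_toSet.finite_subsets ?_
    rintro _ ⟨p, -, rfl⟩ v hv
    exact hv.1
  · intro p hp q hq h
    exact facetFunctionals_eq_of_eq hd hne hp hq h

theorem mem_convexHull_face {n z : EuclideanSpace ℝ (Fin d)} {b : ℝ}
    (hV : ∀ v ∈ V, b ≤ inner ℝ n v)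
    (hz : z ∈ convexHull ℝ (V : Set (EuclideanSpace ℝ (Fin d)))) (hzb : inner ℝ n z = b) :
    z ∈ convexHull ℝ {v : EuclideanSpace ℝ (Fin d) | v ∈ V ∧ inner ℝ n v = b} := by
  obtain ⟨θ, hθ0, hθ1, hθ⟩ := Finset.mem_convexHull'.1 hz
  have h1 : ∑ v ∈ V, θ v * (inner ℝ n v - b) = 0 := by
    have : ∑ v ∈ V, θ v * (inner ℝ n v - b) =
        inner ℝ n (∑ v ∈ V, θ v • v) - (∑ v ∈ V, θ v) * b := by
      simp only [inner_sum, real_inner_smul_right, Finset.sum_mul, ← Finset.sum_sub_distrib,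
        mul_sub]
    rw [this, hθ, hθ1, hzb]
    ring
  rw [Finset.sum_eq_zero_iff_of_nonneg fun v hv =>
    mul_nonneg (hθ0 v hv) (sub_nonneg.2 (hV v hv))] at h1
  have hzero : ∀ v ∈ V, inner ℝ n v ≠ b → θ v = 0 := fun v hv hne =>
    (mul_eq_zero.1 (h1 v hv)).resolve_right (sub_ne_zero.2 hne)
  classical
  have h2 : ∑ v ∈ V.filter (fun v => inner ℝ n v = b), θ v = 1 := by
    rw [← hθ1]
    refine Finset.sum_subset (Finset.filter_subset _ _) fun v hv hv' => hzero v hv ?_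
    simpa [hv] using hv'
  have h3 : ∑ v ∈ V.filter (fun v => inner ℝ n v = b), θ v • v = z := by
    rw [← hθ]
    refine Finset.sum_subset (Finset.filter_subset _ _) fun v hv hv' => ?_
    rw [hzero v hv (by simpa [hv] using hv'), zero_smul]
  rw [← h3]
  refine (convex_convexHull ℝ _).sum_mem (fun v hv => hθ0 v (Finset.mem_filter.1 hv).1) h2
    fun v hv => subset_convexHull ℝ _ (Finset.mem_filter.1 hv)

/-- Proper affine subspaces are null sets. This provides starting points in general position for the
segment argument in `exists_facetFunctional_lt`. -/
theorem exists_mem_forall_notMem {s : Set (EuclideanSpace ℝ (Fin d))} (hs : IsOpen s)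
    (hne : s.Nonempty) {ι : Type*} (F : Finset ι) (A : ι → AffineSubspace ℝ (EuclideanSpace ℝ (Fin d)))
    (hA : ∀ i ∈ F, A i ≠ ⊤) : ∃ x ∈ s, ∀ i ∈ F, x ∉ A i := by
  by_contra! hcon
  have h1 : s ⊆ ⋃ i ∈ F, (A i : Set (EuclideanSpace ℝ (Fin d))) := by
    intro x hx
    obtain ⟨i, hi, hxi⟩ := hcon x hx
    simp only [Set.mem_iUnion]
    exact ⟨i, hi, hxi⟩
  have h2 : volume (⋃ i ∈ F, (A i : Set (EuclideanSpace ℝ (Fin d)))) = 0 := by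
    refine (measure_biUnion_null_iff F.countable_toSet).2 ?_
    exact fun i hi => Measure.addHaar_affineSubspace _ _ (hA i hi)
  exact (hs.measure_pos volume hne).ne' (measure_mono_null h1 h2)

/-- Follow the segment from an interior point `x₀` to `y` up to its exit point `z` and support the
polytope at `z`. In general the resulting face could have low dimension; this is excluded by
choosing `x₀` off every proper affine span of `y` and points of `V`. Indeed `x₀` lies on the line
through `y` and `z`, so the points of `V` on the face together with `y` span the whole space, and
the face has dimension `d - 1`. -/
theorem exists_facetFunctional_lt {y : EuclideanSpace ℝ (Fin d)}
    (hne : (interior (convexHull ℝ (V : Set (EuclideanSpace ℝ (Fin d))))).Nonempty)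
    (hy : y ∉ convexHull ℝ (V : Set (EuclideanSpace ℝ (Fin d)))) :
    ∃ p ∈ facetFunctionals V, inner ℝ p.1 y < p.2 := by
  classical
  set K := convexHull ℝ (V : Set (EuclideanSpace ℝ (Fin d))) with hK
  have hKc : IsClosed K := V.finite_toSet.isClosed_convexHull ℝ
  let 𝒮 : Finset (Finset (EuclideanSpace ℝ (Fin d))) := V.powerset.filter fun S =>
    affineSpan ℝ (insert y (S : Set (EuclideanSpace ℝ (Fin d)))) ≠ ⊤
  obtain ⟨x₀, hx₀, hx₀S⟩ := exists_mem_forall_notMem isOpen_interior hne 𝒮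
    (fun S => affineSpan ℝ (insert y (S : Set (EuclideanSpace ℝ (Fin d)))))
    (fun S hS => (Finset.mem_filter.1 hS).2)
  -- the last point of the segment from `x₀` to `y` in the polytope
  have hcont : Continuous fun t : ℝ => AffineMap.lineMap x₀ y t :=
    AffineMap.lineMap_continuous
  have hTc : IsCompact (Set.Icc (0 : ℝ) 1 ∩ (fun t : ℝ => AffineMap.lineMap x₀ y t) ⁻¹' K) :=
    isCompact_Icc.inter_right (hKc.preimage hcont)
  obtain ⟨t, ⟨⟨ht0, ht1⟩, htK⟩, htmax⟩ := hTc.exists_isGreatest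
    ⟨0, ⟨le_rfl, zero_le_one⟩, by simpa using interior_subset hx₀⟩
  set z := AffineMap.lineMap x₀ y t with hz
  have hzK : z ∈ K := htK
  have ht1' : t < 1 := by
    refine lt_of_le_of_ne ht1 fun h => hy ?_
    rw [hz, h, AffineMap.lineMap_apply_one] at hzK
    exact hzK
  have hzint : z ∉ interior K := by
    intro hzi
    have h1 : ∀ᶠ s in 𝓝 t, AffineMap.lineMap x₀ y s ∈ interior K :=
      hcont.continuousAt.eventually_mem (isOpen_interior.mem_nhds hzi)
    have h2 : ∀ᶠ s in 𝓝[>] t, s ∈ Set.Ioo t 1 := Ioo_mem_nhdsGT ht1'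
    obtain ⟨s, hs1, hs2⟩ := ((h1.filter_mono nhdsWithin_le_nhds).and h2).exists
    have hsK : AffineMap.lineMap x₀ y s ∈ K := interior_subset hs1
    have := htmax ⟨⟨ht0.trans hs2.1.le, hs2.2.le⟩, hsK⟩
    exact absurd hs2.1 (not_lt.2 this)
  obtain ⟨f, hf⟩ := geometric_hahn_banach_open_point (convex_convexHull ℝ _).interior
    isOpen_interior hzint
  set n₀ := -(InnerProductSpace.toDual ℝ (EuclideanSpace ℝ (Fin d))).symm f with hn₀
  have hfn : ∀ a, inner ℝ n₀ a = -f a := fun a => by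
    rw [hn₀, inner_neg_left, InnerProductSpace.toDual_symm_apply]
  have hn₀0 : n₀ ≠ 0 := by
    intro h0
    have h1 := hf x₀ hx₀
    have h2 := hfn x₀
    have h3 := hfn z
    rw [h0, inner_zero_left] at h2 h3
    linarith
  set n := ‖n₀‖⁻¹ • n₀ with hn
  have hn₀pos : 0 < ‖n₀‖ := norm_pos_iff.2 hn₀0
  have hn1 : ‖n‖ = 1 := norm_smul_inv_norm hn₀0
  have hnf : ∀ a, inner ℝ n a = -(‖n₀‖⁻¹ * f a) := fun a => by
    rw [hn, real_inner_smul_left, hfn]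
    ring
  have hVn : ∀ v ∈ V, inner ℝ n z ≤ inner ℝ n v := by
    intro v hv
    have h1 : v ∈ closure (interior K) := by
      rw [(convex_convexHull ℝ _).closure_interior_eq_closure_of_nonempty_interior hne]
      exact subset_closure (subset_convexHull ℝ _ hv)
    have h2 : closure (interior K) ⊆ {a | f a ≤ f z} :=
      closure_minimal (fun a ha => (hf a ha).le) (isClosed_le f.continuous continuous_const)
    have h3 : f v ≤ f z := h2 h1
    rw [hnf, hnf]
    gcongr
  have hx₀n : inner ℝ n z < inner ℝ n x₀ := by
    have := hf x₀ hx₀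
    rw [hnf, hnf]
    gcongr
  have hzS := mem_convexHull_face hVn hzK rfl
  set S := V.filter fun v => inner ℝ n v = inner ℝ n z with hS
  have hScoe : (S : Set (EuclideanSpace ℝ (Fin d))) =
      {v : EuclideanSpace ℝ (Fin d) | v ∈ V ∧ inner ℝ n v = inner ℝ n z} := by
    ext v
    simp [hS]
  have htop : affineSpan ℝ (insert y (S : Set (EuclideanSpace ℝ (Fin d)))) = ⊤ := by
    by_contra hcon
    refine hx₀S S (Finset.mem_filter.2 ⟨Finset.mem_powerset.2 (Finset.filter_subset _ _), hcon⟩) ?_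
    have h1 : z ∈ affineSpan ℝ (insert y (S : Set (EuclideanSpace ℝ (Fin d)))) := by
      rw [← hScoe] at hzS
      exact affineSpan_mono ℝ (Set.subset_insert _ _) (convexHull_subset_affineSpan _ hzS)
    have h2 : y ∈ affineSpan ℝ (insert y (S : Set (EuclideanSpace ℝ (Fin d)))) :=
      mem_affineSpan ℝ (Set.mem_insert _ _)
    -- Solving `z = (1 - t) x₀ + t y` for `x₀` gives this parameter.
    have h3 : x₀ = AffineMap.lineMap z y (-(t / (1 - t))) := by
      have : (1 - t) ≠ 0 := by linarith
      rw [hz]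
      simp only [AffineMap.lineMap_apply_module]
      rw [smul_add, smul_smul, smul_smul, add_assoc, ← add_smul]
      have e1 : (1 - -(t / (1 - t))) * (1 - t) = 1 := by field_simp; ring
      have e2 : (1 - -(t / (1 - t))) * t + -(t / (1 - t)) = 0 := by field_simp; ring
      rw [e1, e2, one_smul, zero_smul, add_zero]
    rw [h3]
    exact AffineMap.lineMap_mem _ h1 h2
  have hSne : S.Nonempty := by
    have h1 : (S : Set (EuclideanSpace ℝ (Fin d))).Nonempty := by
      rw [hScoe]
      exact convexHull_nonempty_iff.1 ⟨z, hzS⟩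
    exact_mod_cast h1
  refine ⟨(n, inner ℝ n z), ⟨hn1, hVn, ?_⟩, ?_⟩
  · have hn0 : n ≠ 0 := by
      rw [← norm_pos_iff, hn1]
      exact one_pos
    change Module.finrank ℝ (vectorSpan ℝ
      {v : EuclideanSpace ℝ (Fin d) | v ∈ V ∧ inner ℝ n v = inner ℝ n z}) + 1 = d
    have h1 := Submodule.finrank_mono (vectorSpan_le_orthogonal (n := n) (b := inner ℝ n z)
      (A := {v : EuclideanSpace ℝ (Fin d) | v ∈ V ∧ inner ℝ n v = inner ℝ n z}) fun x hx => hx.2)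
    have h2 := finrank_orthogonal_singleton_add_one hn0
    have h3 := finrank_vectorSpan_insert_le_set ℝ (S : Set (EuclideanSpace ℝ (Fin d))) y
    rw [← direction_affineSpan ℝ (insert y (S : Set (EuclideanSpace ℝ (Fin d)))), htop,
      AffineSubspace.direction_top, finrank_top, finrank_euclideanSpace_fin, hScoe] at h3
    omega
  · have h1 : inner ℝ n z = (1 - t) * inner ℝ n x₀ + t * inner ℝ n y := by
      rw [hz, AffineMap.lineMap_apply_module, inner_add_right, real_inner_smul_right,
        real_inner_smul_right]
    have h2 : 0 < t := by
      refine lt_of_le_of_ne ht0 fun h => hzint ?_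
      rw [hz, ← h, AffineMap.lineMap_apply_zero]
      exact hx₀
    have h3 : 0 < (1 - t) * (inner ℝ n x₀ - inner ℝ n z) :=
      mul_pos (by linarith) (by linarith)
    simp only
    refine lt_of_mul_lt_mul_left ?_ h2.le
    linarith

theorem mem_interior_convexHull_iff (hd : 1 < d)
    (hne : (interior (convexHull ℝ (V : Set (EuclideanSpace ℝ (Fin d))))).Nonempty)
    {x : EuclideanSpace ℝ (Fin d)} :
    x ∈ interior (convexHull ℝ (V : Set (EuclideanSpace ℝ (Fin d)))) ↔
      ∀ p ∈ facetFunctionals V, p.2 < inner ℝ p.1 x := by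
  constructor
  · intro hx p hp
    refine lt_inner_of_mem_interior (fun h0 => ?_) hp.2.1 hx
    have := hp.1
    simp [h0] at this
  · intro hx
    have hopen : IsOpen {x : EuclideanSpace ℝ (Fin d) |
        ∀ p ∈ facetFunctionals V, p.2 < inner ℝ p.1 x} := by
      have : {x : EuclideanSpace ℝ (Fin d) | ∀ p ∈ facetFunctionals V, p.2 < inner ℝ p.1 x} =
          ⋂ p ∈ facetFunctionals V, {x | p.2 < inner ℝ p.1 x} := by
        ext
        simp
      rw [this]
      exact (finite_facetFunctionals hd hne).isOpen_biInter fun p _ =>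
        isOpen_lt continuous_const (continuous_const.inner continuous_id)
    refine interior_maximal (fun z hz => ?_) hopen hx
    by_contra hcon
    obtain ⟨p, hp, hlt⟩ := exists_facetFunctional_lt hne hcon
    exact lt_asymm hlt (hz p hp)

theorem mem_convexHull_iff_facetFunctionals
    (hne : (interior (convexHull ℝ (V : Set (EuclideanSpace ℝ (Fin d))))).Nonempty)
    {x : EuclideanSpace ℝ (Fin d)} :
    x ∈ convexHull ℝ (V : Set (EuclideanSpace ℝ (Fin d))) ↔
      ∀ p ∈ facetFunctionals V, p.2 ≤ inner ℝ p.1 x := by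
  constructor
  · exact fun hx p hp => le_inner_of_mem_convexHull hp.2.1 hx
  · intro hx
    by_contra hcon
    obtain ⟨p, hp, hlt⟩ := exists_facetFunctional_lt hne hcon
    exact absurd hlt (not_lt.2 (hx p hp))

theorem closure_interior_convexHull
    (hne : (interior (convexHull ℝ (V : Set (EuclideanSpace ℝ (Fin d))))).Nonempty) :
    closure (interior (convexHull ℝ (V : Set (EuclideanSpace ℝ (Fin d))))) =
      convexHull ℝ (V : Set (EuclideanSpace ℝ (Fin d))) := by
  rw [(convex_convexHull ℝ _).closure_interior_eq_closure_of_nonempty_interior hne,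
    (V.finite_toSet.isClosed_convexHull ℝ).closure_eq]

theorem isFacet_of_mem_facetFunctionals
    (hne : (interior (convexHull ℝ (V : Set (EuclideanSpace ℝ (Fin d))))).Nonempty)
    {p : EuclideanSpace ℝ (Fin d) × ℝ} (hp : p ∈ facetFunctionals V) :
    IsFacet (interior (convexHull ℝ (V : Set (EuclideanSpace ℝ (Fin d)))))
      {x | x ∈ convexHull ℝ (V : Set (EuclideanSpace ℝ (Fin d))) ∧ inner ℝ p.1 x = p.2} := by
  obtain ⟨hp1, hp2, hp3⟩ := hp
  have hp0 : p.1 ≠ 0 := by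
    intro h0
    simp [h0] at hp1
  constructor
  · rintro ⟨z, hzK, hz⟩
    refine ⟨-innerSL ℝ p.1, ?_⟩
    rw [closure_interior_convexHull hne]
    ext x
    simp only [Set.mem_ofPred_eq, neg_apply, innerSL_apply_apply, neg_le_neg_iff]
    constructor
    · rintro ⟨hx, hxp⟩
      exact ⟨hx, fun y hy => hxp.le.trans (le_inner_of_mem_convexHull hp2 hy)⟩
    · rintro ⟨hx, hxp⟩
      exact ⟨hx, le_antisymm ((hxp z hzK).trans hz.le) (le_inner_of_mem_convexHull hp2 hx)⟩
  · have h1 := Submodule.finrank_mono (vectorSpan_le_orthogonal (n := p.1) (b := p.2)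
      (A := {x | x ∈ convexHull ℝ (V : Set (EuclideanSpace ℝ (Fin d))) ∧ inner ℝ p.1 x = p.2})
      fun x hx => hx.2)
    have h2 := finrank_orthogonal_singleton_add_one hp0
    have h3 := Submodule.finrank_mono (vectorSpan_mono ℝ (show
      {v : EuclideanSpace ℝ (Fin d) | v ∈ V ∧ inner ℝ p.1 v = p.2} ⊆
      {x | x ∈ convexHull ℝ (V : Set (EuclideanSpace ℝ (Fin d))) ∧ inner ℝ p.1 x = p.2} from
      fun v hv => ⟨subset_convexHull ℝ _ hv.1, hv.2⟩))
    omega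

/-- The distance to a facet is controlled by the height over it. -/
theorem exists_infDist_face_le (hd : 1 < d) {p : EuclideanSpace ℝ (Fin d) × ℝ}
    (hp : p ∈ facetFunctionals V) :
    ∃ C : ℝ, 0 < C ∧ ∀ x ∈ convexHull ℝ (V : Set (EuclideanSpace ℝ (Fin d))),
      Metric.infDist x
        {x | x ∈ convexHull ℝ (V : Set (EuclideanSpace ℝ (Fin d))) ∧ inner ℝ p.1 x = p.2} ≤
      C * (inner ℝ p.1 x - p.2) := by
  classical
  obtain ⟨hp1, hp2, hp3⟩ := hp
  obtain ⟨v₀, hv₀V, hv₀⟩ : {v : EuclideanSpace ℝ (Fin d) | v ∈ V ∧ inner ℝ p.1 v = p.2}.Nonempty := by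
    by_contra hcon
    rw [Set.not_nonempty_iff_eq_empty] at hcon
    rw [hcon, vectorSpan_empty, finrank_bot] at hp3
    omega
  have hC : ∀ v ∈ V, ∃ c : ℝ, 0 ≤ c ∧
      ((if inner ℝ p.1 v = p.2 then (0 : ℝ) else 1) * ‖v - v₀‖ ≤ c * (inner ℝ p.1 v - p.2)) := by
    intro v hv
    by_cases h : inner ℝ p.1 v = p.2
    · exact ⟨0, le_rfl, by simp [h]⟩
    · have h1 : 0 < inner ℝ p.1 v - p.2 :=
        sub_pos.2 (lt_of_le_of_ne (hp2 v hv) (Ne.symm h))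
      refine ⟨‖v - v₀‖ / (inner ℝ p.1 v - p.2), by positivity, ?_⟩
      rw [if_neg h, one_mul, div_mul_cancel₀ _ h1.ne']
  choose! c hc0 hc using hC
  refine ⟨∑ v ∈ V, c v + 1, ?_, ?_⟩
  · have := Finset.sum_nonneg hc0
    linarith
  intro x hx
  obtain ⟨θ, hθ0, hθ1, hθ⟩ := Finset.mem_convexHull'.1 hx
  -- Vertices off the facet are moved to one fixed vertex `v₀` on it. Only these contribute to `x -
  -- x'`, and each has positive height, so its displacement is a bounded multiple of the height.
  set x' := ∑ v ∈ V, θ v • (if inner ℝ p.1 v = p.2 then v else v₀) with hx'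
  have hx'K : x' ∈ convexHull ℝ (V : Set (EuclideanSpace ℝ (Fin d))) := by
    refine (convex_convexHull ℝ _).sum_mem hθ0 hθ1 fun v hv => ?_
    split_ifs
    · exact subset_convexHull ℝ _ hv
    · exact subset_convexHull ℝ _ hv₀V
  have hx'p : inner ℝ p.1 x' = p.2 := by
    rw [hx', inner_sum]
    have : ∀ v ∈ V, inner ℝ p.1 (θ v • (if inner ℝ p.1 v = p.2 then v else v₀)) = θ v * p.2 := by
      intro v _
      rw [real_inner_smul_right]
      split_ifs with h
      · rw [h]
      · rw [hv₀]
    rw [Finset.sum_congr rfl this, ← Finset.sum_mul, hθ1, one_mul]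
  have hx'F : x' ∈ {x | x ∈ convexHull ℝ (V : Set (EuclideanSpace ℝ (Fin d))) ∧
      inner ℝ p.1 x = p.2} := ⟨hx'K, hx'p⟩
  refine (Metric.infDist_le_dist_of_mem hx'F).trans ?_
  rw [dist_eq_norm]
  have h1 : x - x' = ∑ v ∈ V, θ v • (v - (if inner ℝ p.1 v = p.2 then v else v₀)) := by
    rw [← hθ, hx', ← Finset.sum_sub_distrib]
    exact Finset.sum_congr rfl fun v _ => (smul_sub _ _ _).symm
  have h2 : inner ℝ p.1 x - p.2 = ∑ v ∈ V, θ v * (inner ℝ p.1 v - p.2) := by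
    simp only [mul_sub, Finset.sum_sub_distrib, ← Finset.sum_mul, hθ1, one_mul]
    rw [← hθ, inner_sum]
    simp only [real_inner_smul_right]
  rw [h1, h2, Finset.mul_sum]
  refine (norm_sum_le _ _).trans (Finset.sum_le_sum fun v hv => ?_)
  rw [norm_smul, Real.norm_of_nonneg (hθ0 v hv)]
  have h3 : ‖v - (if inner ℝ p.1 v = p.2 then v else v₀)‖ =
      (if inner ℝ p.1 v = p.2 then (0 : ℝ) else 1) * ‖v - v₀‖ := by
    split_ifs <;> simp
  have h4 : c v ≤ ∑ v ∈ V, c v + 1 := by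
    have := Finset.single_le_sum hc0 hv
    linarith
  have h5 := sub_nonneg.2 (hp2 v hv)
  have h6 := hθ0 v hv
  calc θ v * ‖v - (if inner ℝ p.1 v = p.2 then v else v₀)‖
      ≤ θ v * (c v * (inner ℝ p.1 v - p.2)) := by
        rw [h3]
        exact mul_le_mul_of_nonneg_left (hc v hv) h6
    _ ≤ θ v * ((∑ v ∈ V, c v + 1) * (inner ℝ p.1 v - p.2)) := by gcongr
    _ = _ := by ring

end Facets

/-! ### Classical gradients as weak gradients -/

section ClassicalGradient

variable {d : ℕ}

theorem integral_fderiv_eq_zero_of_hasCompactSupport {F : EuclideanSpace ℝ (Fin d) → ℝ}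
    (hF : ContDiff ℝ 1 F) (hc : HasCompactSupport F) (v : EuclideanSpace ℝ (Fin d)) :
    ∫ x, fderiv ℝ F x v = 0 := by
  have h1 : Integrable fun x => fderiv ℝ F x v :=
    ((hF.continuous_fderiv (by simp)).clm_apply continuous_const).integrable_of_hasCompactSupport
      (hc.fderiv_apply (𝕜 := ℝ) v)
  have h2 : Integrable F := hF.continuous.integrable_of_hasCompactSupport hc
  have h3 := integral_mul_fderiv_eq_neg_fderiv_mul_of_integrable (𝕜 := ℝ) (μ := volume)
    (f := fun _ : EuclideanSpace ℝ (Fin d) => (1 : ℝ)) (g := F) (v := v)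
    (by simp) (by simpa using h1) (by simpa using h2) (fun x _ => by fun_prop)
    (fun x _ => hF.differentiable (by simp) x)
  simpa using h3

theorem ContDiffOn.contDiff_mul_of_tsupport_subset {Ω : Set (EuclideanSpace ℝ (Fin d))}
    (hΩ : IsOpen Ω) {f φ : EuclideanSpace ℝ (Fin d) → ℝ} (hf : ContDiffOn ℝ 1 f Ω)
    (hφ : ContDiff ℝ 1 φ) (hsub : tsupport φ ⊆ Ω) : ContDiff ℝ 1 fun x => f x * φ x := by
  rw [contDiff_iff_contDiffAt]
  intro x
  by_cases hx : x ∈ Ω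
  · exact (hf.contDiffAt (hΩ.mem_nhds hx)).mul hφ.contDiffAt
  · have h1 : (fun y => f y * φ y) =ᶠ[𝓝 x] fun _ => 0 := by
      have := notMem_tsupport_iff_eventuallyEq.1 fun h => hx (hsub h)
      filter_upwards [this] with y hy
      rw [hy]
      simp
    exact contDiffAt_const.congr_of_eventuallyEq h1

/-- A continuously differentiable function with square integrable gradient is in `H¹`. -/
theorem hasH1Gradient_of_contDiffOn {Ω : Set (EuclideanSpace ℝ (Fin d))} (hΩ : IsOpen Ω)
    {f : EuclideanSpace ℝ (Fin d) → ℝ} (hf : ContDiffOn ℝ 1 f Ω)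
    (hf2 : MemLp f 2 (volume.restrict Ω)) (hg2 : MemLp (gradient f) 2 (volume.restrict Ω)) :
    HasH1Gradient Ω f (gradient f) := by
  refine ⟨hf2, hg2, fun φ hφ hc hsub v => ?_⟩
  have hφ1 : ContDiff ℝ 1 φ := hφ.of_le (by simp)
  have hF := hf.contDiff_mul_of_tsupport_subset hΩ hφ1 hsub
  have hFc : HasCompactSupport fun x => f x * φ x := hc.mul_left
  have h0 := integral_fderiv_eq_zero_of_hasCompactSupport hF hFc v
  have hder : ∀ x ∈ Ω, fderiv ℝ (fun x => f x * φ x) x v =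
      f x * fderiv ℝ φ x v + inner ℝ (gradient f x) v * φ x := by
    intro x hx
    have h1 : DifferentiableAt ℝ f x :=
      (hf.contDiffAt (hΩ.mem_nhds hx)).differentiableAt (by simp)
    rw [fderiv_fun_mul h1 (hφ1.differentiable (by simp) x), inner_gradient_left]
    simp [mul_comm]
  have hsupp : ∀ x ∉ Ω, fderiv ℝ (fun x => f x * φ x) x v = 0 := by
    intro x hx
    have h1 : x ∉ tsupport fun x => f x * φ x := fun h =>
      hx (hsub (tsupport_mul_subset_right h))
    have h2 := notMem_tsupport_iff_eventuallyEq.1 h1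
    rw [h2.fderiv_eq]
    simp
  rw [← setIntegral_eq_integral_of_forall_compl_eq_zero hsupp,
    setIntegral_congr_fun hΩ.measurableSet hder, integral_add] at h0
  · linarith
  · have h1 : MemLp (fun x => fderiv ℝ φ x v) 2 (volume.restrict Ω) :=
      (((hφ1.continuous_fderiv (by simp)).clm_apply continuous_const).memLp_of_hasCompactSupport
        (hc.fderiv_apply (𝕜 := ℝ) v)).restrict _
    exact hf2.integrable_mul h1
  · have h1 : MemLp φ 2 (volume.restrict Ω) :=
      (hφ.continuous.memLp_of_hasCompactSupport hc).restrict _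
    have h2 : MemLp (fun x => inner ℝ (gradient f x) v) 2 (volume.restrict Ω) := by
      have := hg2.const_inner (𝕜 := ℝ) v
      simpa only [real_inner_comm] using this
    exact h2.integrable_mul h1

theorem ContDiffOn.continuousOn_gradient {Ω : Set (EuclideanSpace ℝ (Fin d))} (hΩ : IsOpen Ω)
    {f : EuclideanSpace ℝ (Fin d) → ℝ} (hf : ContDiffOn ℝ 1 f Ω) : ContinuousOn (gradient f) Ω := by
  unfold gradient
  exact (LinearIsometryEquiv.continuous _).comp_continuousOn
    (hf.continuousOn_fderiv_of_isOpen hΩ le_rfl)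

end ClassicalGradient

theorem eLpNorm_two_sq {α F : Type*} [NormedAddCommGroup F] [MeasurableSpace α] {μ : Measure α} (f : α → F) :
    eLpNorm f 2 μ ^ 2 = ∫⁻ x, ‖f x‖ₑ ^ 2 ∂μ := by
  have := eLpNorm_nnreal_pow_eq_lintegral (f := f) (μ := μ) (p := 2) (by norm_num)
  simpa using this

/-! ### Mollification followed by a homothety: mean square bounds -/

section Mollification

variable {d : ℕ} {F : Type*} [NormedAddCommGroup F] [NormedSpace ℝ F]

/-- Jensen's inequality for the probability density `ρ`, obtained from Cauchy–Schwarz after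
splitting `ρ = √ρ · √ρ`. -/
theorem enorm_integral_smul_sq_le {α : Type*} [MeasurableSpace α] {μ : Measure α} {ρ : α → ℝ}
    (hρ : Measurable ρ) (hρ0 : ∀ z, 0 ≤ ρ z) (hρ1 : ∫⁻ z, ENNReal.ofReal (ρ z) ∂μ = 1)
    {f : α → F} (hf : StronglyMeasurable f) :
    ‖∫ z, ρ z • f z ∂μ‖ₑ ^ 2 ≤ ∫⁻ z, ENNReal.ofReal (ρ z) * ‖f z‖ₑ ^ 2 ∂μ := by
  have h1 : ‖∫ z, ρ z • f z ∂μ‖ₑ ≤ ∫⁻ z, ENNReal.ofReal (ρ z) ^ (1 / 2 : ℝ) *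
      (ENNReal.ofReal (ρ z) ^ (1 / 2 : ℝ) * ‖f z‖ₑ) ∂μ := by
    refine (enorm_integral_le_lintegral_enorm _).trans (le_of_eq (lintegral_congr fun z => ?_))
    rw [enorm_smul, ← mul_assoc, ← ENNReal.rpow_add_of_nonneg _ _ (by norm_num) (by norm_num)]
    norm_num
    rw [Real.enorm_eq_ofReal (hρ0 z)]
  have h2 := ENNReal.lintegral_mul_le_Lp_mul_Lq μ (Real.HolderConjugate.two_two)
    (f := fun z => ENNReal.ofReal (ρ z) ^ (1 / 2 : ℝ))
    (g := fun z => ENNReal.ofReal (ρ z) ^ (1 / 2 : ℝ) * ‖f z‖ₑ)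
    (hρ.ennreal_ofReal.pow_const _).aemeasurable
    ((hρ.ennreal_ofReal.pow_const _).mul hf.enorm).aemeasurable
  have e1 : ∀ z, (ENNReal.ofReal (ρ z) ^ (1 / 2 : ℝ)) ^ (2 : ℝ) = ENNReal.ofReal (ρ z) := fun z => by
    rw [← ENNReal.rpow_mul]
    norm_num
  have e2 : ∀ z, (ENNReal.ofReal (ρ z) ^ (1 / 2 : ℝ) * ‖f z‖ₑ) ^ (2 : ℝ) =
      ENNReal.ofReal (ρ z) * ‖f z‖ₑ ^ 2 := fun z => by
    rw [ENNReal.mul_rpow_of_nonneg _ _ (by norm_num), e1]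
    norm_num
  simp only [Pi.mul_apply, e1, e2, hρ1, ENNReal.one_rpow, one_mul] at h2
  have h3 := ENNReal.rpow_le_rpow (h1.trans h2) (by norm_num : (0 : ℝ) ≤ 2)
  rw [← ENNReal.rpow_mul] at h3
  norm_num at h3
  exact h3

theorem lintegral_comp_smul_add (g : EuclideanSpace ℝ (Fin d) → ENNReal) (hg : Measurable g) {s : ℝ}
    (hs : 0 < s) (c : EuclideanSpace ℝ (Fin d)) :
    ∫⁻ x, g (s • x + c) = ENNReal.ofReal ((s ^ d)⁻¹) * ∫⁻ x, g x := by
  have h1 : ∫⁻ x : EuclideanSpace ℝ (Fin d), g (s • x + c) =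
      ∫⁻ y, g (y + c) ∂(Measure.map (fun x : EuclideanSpace ℝ (Fin d) => s • x) volume) := by
    have := lintegral_map (μ := (volume : Measure (EuclideanSpace ℝ (Fin d))))
      (f := fun y => g (y + c)) (hg.comp (measurable_add_const c)) (measurable_const_smul s)
    exact this.symm
  rw [h1, Measure.map_addHaar_smul _ hs.ne', lintegral_smul_measure,
    lintegral_add_right_eq_self g c, finrank_euclideanSpace_fin, abs_of_pos (by positivity),
    smul_eq_mul]

/-- Mollification composed with the homothety with center `x₀` and ratio `s`. -/
noncomputable def dilatedMollify (ρ : EuclideanSpace ℝ (Fin d) → ℝ) (x₀ : EuclideanSpace ℝ (Fin d))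
    (s : ℝ) (f : EuclideanSpace ℝ (Fin d) → F) (x : EuclideanSpace ℝ (Fin d)) : F :=
  (convolution ρ f (ContinuousLinearMap.lsmul ℝ ℝ) volume) (x₀ + s • (x - x₀))

theorem lintegral_dilatedMollify_sq_le {ρ : EuclideanSpace ℝ (Fin d) → ℝ}
    (hρ : Measurable ρ) (hρ0 : ∀ z, 0 ≤ ρ z) (hρ1 : ∫⁻ z, ENNReal.ofReal (ρ z) = 1)
    (x₀ : EuclideanSpace ℝ (Fin d)) {s : ℝ} (hs : 0 < s) {f : EuclideanSpace ℝ (Fin d) → F}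
    (hf : StronglyMeasurable f) :
    ∫⁻ x, ‖dilatedMollify ρ x₀ s f x‖ₑ ^ 2 ≤
      ENNReal.ofReal ((s ^ d)⁻¹) * ∫⁻ x, ‖f x‖ₑ ^ 2 := by
  have hmeas : Measurable fun x => ‖f x‖ₑ ^ 2 := hf.enorm.pow_const 2
  calc ∫⁻ x, ‖dilatedMollify ρ x₀ s f x‖ₑ ^ 2
      ≤ ∫⁻ x, ∫⁻ z, ENNReal.ofReal (ρ z) * ‖f (x₀ + s • (x - x₀) - z)‖ₑ ^ 2 := by
        refine lintegral_mono fun x => ?_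
        rw [dilatedMollify, convolution_def]
        exact enorm_integral_smul_sq_le hρ hρ0 hρ1
          (hf.comp_measurable (measurable_const.sub measurable_id))
    _ = ∫⁻ z, ∫⁻ x, ENNReal.ofReal (ρ z) * ‖f (x₀ + s • (x - x₀) - z)‖ₑ ^ 2 := by
        refine lintegral_lintegral_swap (Measurable.aemeasurable ?_)
        refine (hρ.ennreal_ofReal.comp measurable_snd).mul (hmeas.comp ?_)
        fun_prop
    _ = ∫⁻ z, ENNReal.ofReal (ρ z) * (ENNReal.ofReal ((s ^ d)⁻¹) * ∫⁻ x, ‖f x‖ₑ ^ 2) := by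
        refine lintegral_congr fun z => ?_
        have hm : Measurable fun x => ‖f (x₀ + s • (x - x₀) - z)‖ₑ ^ 2 :=
          hmeas.comp (g := fun x => ‖f x‖ₑ ^ 2) (f := fun x => x₀ + s • (x - x₀) - z)
            (by fun_prop)
        rw [lintegral_const_mul _ hm]
        congr 1
        rw [← lintegral_comp_smul_add _ hmeas hs (x₀ - s • x₀ - z)]
        refine lintegral_congr fun x => ?_
        congr 3
        rw [smul_sub]
        abel
    _ = _ := by
        rw [lintegral_mul_const _ hρ.ennreal_ofReal, hρ1, one_mul]

theorem eLpNorm_dilatedMollify_le {ρ : EuclideanSpace ℝ (Fin d) → ℝ}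
    (hρ : Measurable ρ) (hρ0 : ∀ z, 0 ≤ ρ z) (hρ1 : ∫⁻ z, ENNReal.ofReal (ρ z) = 1)
    (x₀ : EuclideanSpace ℝ (Fin d)) {s : ℝ} (hs : 1 / 2 ≤ s) {f : EuclideanSpace ℝ (Fin d) → F}
    (hf : StronglyMeasurable f) :
    eLpNorm (dilatedMollify ρ x₀ s f) 2 volume ≤ 2 ^ d * eLpNorm f 2 volume := by
  have h1 := lintegral_dilatedMollify_sq_le hρ hρ0 hρ1 x₀ (by linarith : 0 < s) hf
  rw [← eLpNorm_two_sq, ← eLpNorm_two_sq] at h1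
  -- The sharp constant would be `2 ^ (d / 2)`; the cruder `2 ^ d` avoids a root.
  have h2 : ENNReal.ofReal ((s ^ d)⁻¹) ≤ (2 ^ d) ^ 2 := by
    have h3 : (s ^ d)⁻¹ ≤ 2 ^ d := by
      rw [← inv_pow]
      have h4 : 0 ≤ s⁻¹ := inv_nonneg.2 (by linarith)
      have h5 : s⁻¹ ≤ 2 := by
        rw [inv_le_comm₀ (by linarith) (by norm_num)]
        linarith
      gcongr
    calc ENNReal.ofReal ((s ^ d)⁻¹) ≤ ENNReal.ofReal (2 ^ d) := ENNReal.ofReal_le_ofReal h3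
      _ = 2 ^ d := by rw [ENNReal.ofReal_pow (by norm_num)]; norm_num
      _ ≤ (2 ^ d) ^ 2 := le_self_pow₀ (one_le_pow₀ (by norm_num)) (by norm_num)
  have h3 : eLpNorm (dilatedMollify ρ x₀ s f) 2 volume ^ 2 ≤ (2 ^ d * eLpNorm f 2 volume) ^ 2 := by
    rw [mul_pow]
    exact h1.trans (by gcongr)
  exact (ENNReal.pow_le_pow_left_iff (by norm_num)).1 h3

end Mollification

/-! ### Convergence of dilated mollifications -/

section Mollification

variable {d : ℕ} {F : Type*} [NormedAddCommGroup F] [NormedSpace ℝ F]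

theorem ContDiffBump.lintegral_ofReal_normed (ρ : ContDiffBump (0 : EuclideanSpace ℝ (Fin d))) :
    ∫⁻ z, ENNReal.ofReal (ρ.normed volume z) = 1 := by
  rw [← ofReal_integral_eq_lintegral_ofReal ρ.integrable_normed
    (Eventually.of_forall ρ.nonneg_normed), ρ.integral_normed, ENNReal.ofReal_one]

theorem continuous_dilatedMollify [CompleteSpace F] (ρ : ContDiffBump (0 : EuclideanSpace ℝ (Fin d)))
    (x₀ : EuclideanSpace ℝ (Fin d)) (s : ℝ) {f : EuclideanSpace ℝ (Fin d) → F}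
    (hf : LocallyIntegrable f) : Continuous (dilatedMollify (ρ.normed volume) x₀ s f) := by
  have h1 : Continuous (convolution (ρ.normed volume) f (ContinuousLinearMap.lsmul ℝ ℝ) volume) :=
    ρ.hasCompactSupport_normed.continuous_convolution_left _ ρ.continuous_normed hf
  unfold dilatedMollify
  fun_prop

/-- Mollifications with small support, dilated by a factor close to one, are close to the
function in the mean. -/
theorem exists_eLpNorm_dilatedMollify_sub_le [CompleteSpace F] {Ω : Set (EuclideanSpace ℝ (Fin d))}
    (hΩb : Bornology.IsBounded Ω) (hΩm : MeasurableSet Ω) (x₀ : EuclideanSpace ℝ (Fin d))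
    {f : EuclideanSpace ℝ (Fin d) → F}
    (hf : StronglyMeasurable f) (hf2 : MemLp f 2 volume) {e : ℝ} (he : 0 < e) :
    ∃ δ : ℝ, 0 < δ ∧ ∀ s : ℝ, 1 - δ ≤ s → 1 / 2 ≤ s → s ≤ 1 →
      ∀ ρ : ContDiffBump (0 : EuclideanSpace ℝ (Fin d)), ρ.rOut ≤ δ →
        eLpNorm (dilatedMollify (ρ.normed volume) x₀ s f - f) 2 (volume.restrict Ω) ≤
          ENNReal.ofReal e := by
  have hvol : volume Ω < ⊤ := hΩb.measure_lt_top
  -- A third of the error for each of three terms: the operator on a continuous approximation, the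
  -- operator on the remainder (whence `2 ^ d`), and the remainder itself.
  set e₁ := e / (3 * 2 ^ d) with he₁
  have he₁0 : 0 < e₁ := by positivity
  obtain ⟨fc, hfcs, hfce, hfcc, hfc2⟩ := hf2.exists_hasCompactSupport_eLpNorm_sub_le (by norm_num)
    (ENNReal.ofReal_pos.2 he₁0).ne'
  set W := (volume Ω).toReal ^ (1 / 2 : ℝ) with hW
  have hW0 : 0 ≤ W := by positivity
  set e₂ := e / (3 * (W + 1)) with he₂
  have he₂0 : 0 < e₂ := by positivity
  have huc : UniformContinuous fc := hfcc.uniformContinuous_of_tendsto_cocompact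
    (x := 0) hfcs.is_zero_at_infty
  obtain ⟨δ₀, hδ₀, huc⟩ := Metric.uniformContinuous_iff.1 huc e₂ he₂0
  obtain ⟨R, hR⟩ := hΩb.subset_closedBall x₀
  set R' := max R 0 with hR'
  have hR'0 : 0 ≤ R' := le_max_right _ _
  -- The argument moves by at most `δ` through the mollifier and `δR'` through the homothety,
  -- together `δ₀/2`.
  refine ⟨δ₀ / (2 * (R' + 1)), by positivity, fun s hs1 hs2 hs3 ρ hρ => ?_⟩
  set δ := δ₀ / (2 * (R' + 1)) with hδ
  have hδ0 : 0 < δ := by positivity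
  have hδR : δ * (R' + 1) = δ₀ / 2 := by rw [hδ]; field_simp
  set A := fun f : EuclideanSpace ℝ (Fin d) → F => dilatedMollify (ρ.normed volume) x₀ s f with hA
  have hfint : LocallyIntegrable f := hf2.locallyIntegrable (by norm_num)
  have hfcint : LocallyIntegrable fc := hfcc.locallyIntegrable
  have hlin : A f = A fc + A (f - fc) := by
    ext x
    have h1 : f = fc + (f - fc) := by abel
    simp only [hA, Pi.add_apply, dilatedMollify]
    conv_lhs => rw [h1]
    exact ConvolutionExistsAt.distrib_add
      (ρ.hasCompactSupport_normed.convolutionExists_left _ ρ.continuous_normed hfcint _)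
      (ρ.hasCompactSupport_normed.convolutionExists_left _ ρ.continuous_normed
        (hfint.sub hfcint) _)
  have hsplit : A f - f = (A fc - fc) + (A (f - fc) + (fc - f)) := by
    rw [hlin]
    abel
  have hm1 : Continuous (A fc) := continuous_dilatedMollify ρ x₀ s hfcint
  have hm2 : Continuous (A (f - fc)) := continuous_dilatedMollify ρ x₀ s (hfint.sub hfcint)
  have hsm : StronglyMeasurable (f - fc) := hf.sub hfcc.stronglyMeasurable
  have b1 : eLpNorm (A fc - fc) 2 (volume.restrict Ω) ≤ ENNReal.ofReal (e / 3) := by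
    have hpt : ∀ᵐ x ∂(volume.restrict Ω), ‖(A fc - fc) x‖ ≤ e₂ := by
      filter_upwards [ae_restrict_mem hΩm] with x hx
      rw [Pi.sub_apply, ← dist_eq_norm]
      simp only [hA, dilatedMollify]
      refine dist_convolution_le he₂0.le ρ.support_normed_eq.subset ρ.nonneg_normed
        ρ.integral_normed hfcc.aestronglyMeasurable fun z hz => (huc ?_).le
      have h1 : dist x x₀ ≤ R' := (Metric.mem_closedBall.1 (hR hx)).trans (le_max_left _ _)
      have h2 : dist (x₀ + s • (x - x₀)) x = (1 - s) * dist x x₀ := by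
        rw [dist_eq_norm, dist_eq_norm, show x₀ + s • (x - x₀) - x = -((1 - s) • (x - x₀)) by
          rw [sub_smul, one_smul]; abel, norm_neg, norm_smul, Real.norm_of_nonneg (by linarith)]
      have h3 : (1 - s) * dist x x₀ ≤ δ * R' := by
        gcongr
        linarith
      calc dist z x ≤ dist z (x₀ + s • (x - x₀)) + dist (x₀ + s • (x - x₀)) x :=
            dist_triangle _ _ _
        _ ≤ δ + δ * R' := by
          rw [h2]
          exact add_le_add ((Metric.mem_ball.1 hz).le.trans hρ) h3
        _ = δ * (R' + 1) := by ring
        _ < δ₀ := by rw [hδR]; linarith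
    refine (eLpNorm_le_of_ae_bound hpt).trans ?_
    rw [Measure.restrict_apply_univ]
    have h4 : volume Ω ^ (ENNReal.toReal 2)⁻¹ = ENNReal.ofReal W := by
      rw [hW, ← ENNReal.ofReal_rpow_of_nonneg ENNReal.toReal_nonneg (by norm_num),
        ENNReal.ofReal_toReal hvol.ne]
      norm_num
    rw [h4, ← ENNReal.ofReal_mul hW0]
    refine ENNReal.ofReal_le_ofReal ?_
    rw [he₂, ← mul_div_assoc, div_le_div_iff₀ (by positivity) (by norm_num)]
    nlinarith
  have b2 : eLpNorm (A (f - fc)) 2 (volume.restrict Ω) ≤ ENNReal.ofReal (e / 3) := by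
    refine (eLpNorm_mono_measure _ Measure.restrict_le_self).trans ?_
    refine (eLpNorm_dilatedMollify_le ρ.continuous_normed.measurable ρ.nonneg_normed
      ρ.lintegral_ofReal_normed x₀ hs2 hsm).trans ?_
    have h1 : (2 : ENNReal) ^ d = ENNReal.ofReal (2 ^ d) := by
      rw [ENNReal.ofReal_pow (by norm_num)]
      norm_num
    calc 2 ^ d * eLpNorm (f - fc) 2 volume ≤ ENNReal.ofReal (2 ^ d) * ENNReal.ofReal e₁ := by
          rw [h1]
          gcongr
      _ = ENNReal.ofReal (e / 3) := by
          rw [← ENNReal.ofReal_mul (by positivity), he₁]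
          congr 1
          field_simp
  have b3 : eLpNorm (fc - f) 2 (volume.restrict Ω) ≤ ENNReal.ofReal (e / 3) := by
    refine (eLpNorm_mono_measure _ Measure.restrict_le_self).trans ?_
    rw [eLpNorm_sub_comm]
    refine hfce.trans (ENNReal.ofReal_le_ofReal ?_)
    rw [he₁]
    refine div_le_div_of_nonneg_left he.le (by norm_num) ?_
    have : (1 : ℝ) ≤ 2 ^ d := one_le_pow₀ (by norm_num)
    linarith
  have hm3 : AEStronglyMeasurable (fc - f) (volume.restrict Ω) :=
    (hfcc.stronglyMeasurable.sub hf).aestronglyMeasurable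
  rw [show dilatedMollify (ρ.normed volume) x₀ s f - f = A f - f from rfl, hsplit]
  calc eLpNorm ((A fc - fc) + (A (f - fc) + (fc - f))) 2 (volume.restrict Ω)
      ≤ eLpNorm (A fc - fc) 2 (volume.restrict Ω) +
        (eLpNorm (A (f - fc)) 2 (volume.restrict Ω) + eLpNorm (fc - f) 2 (volume.restrict Ω)) := by
        refine (eLpNorm_add_le (hm1.sub hfcc).aestronglyMeasurable
          (hm2.aestronglyMeasurable.add hm3) (by norm_num)).trans ?_
        gcongr
        exact eLpNorm_add_le hm2.aestronglyMeasurable hm3 (by norm_num)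
    _ ≤ ENNReal.ofReal (e / 3) + (ENNReal.ofReal (e / 3) + ENNReal.ofReal (e / 3)) := by gcongr
    _ = ENNReal.ofReal e := by
        rw [← ENNReal.ofReal_add (by positivity) (by positivity),
          ← ENNReal.ofReal_add (by positivity) (by positivity)]
        congr 1
        ring

end Mollification

/-! ### Smooth functions are dense in `H¹` of a bounded convex domain -/

section Density

variable {d : ℕ} {Ω : Set (EuclideanSpace ℝ (Fin d))}

/-- The translated kernel `t ↦ ρ(y - t)` is an admissible test function as soon as its support ball
lies in `Ω`. Extending `u` and `g` by zero turns the defining identity into one between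
convolutions. -/
theorem HasH1Gradient.fderiv_convolution {u : EuclideanSpace ℝ (Fin d) → ℝ}
    {g : EuclideanSpace ℝ (Fin d) → EuclideanSpace ℝ (Fin d)} (h : HasH1Gradient Ω u g)
    (hu0 : ∀ x ∉ Ω, u x = 0) (hg0 : ∀ x ∉ Ω, g x = 0)
    (hu : LocallyIntegrable u) (hg : LocallyIntegrable g)
    (ρ : ContDiffBump (0 : EuclideanSpace ℝ (Fin d))) {y : EuclideanSpace ℝ (Fin d)}
    (hy : Metric.closedBall y ρ.rOut ⊆ Ω) (v : EuclideanSpace ℝ (Fin d)) :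
    fderiv ℝ (convolution (ρ.normed volume) u (ContinuousLinearMap.lsmul ℝ ℝ) volume) y v =
      inner ℝ ((convolution (ρ.normed volume) g (ContinuousLinearMap.lsmul ℝ ℝ) volume) y) v := by
  set φ₀ := ρ.normed (volume : Measure (EuclideanSpace ℝ (Fin d))) with hφ₀
  have hφs : ContDiff ℝ 1 φ₀ := ρ.contDiff_normed
  have hφc : HasCompactSupport φ₀ := ρ.hasCompactSupport_normed
  have h1 := (hφc.hasFDerivAt_convolution_left (ContinuousLinearMap.lsmul ℝ ℝ) hφs hu y).fderiv
  rw [h1]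
  have hex := (hφc.fderiv ℝ).convolutionExists_left
    ((ContinuousLinearMap.lsmul ℝ ℝ : ℝ →L[ℝ] ℝ →L[ℝ] ℝ).precompL (EuclideanSpace ℝ (Fin d)))
    (hφs.continuous_fderiv (by simp)) hu y
  have h2 : (convolution (fderiv ℝ φ₀) u ((ContinuousLinearMap.lsmul ℝ ℝ :
      ℝ →L[ℝ] ℝ →L[ℝ] ℝ).precompL (EuclideanSpace ℝ (Fin d))) volume) y v =
      ∫ t, fderiv ℝ φ₀ t v * u (y - t) := by
    rw [convolution_def, ContinuousLinearMap.integral_apply hex]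
    rfl
  rw [h2]
  have h3 : ∫ t, fderiv ℝ φ₀ t v * u (y - t) = ∫ t, fderiv ℝ φ₀ (y - t) v * u t := by
    rw [← integral_sub_left_eq_self (fun t => fderiv ℝ φ₀ t v * u (y - t)) volume y]
    simp
  rw [h3]
  set φ : EuclideanSpace ℝ (Fin d) → ℝ := fun t => φ₀ (y - t) with hφ
  have hφd : ∀ t, fderiv ℝ φ t v = -fderiv ℝ φ₀ (y - t) v := by
    intro t
    have h4 : HasFDerivAt φ₀ (fderiv ℝ φ₀ (y - t)) (y - t) :=
      (hφs.differentiable (by simp) _).hasFDerivAt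
    have h5 : HasFDerivAt (fun t => y - t)
        (-ContinuousLinearMap.id ℝ (EuclideanSpace ℝ (Fin d))) t :=
      (hasFDerivAt_id t).const_sub y
    have h6 := h4.comp t h5
    rw [show φ = φ₀ ∘ fun t => y - t from rfl, h6.fderiv]
    simp
  have hφball : ∀ t, φ t ≠ 0 → t ∈ Metric.closedBall y ρ.rOut := by
    intro t ht
    have h7 : y - t ∈ Function.support φ₀ := ht
    rw [hφ₀, ρ.support_normed_eq, Metric.mem_ball, dist_zero_right] at h7
    rw [Metric.mem_closedBall, dist_comm, dist_eq_norm]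
    exact h7.le
  have hts : tsupport φ ⊆ Metric.closedBall y ρ.rOut :=
    closure_minimal hφball Metric.isClosed_closedBall
  have h8 := h.integral_eq φ ((ρ.contDiff_normed).comp (contDiff_const.sub contDiff_id))
    ((isCompact_closedBall y ρ.rOut).of_isClosed_subset (isClosed_tsupport φ) hts)
    (hts.trans hy) v
  rw [setIntegral_eq_integral_of_forall_compl_eq_zero fun x hx => by rw [hu0 x hx, zero_mul],
    setIntegral_eq_integral_of_forall_compl_eq_zero fun x hx => by
      rw [hg0 x hx, inner_zero_left, zero_mul]] at h8
  have h9 : ∫ t, fderiv ℝ φ₀ (y - t) v * u t = -∫ t, u t * fderiv ℝ φ t v := by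
    rw [← integral_neg]
    refine integral_congr_ae (Eventually.of_forall fun t => ?_)
    simp only [hφd]
    ring
  rw [h9, h8, neg_neg, convolution_eq_swap, real_inner_comm]
  have hex2 := hφc.convolutionExists_left
    (ContinuousLinearMap.lsmul ℝ ℝ : ℝ →L[ℝ] EuclideanSpace ℝ (Fin d) →L[ℝ] _)
    ρ.continuous_normed hg y
  rw [convolutionExistsAt_iff_integrable_swap] at hex2
  rw [← integral_inner hex2]
  refine integral_congr_ae (Eventually.of_forall fun t => ?_)
  simp only [ContinuousLinearMap.lsmul_apply, real_inner_smul_right, hφ]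
  rw [real_inner_comm, mul_comm]

theorem HasH1Gradient.congr_ae {u u' : EuclideanSpace ℝ (Fin d) → ℝ}
    {g g' : EuclideanSpace ℝ (Fin d) → EuclideanSpace ℝ (Fin d)} (h : HasH1Gradient Ω u g)
    (hu : u =ᵐ[volume.restrict Ω] u') (hg : g =ᵐ[volume.restrict Ω] g') :
    HasH1Gradient Ω u' g' := by
  refine ⟨h.memLp.ae_eq hu, h.memLp_gradient.ae_eq hg, fun φ h1 h2 h3 v => ?_⟩
  have h4 := h.integral_eq φ h1 h2 h3 v
  rw [integral_congr_ae (hu.mono fun x hx => show u x * _ = u' x * _ by rw [hx]),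
    integral_congr_ae (hg.mono fun x hx => show inner ℝ (g x) v * φ x = inner ℝ (g' x) v * φ x by
      rw [hx])] at h4
  exact h4

/-- Smooth functions on the whole space are dense in `H¹` of a bounded convex domain. -/
theorem HasH1Gradient.exists_contDiff_eLpNorm_sub_le (hΩo : IsOpen Ω) (hΩc : Convex ℝ Ω)
    (hΩb : Bornology.IsBounded Ω) (hΩn : Ω.Nonempty) {u : EuclideanSpace ℝ (Fin d) → ℝ}
    {g : EuclideanSpace ℝ (Fin d) → EuclideanSpace ℝ (Fin d)} (h : HasH1Gradient Ω u g)
    {e : ℝ} (he : 0 < e) :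
    ∃ U : EuclideanSpace ℝ (Fin d) → ℝ, ContDiff ℝ ∞ U ∧
      eLpNorm (U - u) 2 (volume.restrict Ω) ≤ ENNReal.ofReal e ∧
      eLpNorm (gradient U - g) 2 (volume.restrict Ω) ≤ ENNReal.ofReal e := by
  -- reduction to strongly measurable functions that vanish outside `Ω`
  wlog hred : StronglyMeasurable u ∧ StronglyMeasurable g ∧ (∀ x ∉ Ω, u x = 0) ∧
      (∀ x ∉ Ω, g x = 0) generalizing u g
  · have hu := h.memLp.aestronglyMeasurable
    have hg := h.memLp_gradient.aestronglyMeasurable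
    have e1 : u =ᵐ[volume.restrict Ω] Ω.indicator (hu.mk u) := by
      filter_upwards [hu.ae_eq_mk, ae_restrict_mem hΩo.measurableSet] with x hx hxΩ
      rw [Set.indicator_of_mem hxΩ, hx]
    have e2 : g =ᵐ[volume.restrict Ω] Ω.indicator (hg.mk g) := by
      filter_upwards [hg.ae_eq_mk, ae_restrict_mem hΩo.measurableSet] with x hx hxΩ
      rw [Set.indicator_of_mem hxΩ, hx]
    obtain ⟨U, hU, hU1, hU2⟩ := this (h.congr_ae e1 e2)
      ⟨hu.stronglyMeasurable_mk.indicator hΩo.measurableSet,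
        hg.stronglyMeasurable_mk.indicator hΩo.measurableSet,
        fun x hx => Set.indicator_of_notMem hx _, fun x hx => Set.indicator_of_notMem hx _⟩
    refine ⟨U, hU, ?_, ?_⟩
    · rwa [eLpNorm_congr_ae (EventuallyEq.rfl.sub e1)]
    · rwa [eLpNorm_congr_ae (EventuallyEq.rfl.sub e2)]
  obtain ⟨hum, hgm, hu0, hg0⟩ := hred
  have hu2 : MemLp u 2 volume := by
    have := (memLp_indicator_iff_restrict hΩo.measurableSet).2 h.memLp
    rwa [Set.indicator_eq_self.2 fun x hx => by_contra fun hxΩ => hx (hu0 x hxΩ)] at this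
  have hg2 : MemLp g 2 volume := by
    have := (memLp_indicator_iff_restrict hΩo.measurableSet).2 h.memLp_gradient
    rwa [Set.indicator_eq_self.2 fun x hx => by_contra fun hxΩ => hx (hg0 x hxΩ)] at this
  have hui : LocallyIntegrable u := hu2.locallyIntegrable (by norm_num)
  have hgi : LocallyIntegrable g := hg2.locallyIntegrable (by norm_num)
  obtain ⟨x₀, hx₀⟩ := hΩn
  obtain ⟨r₀, hr₀, hball⟩ := Metric.nhds_basis_closedBall.mem_iff.1 (hΩo.mem_nhds hx₀)
  obtain ⟨δ₁, hδ₁, happ1⟩ := exists_eLpNorm_dilatedMollify_sub_le hΩb hΩo.measurableSet x₀ hum hu2 he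
  obtain ⟨δ₂, hδ₂, happ2⟩ := exists_eLpNorm_dilatedMollify_sub_le hΩb hΩo.measurableSet x₀ hgm hg2
    (half_pos he)
  set N := (eLpNorm g 2 (volume.restrict Ω)).toReal with hN
  have hN0 : 0 ≤ N := ENNReal.toReal_nonneg
  -- The last bound pays for the factor `s = 1 - t` that the chain rule puts in front of the
  -- gradient: it leaves an extra term `-t g`.
  set t := min (min δ₁ δ₂) (min (1 / 2) (e / (2 * (N + 1)))) with ht
  have ht0 : 0 < t := by
    have : 0 < e / (2 * (N + 1)) := by positivity
    simp only [ht, lt_min_iff]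
    exact ⟨⟨hδ₁, hδ₂⟩, by norm_num, this⟩
  have ht1 : t ≤ δ₁ := (min_le_left _ _).trans (min_le_left _ _)
  have ht2 : t ≤ δ₂ := (min_le_left _ _).trans (min_le_right _ _)
  have ht3 : t ≤ 1 / 2 := (min_le_right _ _).trans (min_le_left _ _)
  have ht4 : t ≤ e / (2 * (N + 1)) := (min_le_right _ _).trans (min_le_right _ _)
  -- By convexity, contracting `x ∈ Ω` toward `x₀` by the ratio `1 - t` leaves a ball of radius `t
  -- r₀` inside `Ω`, which is room for the mollifier.
  set R := min (min δ₁ δ₂) (t * r₀) with hR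
  have hR0 : 0 < R := by
    simp only [hR, lt_min_iff]
    exact ⟨⟨hδ₁, hδ₂⟩, by positivity⟩
  let ρ : ContDiffBump (0 : EuclideanSpace ℝ (Fin d)) := ⟨R / 2, R, by positivity, by linarith⟩
  have hρR : ρ.rOut = R := rfl
  set s := 1 - t with hs
  set c := convolution (ρ.normed volume) u (ContinuousLinearMap.lsmul ℝ ℝ) volume with hc
  have hcs : ContDiff ℝ ∞ c :=
    ρ.hasCompactSupport_normed.contDiff_convolution_left _ ρ.contDiff_normed hui
  have hDs : ContDiff ℝ ∞ fun x : EuclideanSpace ℝ (Fin d) => x₀ + s • (x - x₀) := by fun_prop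
  have hgrad : ∀ x ∈ Ω, gradient (dilatedMollify (ρ.normed volume) x₀ s u) x =
      s • dilatedMollify (ρ.normed volume) x₀ s g x := by
    intro x hx
    have hsub : Metric.closedBall (x₀ + s • (x - x₀)) ρ.rOut ⊆ Ω := by
      intro z hz
      have h1 : x₀ + t⁻¹ • (z - (x₀ + s • (x - x₀))) ∈ Ω := by
        refine hball ?_
        rw [Metric.mem_closedBall, dist_self_add_left, norm_smul, norm_inv,
          Real.norm_of_nonneg ht0.le, inv_mul_le_iff₀ ht0, ← dist_eq_norm]
        exact (Metric.mem_closedBall.1 hz).trans (min_le_right _ _)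
      have h2 := hΩc hx h1 (by linarith : 0 ≤ s) ht0.le (by rw [hs]; ring)
      have h3 : s • x + t • (x₀ + t⁻¹ • (z - (x₀ + s • (x - x₀)))) = z := by
        rw [smul_add, smul_smul, mul_inv_cancel₀ ht0.ne', one_smul, hs, sub_smul, sub_smul,
          one_smul, one_smul, smul_sub]
        abel
      rwa [h3] at h2
    refine ext_inner_right ℝ fun v => ?_
    rw [inner_gradient_left, real_inner_smul_left]
    have h1 : HasFDerivAt c (fderiv ℝ c (x₀ + s • (x - x₀))) (x₀ + s • (x - x₀)) :=
      (hcs.differentiable (by simp) _).hasFDerivAt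
    have h2 : HasFDerivAt (fun x : EuclideanSpace ℝ (Fin d) => x₀ + s • (x - x₀))
        (s • ContinuousLinearMap.id ℝ (EuclideanSpace ℝ (Fin d))) x :=
      (((hasFDerivAt_id x).sub_const x₀).const_smul s).const_add x₀
    have h3 := (h1.comp x h2).fderiv
    rw [show dilatedMollify (ρ.normed volume) x₀ s u = c ∘ fun x => x₀ + s • (x - x₀) from rfl, h3]
    simp only [ContinuousLinearMap.comp_apply, smul_apply, ContinuousLinearMap.id_apply, map_smul,
      smul_eq_mul]
    congr 1
    exact h.fderiv_convolution hu0 hg0 hui hgi ρ hsub v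
  refine ⟨dilatedMollify (ρ.normed volume) x₀ s u, hcs.comp hDs, ?_, ?_⟩
  · exact happ1 s (by linarith) (by linarith) (by linarith) ρ
      ((min_le_left _ _).trans (min_le_left _ _))
  · have h1 : gradient (dilatedMollify (ρ.normed volume) x₀ s u) - g =ᵐ[volume.restrict Ω]
        s • (dilatedMollify (ρ.normed volume) x₀ s g - g) + (-t) • g := by
      filter_upwards [ae_restrict_mem hΩo.measurableSet] with x hx
      simp only [Pi.sub_apply, Pi.add_apply, Pi.smul_apply, hgrad x hx, smul_sub]
      rw [hs, sub_smul 1 t (g x), one_smul, neg_smul]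
      abel
    have hcont := continuous_dilatedMollify ρ x₀ s hgi
    rw [eLpNorm_congr_ae h1]
    have hfin : eLpNorm g 2 (volume.restrict Ω) = ENNReal.ofReal N := by
      rw [hN, ENNReal.ofReal_toReal h.memLp_gradient.eLpNorm_ne_top]
    refine (eLpNorm_add_le ((hcont.aestronglyMeasurable.sub hgm.aestronglyMeasurable).const_smul s)
      (hgm.aestronglyMeasurable.const_smul (-t)) (by norm_num)).trans ?_
    rw [eLpNorm_const_smul, eLpNorm_const_smul, hfin, enorm_neg, Real.enorm_eq_ofReal (by linarith),
      Real.enorm_eq_ofReal ht0.le, ← ENNReal.ofReal_mul ht0.le]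
    calc ENNReal.ofReal s * eLpNorm (dilatedMollify (ρ.normed volume) x₀ s g - g) 2
          (volume.restrict Ω) + ENNReal.ofReal (t * N)
        ≤ 1 * ENNReal.ofReal (e / 2) + ENNReal.ofReal (e / 2) := by
          gcongr
          · rw [← ENNReal.ofReal_one]
            exact ENNReal.ofReal_le_ofReal (by linarith)
          · exact happ2 s (by linarith) (by linarith) (by linarith) ρ
              ((min_le_left _ _).trans (min_le_right _ _))
          · rw [le_div_iff₀ (by positivity)] at ht4
            nlinarith
      _ = ENNReal.ofReal e := by
          rw [one_mul, ← ENNReal.ofReal_add (by positivity) (by positivity), add_halves]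

end Density

/-! ### Volumes near hyperplanes and near their intersections -/

section SlabMeasure

variable {d : ℕ}

theorem OrthonormalBasis.volume_setOf_inner_mem_Icc
    (b : OrthonormalBasis (Fin d) ℝ (EuclideanSpace ℝ (Fin d))) (l u : Fin d → ℝ) :
    volume {x : EuclideanSpace ℝ (Fin d) | ∀ i, inner ℝ (b i) x ∈ Set.Icc (l i) (u i)} =
      ∏ i, ENNReal.ofReal (u i - l i) := by
  have h1 : MeasurePreserving (fun x => (b.repr x).ofLp) volume volume :=
    (PiLp.volume_preserving_ofLp (Fin d)).comp b.measurePreserving_repr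
  rw [← Real.volume_Icc_pi, ← h1.measure_preimage measurableSet_Icc.nullMeasurableSet]
  congr 1
  ext x
  simp only [Set.mem_ofPred_eq, Set.mem_preimage, Set.mem_Icc, Pi.le_def, b.repr_apply_apply,
    forall_and]

theorem Finset.prod_ofReal_le {ι : Type*} [DecidableEq ι] (s t : Finset ι) (hts : t ⊆ s)
    (f : ι → ℝ) {K : ℝ} (hK : 0 ≤ K) (h : ∀ i ∈ s \ t, f i ≤ K) :
    ∏ i ∈ s, ENNReal.ofReal (f i) ≤
      ENNReal.ofReal (K ^ (s \ t).card) * ∏ i ∈ t, ENNReal.ofReal (f i) := by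
  rw [← Finset.prod_sdiff hts]
  gcongr
  rw [ENNReal.ofReal_pow hK]
  exact Finset.prod_le_pow_card _ _ _ fun i hi => ENNReal.ofReal_le_ofReal (h i hi)

theorem exists_volume_slab_le {n : EuclideanSpace ℝ (Fin d)} (hd : 0 < d) (hn : ‖n‖ = 1) (a R : ℝ) :
    ∃ c : ℝ, 0 ≤ c ∧ ∀ r : ℝ, 0 ≤ r →
      volume {x ∈ Metric.closedBall (0 : EuclideanSpace ℝ (Fin d)) R | |inner ℝ n x - a| ≤ r} ≤
        ENNReal.ofReal (c * r) := by
  classical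
  let i₀ : Fin d := ⟨0, hd⟩
  obtain ⟨b, hb⟩ := Orthonormal.exists_orthonormalBasis_extension_of_card_eq (𝕜 := ℝ)
    (E := EuclideanSpace ℝ (Fin d)) (ι := Fin d) (by simp) (v := fun _ => n) (s := {i₀}) (by
      refine ⟨fun _ => hn, fun i j hij => (hij (Subsingleton.elim i j)).elim⟩)
  have hb0 : b i₀ = n := hb i₀ rfl
  refine ⟨(2 * |R|) ^ (Finset.univ \ {i₀}).card * 2, by positivity, fun r hr => ?_⟩
  let l : Fin d → ℝ := fun i => if i = i₀ then a - r else -|R|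
  let u : Fin d → ℝ := fun i => if i = i₀ then a + r else |R|
  have hsub : {x ∈ Metric.closedBall (0 : EuclideanSpace ℝ (Fin d)) R | |inner ℝ n x - a| ≤ r} ⊆
      {x | ∀ i, inner ℝ (b i) x ∈ Set.Icc (l i) (u i)} := by
    rintro x ⟨hx, hxr⟩ i
    rw [mem_closedBall_zero_iff] at hx
    by_cases hi : i = i₀
    · subst hi
      rw [abs_le] at hxr
      simp only [l, u, if_true, hb0]
      constructor <;> linarith
    · simp only [l, u, if_neg hi]
      have h1 := abs_real_inner_le_norm (b i) x
      rw [b.norm_eq_one, one_mul] at h1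
      exact abs_le.1 (h1.trans (hx.trans (le_abs_self R)))
  refine (measure_mono hsub).trans ?_
  rw [b.volume_setOf_inner_mem_Icc]
  refine (Finset.prod_ofReal_le Finset.univ {i₀} (Finset.subset_univ _) (fun i => u i - l i)
    (K := 2 * |R|) (by positivity) ?_).trans ?_
  · intro i hi
    have : i ≠ i₀ := by simpa using hi
    simp only [l, u, if_neg this]
    linarith
  · rw [Finset.prod_singleton, ← ENNReal.ofReal_mul (by positivity)]
    refine ENNReal.ofReal_le_ofReal (le_of_eq ?_)
    simp only [l, u, if_true]
    ring

theorem exists_volume_orthonormal_wedge_le {n₁ n₂ : EuclideanSpace ℝ (Fin d)} (hd : 1 < d)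
    (hn₁ : ‖n₁‖ = 1) (hn₂ : ‖n₂‖ = 1) (ho : inner ℝ n₁ n₂ = 0) (a₁ a₂ R : ℝ) :
    ∃ c : ℝ, 0 ≤ c ∧ ∀ r s : ℝ, 0 ≤ r → 0 ≤ s →
      volume {x ∈ Metric.closedBall (0 : EuclideanSpace ℝ (Fin d)) R |
        |inner ℝ n₁ x - a₁| ≤ r ∧ |inner ℝ n₂ x - a₂| ≤ s} ≤ ENNReal.ofReal (c * (r * s)) := by
  classical
  let i₀ : Fin d := ⟨0, by omega⟩
  let i₁ : Fin d := ⟨1, hd⟩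
  have h01 : i₀ ≠ i₁ := by simp [i₀, i₁]
  obtain ⟨b, hb⟩ := Orthonormal.exists_orthonormalBasis_extension_of_card_eq (𝕜 := ℝ)
    (E := EuclideanSpace ℝ (Fin d)) (ι := Fin d) (by simp)
    (v := fun i => if i = i₀ then n₁ else n₂) (s := {i₀, i₁}) (by
      refine ⟨?_, ?_⟩
      · rintro ⟨i, rfl | rfl⟩
        · simpa using hn₁
        · simpa [h01.symm] using hn₂
      · rintro ⟨i, rfl | rfl⟩ ⟨j, rfl | rfl⟩ hij
        · exact (hij rfl).elim
        · simpa [h01.symm] using ho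
        · simpa [h01.symm, real_inner_comm] using ho
        · exact (hij rfl).elim)
  have hb0 : b i₀ = n₁ := by simpa using hb i₀ (by simp)
  have hb1 : b i₁ = n₂ := by simpa [h01.symm] using hb i₁ (by simp)
  refine ⟨(2 * |R|) ^ (Finset.univ \ {i₀, i₁}).card * 4, by positivity, fun r s hr hs => ?_⟩
  let l : Fin d → ℝ := fun i => if i = i₀ then a₁ - r else if i = i₁ then a₂ - s else -|R|
  let u : Fin d → ℝ := fun i => if i = i₀ then a₁ + r else if i = i₁ then a₂ + s else |R|
  have hsub : {x ∈ Metric.closedBall (0 : EuclideanSpace ℝ (Fin d)) R |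
        |inner ℝ n₁ x - a₁| ≤ r ∧ |inner ℝ n₂ x - a₂| ≤ s} ⊆
      {x | ∀ i, inner ℝ (b i) x ∈ Set.Icc (l i) (u i)} := by
    rintro x ⟨hx, hxr, hxs⟩ i
    rw [mem_closedBall_zero_iff] at hx
    rw [abs_le] at hxr hxs
    by_cases hi : i = i₀
    · subst hi
      simp only [l, u, if_true, hb0]
      constructor <;> linarith
    by_cases hi1 : i = i₁
    · subst hi1
      simp only [l, u, if_neg hi, if_true, hb1]
      constructor <;> linarith
    · simp only [l, u, if_neg hi, if_neg hi1]
      have h1 := abs_real_inner_le_norm (b i) x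
      rw [b.norm_eq_one, one_mul] at h1
      exact abs_le.1 (h1.trans (hx.trans (le_abs_self R)))
  refine (measure_mono hsub).trans ?_
  rw [b.volume_setOf_inner_mem_Icc]
  refine (Finset.prod_ofReal_le Finset.univ {i₀, i₁} (Finset.subset_univ _) (fun i => u i - l i)
    (K := 2 * |R|) (by positivity) ?_).trans ?_
  · intro i hi
    have : i ≠ i₀ ∧ i ≠ i₁ := by simpa using hi
    simp only [l, u, if_neg this.1, if_neg this.2]
    linarith
  · have e1 : u i₀ - l i₀ = 2 * r := by simp only [l, u, if_true]; ring
    have e2 : u i₁ - l i₁ = 2 * s := by simp only [l, u, if_neg h01.symm, if_true]; ring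
    rw [Finset.prod_pair h01, e1, e2, ← ENNReal.ofReal_mul (by positivity),
      ← ENNReal.ofReal_mul (by positivity)]
    exact ENNReal.ofReal_le_ofReal (le_of_eq (by ring))

/-- The part of a bounded set that is close to two distinct hyperplanes not meeting inside it in a
hyperplane has measure quadratic in the distance. -/
theorem exists_volume_wedge_le (hd : 1 < d) {Ω : Set (EuclideanSpace ℝ (Fin d))}
    (hΩb : Bornology.IsBounded Ω) (hΩn : Ω.Nonempty) {n₁ n₂ : EuclideanSpace ℝ (Fin d)}
    (hn₁ : ‖n₁‖ = 1) (hn₂ : ‖n₂‖ = 1) {a₁ a₂ : ℝ} (hne : (n₁, a₁) ≠ (n₂, a₂))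
    (h₁ : ∀ x ∈ Ω, a₁ < inner ℝ n₁ x) (h₂ : ∀ x ∈ Ω, a₂ < inner ℝ n₂ x) :
    ∃ c : ℝ, 0 ≤ c ∧ ∀ r : ℝ, 0 ≤ r →
      volume {x ∈ Ω | (inner ℝ n₁ x - a₁) ^ 2 + (inner ℝ n₂ x - a₂) ^ 2 ≤ r} ≤
        ENNReal.ofReal (c * r) := by
  obtain ⟨R, hR⟩ := hΩb.subset_closedBall 0
  -- Parallel normals: the hyperplanes are distinct, so the sum of squares is at least some `D > 0`
  -- on `Ω`, and the total volume suffices for `r ≥ D`. For opposite normals, coincidence of the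
  -- hyperplanes is excluded by a point of `Ω`.
  by_cases hm : n₂ - inner ℝ n₁ n₂ • n₁ = 0
  · have hpar : n₂ = inner ℝ n₁ n₂ • n₁ := sub_eq_zero.1 hm
    set σ : ℝ := inner ℝ n₁ n₂ with hσ
    have hσ1 : |σ| = 1 := by
      have := hn₂
      rw [hpar, norm_smul, hn₁, mul_one, Real.norm_eq_abs] at this
      exact this
    obtain ⟨D, hD, hDQ⟩ : ∃ D : ℝ, 0 < D ∧ ∀ x ∈ Ω,
        D ≤ (inner ℝ n₁ x - a₁) ^ 2 + (inner ℝ n₂ x - a₂) ^ 2 := by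
      have hin : ∀ x, inner ℝ n₂ x = σ * inner ℝ n₁ x := fun x => by
        rw [hpar, real_inner_smul_left]
      have hDne : σ * a₁ - a₂ ≠ 0 := by
        intro h0
        rcases (abs_eq one_pos.le).1 hσ1 with h | h
        · apply hne
          rw [h] at hpar h0
          rw [one_smul] at hpar
          rw [hpar]
          congr 1
          linarith
        · obtain ⟨x, hx⟩ := hΩn
          have e1 := h₁ x hx
          have e2 := h₂ x hx
          rw [hin, h] at e2
          rw [h] at h0
          linarith
      refine ⟨(σ * a₁ - a₂) ^ 2 / 2, by positivity, fun x _ => ?_⟩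
      have hσ2 : σ ^ 2 = 1 := by rw [← sq_abs, hσ1]; norm_num
      rw [hin]
      set t := inner ℝ n₁ x
      have e : σ * a₁ - a₂ = (σ * t - a₂) - σ * (t - a₁) := by ring
      have e2 : (t - a₁) ^ 2 = (σ * (t - a₁)) ^ 2 := by rw [mul_pow, hσ2, one_mul]
      rw [e, e2]
      nlinarith [sq_nonneg ((σ * t - a₂) + σ * (t - a₁))]
    have hv : volume Ω ≠ ⊤ := hΩb.measure_lt_top.ne
    refine ⟨(volume Ω).toReal / D, by positivity, fun r hr => ?_⟩
    by_cases hrD : r < D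
    · have : {x ∈ Ω | (inner ℝ n₁ x - a₁) ^ 2 + (inner ℝ n₂ x - a₂) ^ 2 ≤ r} = ∅ := by
        ext x
        simp only [Set.mem_ofPred_eq, Set.mem_empty_iff_false, iff_false, not_and, not_le]
        exact fun hx => hrD.trans_le (hDQ x hx)
      rw [this]
      simp
    · refine (measure_mono (fun x hx => hx.1)).trans ?_
      rw [← ENNReal.ofReal_toReal hv]
      refine ENNReal.ofReal_le_ofReal ?_
      rw [ENNReal.toReal_ofReal ENNReal.toReal_nonneg, div_mul_eq_mul_div, le_div_iff₀ hD]
      exact mul_le_mul_of_nonneg_left (not_lt.1 hrD) ENNReal.toReal_nonneg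
  -- Gram–Schmidt: the set lies in a slab of width of order `√r` in each of two orthonormal
  -- directions, and the product of the widths is linear in `r`.
  · set m := n₂ - inner ℝ n₁ n₂ • n₁ with hmdef
    set σ : ℝ := inner ℝ n₁ n₂ with hσ
    have hmp : 0 < ‖m‖ := norm_pos_iff.2 hm
    have hσ1 : |σ| ≤ 1 := by
      have := abs_real_inner_le_norm n₁ n₂
      rwa [hn₁, hn₂, one_mul] at this
    obtain ⟨c, hc, hcv⟩ := exists_volume_orthonormal_wedge_le (n₁ := n₁) (n₂ := ‖m‖⁻¹ • m) hd hn₁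
      (by rw [norm_smul, norm_inv, norm_norm, inv_mul_cancel₀ hmp.ne']) (by
        rw [real_inner_smul_right, hmdef, inner_sub_right, real_inner_smul_right,
          real_inner_self_eq_norm_sq, hn₁]
        simp [hσ]) a₁ (‖m‖⁻¹ * (a₂ - σ * a₁)) R
    refine ⟨c * (‖m‖⁻¹ * 2), by positivity, fun r hr => ?_⟩
    refine (measure_mono ?_).trans ((hcv (√r) (‖m‖⁻¹ * (2 * √r)) (by positivity)
      (by positivity)).trans (ENNReal.ofReal_le_ofReal (le_of_eq ?_)))
    · rintro x ⟨hx, hxr⟩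
      have t1 : |inner ℝ n₁ x - a₁| ≤ √r := by
        refine Real.abs_le_sqrt ?_
        nlinarith [sq_nonneg (inner ℝ n₂ x - a₂)]
      have t2 : |inner ℝ n₂ x - a₂| ≤ √r := by
        refine Real.abs_le_sqrt ?_
        nlinarith [sq_nonneg (inner ℝ n₁ x - a₁)]
      refine ⟨hR hx, t1, ?_⟩
      rw [real_inner_smul_left, ← mul_sub, abs_mul, abs_of_pos (inv_pos.2 hmp)]
      gcongr
      have e : inner ℝ m x - (a₂ - σ * a₁) =
          (inner ℝ n₂ x - a₂) - σ * (inner ℝ n₁ x - a₁) := by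
        rw [hmdef, inner_sub_left, real_inner_smul_left]
        ring
      rw [e]
      refine (abs_sub _ _).trans ?_
      rw [abs_mul]
      have := mul_le_mul hσ1 t1 (abs_nonneg _) one_pos.le
      linarith
    · have : √r * √r = r := Real.mul_self_sqrt hr
      linear_combination (c * ‖m‖⁻¹ * 2) * this

/-- On the layer where the height is about `4^(-m)`, the integrand is at most `2^(m+1)` and the
volume is `O(4^(-m))`, so the layers sum like a geometric series of ratio `1/2`. This integrates the
squared gradient error near a facet. -/
theorem lintegral_inv_sqrt_lt_top (hd : 0 < d) {Ω : Set (EuclideanSpace ℝ (Fin d))}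
    (hΩb : Bornology.IsBounded Ω) (hΩm : MeasurableSet Ω) {n : EuclideanSpace ℝ (Fin d)}
    (hn : ‖n‖ = 1) {a : ℝ} (ha : ∀ x ∈ Ω, a < inner ℝ n x) :
    ∫⁻ x in Ω, ENNReal.ofReal (1 / √(inner ℝ n x - a)) < ⊤ := by
  obtain ⟨R, hR⟩ := hΩb.subset_closedBall 0
  obtain ⟨c, hc, hcv⟩ := exists_volume_slab_le hd hn a R
  let S : ℕ → Set (EuclideanSpace ℝ (Fin d)) := fun m => {x | |inner ℝ n x - a| ≤ (1 / 4) ^ m}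
  have hSm : ∀ m, MeasurableSet (S m) := fun m => by
    refine (isClosed_le (by fun_prop) continuous_const).measurableSet
  have hpt : ∀ x ∈ Ω, ENNReal.ofReal (1 / √(inner ℝ n x - a)) ≤
      1 + ∑' m, (S m).indicator (fun _ => ENNReal.ofReal (2 ^ (m + 1))) x := by
    intro x hx
    have ht := sub_pos.2 (ha x hx)
    set t := inner ℝ n x - a with htdef
    rcases le_or_gt 1 t with h1 | h1
    · refine le_add_right ?_
      rw [← ENNReal.ofReal_one]
      refine ENNReal.ofReal_le_ofReal ?_
      rw [div_le_one (by positivity)]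
      exact Real.one_le_sqrt.2 h1
    · obtain ⟨m, hm1, hm2⟩ := exists_nat_pow_near_of_lt_one ht h1.le
        (show (0 : ℝ) < 1 / 4 by norm_num) (by norm_num)
      refine le_add_left (le_trans ?_ (ENNReal.le_tsum m))
      rw [Set.indicator_of_mem (show x ∈ S m by
        change |inner ℝ n x - a| ≤ _
        rw [abs_of_pos ht]; exact hm2)]
      refine ENNReal.ofReal_le_ofReal ?_
      rw [div_le_iff₀ (by positivity)]
      have : (1 / 2 : ℝ) ^ (m + 1) ≤ √t := by
        refine Real.le_sqrt_of_sq_le ?_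
        rw [← pow_mul, mul_comm, pow_mul]
        norm_num at hm1 ⊢
        exact hm1.le
      calc (1 : ℝ) = 2 ^ (m + 1) * (1 / 2) ^ (m + 1) := by rw [← mul_pow]; norm_num
        _ ≤ _ := by gcongr
  refine (setLIntegral_mono' hΩm hpt).trans_lt ?_
  have hmeas : ∀ m, Measurable ((S m).indicator fun _ => ENNReal.ofReal (2 ^ (m + 1))) := fun m =>
    measurable_const.indicator (hSm m)
  rw [lintegral_add_left measurable_const, lintegral_tsum fun m => (hmeas m).aemeasurable]
  refine ENNReal.add_lt_top.2 ⟨by simpa using hΩb.measure_lt_top, ?_⟩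
  have hterm : ∀ m, ∫⁻ x in Ω, (S m).indicator (fun _ => ENNReal.ofReal (2 ^ (m + 1))) x ≤
      ENNReal.ofReal (2 * c * (1 / 2) ^ m) := by
    intro m
    rw [lintegral_indicator_const (hSm m), Measure.restrict_apply (hSm m)]
    have : volume (S m ∩ Ω) ≤ ENNReal.ofReal (c * (1 / 4) ^ m) :=
      (measure_mono (show S m ∩ Ω ⊆ {x ∈ Metric.closedBall 0 R | |inner ℝ n x - a| ≤ (1 / 4) ^ m}
        from fun x hx => ⟨hR hx.2, hx.1⟩)).trans (hcv ((1 / 4) ^ m) (by positivity))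
    refine (mul_le_mul_right this _).trans ?_
    rw [← ENNReal.ofReal_mul (by positivity)]
    refine ENNReal.ofReal_le_ofReal (le_of_eq ?_)
    have : (1 / 2 : ℝ) ^ m = 2 ^ m * (1 / 4) ^ m := by rw [← mul_pow]; norm_num
    rw [this]
    ring
  refine (ENNReal.tsum_le_tsum hterm).trans_lt ?_
  have hs : Summable fun m : ℕ => 2 * c * (1 / 2 : ℝ) ^ m :=
    (summable_geometric_of_lt_one (by norm_num) (by norm_num)).mul_left _
  exact hs.tsum_ofReal_lt_top

end SlabMeasure

/-! ### Cutoffs around sets of zero capacity -/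

section Cutoff

variable {d : ℕ}

theorem eLpNorm_two_le_ofReal {α F : Type*} [NormedAddCommGroup F] [MeasurableSpace α]
    {μ : Measure α} {f : α → F} {e : ℝ} (he : 0 ≤ e)
    (h : ∫⁻ x, ‖f x‖ₑ ^ 2 ∂μ ≤ ENNReal.ofReal (e ^ 2)) : eLpNorm f 2 μ ≤ ENNReal.ofReal e := by
  rw [← eLpNorm_two_sq, ENNReal.ofReal_pow he] at h
  exact (ENNReal.pow_le_pow_left_iff two_ne_zero).1 h

theorem eLpNorm_two_le_add_of_norm_le {α F G H : Type*} [NormedAddCommGroup F]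
    [NormedAddCommGroup G] [NormedAddCommGroup H] [MeasurableSpace α] {μ : Measure α}
    {f : α → F} {a : α → G} {b : α → H} (ha : AEStronglyMeasurable a μ)
    (hb : AEStronglyMeasurable b μ) (h : ∀ᵐ x ∂μ, ‖f x‖ ≤ ‖a x‖ + ‖b x‖) :
    eLpNorm f 2 μ ≤ eLpNorm a 2 μ + eLpNorm b 2 μ := by
  refine (eLpNorm_mono_ae_real h).trans ((eLpNorm_add_le ha.norm hb.norm (by norm_num)).trans ?_)
  rw [eLpNorm_norm, eLpNorm_norm]

theorem exists_abs_deriv_smoothTransition_le :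
    ∃ D : ℝ, 0 ≤ D ∧ ∀ r : ℝ, |deriv (fun r => Real.smoothTransition (r - 1)) r| ≤
      (Set.Icc (1 : ℝ) 2).indicator (fun _ => D) r := by
  set ψ : ℝ → ℝ := fun r => Real.smoothTransition (r - 1) with hψ
  have hs : ContDiff ℝ 1 ψ :=
    (Real.smoothTransition.contDiff (n := 1)).comp (contDiff_id.sub contDiff_const)
  have hc : Continuous (deriv ψ) := hs.continuous_deriv le_rfl
  obtain ⟨D, hD⟩ := isCompact_Icc.exists_bound_of_continuousOn (s := Set.Icc (1 : ℝ) 2)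
    hc.continuousOn
  refine ⟨|D|, abs_nonneg D, fun r => ?_⟩
  by_cases hr : r ∈ Set.Icc (1 : ℝ) 2
  · rw [Set.indicator_of_mem hr]
    exact (hD r hr).trans (le_abs_self D)
  · rw [Set.indicator_of_notMem hr]
    have : deriv ψ r = 0 := by
      rcases lt_or_ge r 1 with h1 | h1
      · have : ψ =ᶠ[𝓝 r] fun _ => 0 := by
          filter_upwards [Iio_mem_nhds h1] with s hs
          exact Real.smoothTransition.zero_of_nonpos (by linarith [Set.mem_Iio.1 hs])
        rw [this.deriv_eq, deriv_const]
      · have h2 : 2 < r := by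
          by_contra h
          exact hr ⟨h1, not_lt.1 h⟩
        have : ψ =ᶠ[𝓝 r] fun _ => 1 := by
          filter_upwards [Ioi_mem_nhds h2] with s hs
          exact Real.smoothTransition.one_of_one_le (by linarith [Set.mem_Ioi.1 hs])
        rw [this.deriv_eq, deriv_const]
    rw [this, abs_zero]

theorem Finset.sq_sum_le_sum_sq_of_pairwise {ι : Type*} (s : Finset ι) (f : ι → ℝ)
    (h : ∀ i ∈ s, ∀ j ∈ s, i ≠ j → f i = 0 ∨ f j = 0) : (∑ i ∈ s, f i) ^ 2 = ∑ i ∈ s, f i ^ 2 := by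
  classical
  by_cases hz : ∃ i ∈ s, f i ≠ 0
  · obtain ⟨i, hi, hfi⟩ := hz
    have h0 : ∀ j ∈ s, j ≠ i → f j = 0 := fun j hj hji =>
      (h i hi j hj hji.symm).resolve_left hfi
    rw [Finset.sum_eq_single_of_mem i hi h0,
      Finset.sum_eq_single_of_mem i hi fun j hj hji => by rw [h0 j hj hji]; norm_num]
  · push Not at hz
    rw [Finset.sum_eq_zero hz, Finset.sum_eq_zero fun i hi => by rw [hz i hi]; norm_num]
    norm_num

/-- A set on which the volume grows linearly in `Q ~ dist²` has zero `H¹`-capacity: there are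
smooth functions vanishing near it that are `H¹`-close to the constant one. -/
theorem exists_cutoff {Ω : Set (EuclideanSpace ℝ (Fin d))} {Q : EuclideanSpace ℝ (Fin d) → ℝ}
    (hQ : ContDiff ℝ ∞ Q) (hQg : ∀ x, ‖fderiv ℝ Q x‖ ^ 2 ≤ 8 * Q x) {c : ℝ} (hc : 0 ≤ c)
    (hcv : ∀ r : ℝ, 0 ≤ r → volume {x ∈ Ω | Q x ≤ r} ≤ ENNReal.ofReal (c * r)) {e : ℝ}
    (he : 0 < e) :
    ∃ χ : EuclideanSpace ℝ (Fin d) → ℝ, ContDiff ℝ ∞ χ ∧ (∀ x, χ x ∈ Set.Icc (0 : ℝ) 1) ∧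
      (∃ δ > 0, ∀ x, Q x ≤ δ → χ x = 0) ∧
      eLpNorm (fun x => χ x - 1) 2 (volume.restrict Ω) ≤ ENNReal.ofReal e ∧
      eLpNorm (fderiv ℝ χ) 2 (volume.restrict Ω) ≤ ENNReal.ofReal e := by
  obtain ⟨D, hD, hDb⟩ := exists_abs_deriv_smoothTransition_le
  set ψ : ℝ → ℝ := fun r => Real.smoothTransition (r - 1) with hψ
  have hψs : ContDiff ℝ ∞ ψ :=
    (Real.smoothTransition.contDiff (n := ⊤)).comp (contDiff_id.sub contDiff_const)
  have hψ0 : ∀ r ≤ 1, ψ r = 0 := fun r hr =>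
    Real.smoothTransition.zero_of_nonpos (by linarith)
  have hψ1 : ∀ r, 2 ≤ r → ψ r = 1 := fun r hr =>
    Real.smoothTransition.one_of_one_le (by linarith)
  have hψI : ∀ r, 0 ≤ ψ r ∧ ψ r ≤ 1 := fun r =>
    ⟨Real.smoothTransition.nonneg _, Real.smoothTransition.le_one _⟩
  -- `M` sets the coarsest scale: `χ = 1` off `{Q ≤ 2·4^(-M)}`, whose measure controls `χ - 1`.
  obtain ⟨M, hM⟩ : ∃ M : ℕ, c * (2 * (1 / 4) ^ M) ≤ e ^ 2 := by
    have h1 : Tendsto (fun M : ℕ => c * (2 * (1 / 4 : ℝ) ^ M)) atTop (𝓝 (c * (2 * 0))) :=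
      ((tendsto_pow_atTop_nhds_zero_of_lt_one (by norm_num) (by norm_num)).const_mul _).const_mul _
    rw [mul_zero, mul_zero] at h1
    exact (h1.eventually (ge_mem_nhds (by positivity : (0 : ℝ) < e ^ 2))).exists
  -- `N` is the number of scales averaged. Each has Dirichlet energy at most `32 D² c`,
  -- independently of the scale; as the gradients have disjoint supports, their mean has energy at
  -- most `32 D² c / N`. This is a discrete logarithmic cutoff.
  obtain ⟨N, hN⟩ := exists_nat_gt (32 * D ^ 2 * c / e ^ 2)
  have hNpos : (0 : ℝ) < N := lt_of_le_of_lt (by positivity) hN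
  have hN' : 32 * D ^ 2 * c / N ≤ e ^ 2 := by
    rw [div_lt_iff₀ (by positivity)] at hN
    rw [div_le_iff₀ hNpos]
    linarith
  let φ : ℕ → EuclideanSpace ℝ (Fin d) → ℝ := fun m x => ψ (4 ^ (M + m) * Q x)
  have hφs : ∀ m, ContDiff ℝ ∞ (φ m) := fun m => hψs.comp (contDiff_const.mul hQ)
  have hQd : Differentiable ℝ Q := hQ.differentiable (by simp)
  let χ : EuclideanSpace ℝ (Fin d) → ℝ := fun x => (N : ℝ)⁻¹ * ∑ m ∈ Finset.range N, φ m x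
  have hQ0 : ∀ x, 0 ≤ Q x := fun x => by nlinarith [hQg x, sq_nonneg ‖fderiv ℝ Q x‖]
  have hQc : Continuous Q := hQ.continuous
  let A : ℕ → Set (EuclideanSpace ℝ (Fin d)) := fun m => {x | 4 ^ (M + m) * Q x ∈ Set.Icc (1 : ℝ) 2}
  have hAm : ∀ m, MeasurableSet (A m) := fun m =>
    measurableSet_Icc.preimage (continuous_const.mul hQc).measurable
  have hφd : ∀ m x, fderiv ℝ (φ m) x =
      (deriv ψ (4 ^ (M + m) * Q x) * 4 ^ (M + m)) • fderiv ℝ Q x := by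
    intro m x
    have h1 : HasFDerivAt (fun x => (4 : ℝ) ^ (M + m) * Q x) ((4 : ℝ) ^ (M + m) • fderiv ℝ Q x) x :=
      (hQd x).hasFDerivAt.const_mul _
    have h2 : HasDerivAt ψ (deriv ψ (4 ^ (M + m) * Q x)) (4 ^ (M + m) * Q x) :=
      (hψs.differentiable (by simp) _).hasDerivAt
    exact (h2.comp_hasFDerivAt x h1).fderiv.trans (smul_smul _ _ _)
  have hφn : ∀ m x, ‖fderiv ℝ (φ m) x‖ ^ 2 ≤
      (A m).indicator (fun _ => 16 * D ^ 2 * 4 ^ (M + m)) x := by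
    intro m x
    have h1 : |deriv ψ (4 ^ (M + m) * Q x)| ≤ (A m).indicator (fun _ => D) x :=
      hDb (4 ^ (M + m) * Q x)
    rw [hφd, norm_smul, Real.norm_eq_abs, abs_mul, abs_of_pos (by positivity : (0 : ℝ) < 4 ^ (M + m))]
    by_cases hx : x ∈ A m
    · rw [Set.indicator_of_mem hx]
      rw [Set.indicator_of_mem hx] at h1
      have hx2 : (4 : ℝ) ^ (M + m) * Q x ≤ 2 := hx.2
      calc (|deriv ψ (4 ^ (M + m) * Q x)| * 4 ^ (M + m) * ‖fderiv ℝ Q x‖) ^ 2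
          ≤ (D * 4 ^ (M + m)) ^ 2 * (8 * Q x) := by
            rw [mul_pow]
            gcongr
            exact hQg x
        _ = 8 * D ^ 2 * 4 ^ (M + m) * (4 ^ (M + m) * Q x) := by ring
        _ ≤ 8 * D ^ 2 * 4 ^ (M + m) * 2 := by gcongr
        _ = _ := by ring
    · rw [Set.indicator_of_notMem hx]
      rw [Set.indicator_of_notMem hx] at h1
      rw [le_antisymm h1 (abs_nonneg _)]
      simp
  -- Scales differ by a factor at least `4`, while the transition interval `[1, 2]` spans only a
  -- factor `2`.
  have hAd : ∀ x m m', m < m' → x ∈ A m → x ∉ A m' := by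
    intro x m m' hmm hx hx'
    have h1 : (1 : ℝ) ≤ 4 ^ (M + m) * Q x := hx.1
    have h2 : (4 : ℝ) ^ (M + m') * Q x ≤ 2 := hx'.2
    have h3 : (4 : ℝ) ^ (M + m) * 4 ≤ 4 ^ (M + m') := by
      rw [← pow_succ]
      exact pow_le_pow_right₀ (by norm_num) (by omega)
    nlinarith [hQ0 x]
  have hfz : ∀ m x, x ∉ A m → ‖fderiv ℝ (φ m) x‖ = 0 := by
    intro m x hx
    have := hφn m x
    rw [Set.indicator_of_notMem hx] at this
    nlinarith [norm_nonneg (fderiv ℝ (φ m) x)]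
  have hχd : ∀ x, fderiv ℝ χ x = (N : ℝ)⁻¹ • ∑ m ∈ Finset.range N, fderiv ℝ (φ m) x := by
    intro x
    exact ((HasFDerivAt.fun_sum fun m _ =>
      ((hφs m).differentiable (by simp) x).hasFDerivAt).const_mul _).fderiv
  have hχn : ∀ x, ‖fderiv ℝ χ x‖ ^ 2 ≤ ∑ m ∈ Finset.range N,
      (A m).indicator (fun _ => 16 * D ^ 2 / N ^ 2 * 4 ^ (M + m)) x := by
    intro x
    have h1 : ‖fderiv ℝ χ x‖ ≤ (N : ℝ)⁻¹ * ∑ m ∈ Finset.range N, ‖fderiv ℝ (φ m) x‖ := by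
      rw [hχd, norm_smul, norm_inv, Real.norm_natCast]
      gcongr
      exact norm_sum_le _ _
    have h2 := Finset.sq_sum_le_sum_sq_of_pairwise (Finset.range N) (fun m => ‖fderiv ℝ (φ m) x‖) (by
      intro i _ j _ hij
      by_contra! hcon
      have hi : x ∈ A i := by
        by_contra h
        exact hcon.1 (hfz i x h)
      have hj : x ∈ A j := by
        by_contra h
        exact hcon.2 (hfz j x h)
      rcases lt_or_gt_of_ne hij with h | h
      · exact hAd x i j h hi hj
      · exact hAd x j i h hj hi)
    calc ‖fderiv ℝ χ x‖ ^ 2 ≤ ((N : ℝ)⁻¹ * ∑ m ∈ Finset.range N, ‖fderiv ℝ (φ m) x‖) ^ 2 := by gcongr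
      _ = ∑ m ∈ Finset.range N, (N : ℝ)⁻¹ ^ 2 * ‖fderiv ℝ (φ m) x‖ ^ 2 := by
          rw [mul_pow, h2, Finset.mul_sum]
      _ ≤ _ := by
          refine Finset.sum_le_sum fun m _ => ?_
          have h3 := mul_le_mul_of_nonneg_left (hφn m x) (by positivity : (0 : ℝ) ≤ (N : ℝ)⁻¹ ^ 2)
          refine h3.trans (le_of_eq ?_)
          by_cases hx : x ∈ A m
          · rw [Set.indicator_of_mem hx, Set.indicator_of_mem hx]
            field_simp
          · rw [Set.indicator_of_notMem hx, Set.indicator_of_notMem hx, mul_zero]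
  have hvolA : ∀ r : ℝ, 0 ≤ r → ∀ S : Set (EuclideanSpace ℝ (Fin d)), MeasurableSet S →
      (∀ x ∈ S, Q x ≤ r) → volume.restrict Ω S ≤ ENNReal.ofReal (c * r) := by
    intro r hr S hS hSr
    rw [Measure.restrict_apply hS]
    exact (measure_mono (show S ∩ Ω ⊆ {x ∈ Ω | Q x ≤ r} from
      fun x hx => ⟨hx.2, hSr x hx.1⟩)).trans (hcv r hr)
  refine ⟨χ, ?_, fun x => ⟨?_, ?_⟩, ⟨(1 / 4) ^ (M + N), by positivity, fun x hx => ?_⟩, ?_, ?_⟩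
  · exact contDiff_const.mul (ContDiff.sum fun m _ => hφs m)
  · exact mul_nonneg (by positivity) (Finset.sum_nonneg fun m _ => (hψI _).1)
  · have : ∑ m ∈ Finset.range N, φ m x ≤ ∑ m ∈ Finset.range N, (1 : ℝ) :=
      Finset.sum_le_sum fun m _ => (hψI _).2
    rw [Finset.sum_const, Finset.card_range, nsmul_one] at this
    calc (N : ℝ)⁻¹ * ∑ m ∈ Finset.range N, φ m x ≤ (N : ℝ)⁻¹ * N := by gcongr
      _ = 1 := inv_mul_cancel₀ hNpos.ne'
  · have : ∑ m ∈ Finset.range N, φ m x = 0 := by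
      refine Finset.sum_eq_zero fun m hm => hψ0 _ ?_
      calc (4 : ℝ) ^ (M + m) * Q x ≤ 4 ^ (M + N) * (1 / 4) ^ (M + N) := by
            gcongr
            · exact hQ0 x
            · norm_num
            · exact (Finset.mem_range.1 hm).le
        _ = 1 := by rw [← mul_pow]; norm_num
    simp only [χ, this, mul_zero]
  · refine eLpNorm_two_le_ofReal he.le ?_
    let S : Set (EuclideanSpace ℝ (Fin d)) := {x | Q x ≤ 2 * (1 / 4) ^ M}
    have hS : MeasurableSet S := (isClosed_le hQc continuous_const).measurableSet
    have hpt : ∀ x, ‖χ x - 1‖ₑ ^ 2 ≤ S.indicator (fun _ => (1 : ENNReal)) x := by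
      intro x
      by_cases hx : x ∈ S
      · rw [Set.indicator_of_mem hx]
        have h0 : ‖χ x - 1‖ₑ ≤ 1 := by
          have h1 : 0 ≤ χ x := mul_nonneg (by positivity) (Finset.sum_nonneg fun m _ => (hψI _).1)
          have h2 : χ x ≤ 1 := by
            have : ∑ m ∈ Finset.range N, φ m x ≤ ∑ m ∈ Finset.range N, (1 : ℝ) :=
              Finset.sum_le_sum fun m _ => (hψI _).2
            rw [Finset.sum_const, Finset.card_range, nsmul_one] at this
            calc (N : ℝ)⁻¹ * ∑ m ∈ Finset.range N, φ m x ≤ (N : ℝ)⁻¹ * N := by gcongr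
              _ = 1 := inv_mul_cancel₀ hNpos.ne'
          rw [← ofReal_norm, ← ENNReal.ofReal_one]
          refine ENNReal.ofReal_le_ofReal ?_
          rw [Real.norm_eq_abs, abs_le]
          constructor <;> linarith
        exact pow_le_one' h0 2
      · have hx' : 2 * (1 / 4) ^ M < Q x := not_le.1 hx
        have : ∑ m ∈ Finset.range N, φ m x = N := by
          rw [Finset.sum_congr rfl fun m hm => hψ1 (4 ^ (M + m) * Q x) ?_]
          · simp
          · calc (2 : ℝ) = 4 ^ M * (2 * (1 / 4) ^ M) := by
                  have : (4 : ℝ) ^ M * (1 / 4) ^ M = 1 := by rw [← mul_pow]; norm_num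
                  linear_combination -2 * this
              _ ≤ 4 ^ (M + m) * Q x := by
                  gcongr
                  · norm_num
                  · omega
        have : χ x = 1 := by
          simp only [χ, this]
          exact inv_mul_cancel₀ hNpos.ne'
        rw [this]
        simp
    refine (lintegral_mono hpt).trans ?_
    rw [lintegral_indicator_const hS, one_mul]
    exact (hvolA _ (by positivity) S hS fun x hx => hx).trans (ENNReal.ofReal_le_ofReal hM)
  · refine eLpNorm_two_le_ofReal he.le ?_
    have hpt : ∀ x, ‖fderiv ℝ χ x‖ₑ ^ 2 ≤ ∑ m ∈ Finset.range N,
        (A m).indicator (fun _ => ENNReal.ofReal (16 * D ^ 2 / N ^ 2 * 4 ^ (M + m))) x := by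
      intro x
      rw [← ofReal_norm, ← ENNReal.ofReal_pow (norm_nonneg _)]
      refine (ENNReal.ofReal_le_ofReal (hχn x)).trans (le_of_eq ?_)
      rw [ENNReal.ofReal_sum_of_nonneg fun m _ => Set.indicator_nonneg (fun _ _ => by positivity) x]
      refine Finset.sum_congr rfl fun m _ => ?_
      by_cases hx : x ∈ A m
      · rw [Set.indicator_of_mem hx, Set.indicator_of_mem hx]
      · rw [Set.indicator_of_notMem hx, Set.indicator_of_notMem hx, ENNReal.ofReal_zero]
    refine (lintegral_mono hpt).trans ?_
    rw [lintegral_finsetSum _ fun m _ => measurable_const.indicator (hAm m)]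
    calc ∑ m ∈ Finset.range N, ∫⁻ x in Ω,
          (A m).indicator (fun _ => ENNReal.ofReal (16 * D ^ 2 / N ^ 2 * 4 ^ (M + m))) x
        ≤ ∑ m ∈ Finset.range N, ENNReal.ofReal (32 * D ^ 2 * c / N ^ 2) := by
          refine Finset.sum_le_sum fun m _ => ?_
          rw [lintegral_indicator_const (hAm m)]
          refine (mul_le_mul_right (hvolA (2 * (1 / 4) ^ (M + m)) (by positivity) _ (hAm m)
            fun x hx => ?_) _).trans ?_
          · have h2 : (4 : ℝ) ^ (M + m) * Q x ≤ 2 := hx.2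
            have h3 : (4 : ℝ) ^ (M + m) * (1 / 4) ^ (M + m) = 1 := by rw [← mul_pow]; norm_num
            have h4 : (0 : ℝ) < (1 / 4) ^ (M + m) := by positivity
            calc Q x = (1 / 4) ^ (M + m) * (4 ^ (M + m) * Q x) := by
                  linear_combination -(Q x) * h3
              _ ≤ (1 / 4) ^ (M + m) * 2 := by gcongr
              _ = _ := mul_comm _ _
          · rw [← ENNReal.ofReal_mul (by positivity)]
            refine ENNReal.ofReal_le_ofReal (le_of_eq ?_)
            have h3 : (4 : ℝ) ^ (M + m) * (1 / 4) ^ (M + m) = 1 := by rw [← mul_pow]; norm_num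
            linear_combination (32 * D ^ 2 * c / N ^ 2) * h3
      _ ≤ ENNReal.ofReal (e ^ 2) := by
          rw [← ENNReal.ofReal_sum_of_nonneg fun _ _ => by positivity]
          refine ENNReal.ofReal_le_ofReal (le_trans (le_of_eq ?_) hN')
          rw [Finset.sum_const, Finset.card_range, nsmul_eq_mul]
          field_simp

/-- Multiply the individual cutoffs. With values in `[0, 1]`, both the deviation from one and the
gradient of a product are bounded by the sums over its factors. -/
theorem exists_cutoff_finset {ι : Type*} (J : Finset ι) {Ω : Set (EuclideanSpace ℝ (Fin d))}
    {Q : ι → EuclideanSpace ℝ (Fin d) → ℝ} (hQ : ∀ j ∈ J, ContDiff ℝ ∞ (Q j))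
    (hQg : ∀ j ∈ J, ∀ x, ‖fderiv ℝ (Q j) x‖ ^ 2 ≤ 8 * Q j x)
    (hcv : ∀ j ∈ J, ∃ c : ℝ, 0 ≤ c ∧
      ∀ r : ℝ, 0 ≤ r → volume {x ∈ Ω | Q j x ≤ r} ≤ ENNReal.ofReal (c * r)) :
    ∀ e : ℝ, 0 < e → ∃ χ : EuclideanSpace ℝ (Fin d) → ℝ, ContDiff ℝ ∞ χ ∧
      (∀ x, χ x ∈ Set.Icc (0 : ℝ) 1) ∧
      (∃ δ > 0, ∀ j ∈ J, ∀ x, Q j x ≤ δ → χ x = 0) ∧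
      eLpNorm (fun x => χ x - 1) 2 (volume.restrict Ω) ≤ ENNReal.ofReal e ∧
      eLpNorm (fderiv ℝ χ) 2 (volume.restrict Ω) ≤ ENNReal.ofReal e := by
  classical
  induction J using Finset.induction_on with
  | empty =>
    intro e he
    refine ⟨fun _ => 1, contDiff_const, fun _ => by simp, ⟨1, one_pos, by simp⟩, ?_, ?_⟩
    · simp
    · have h0 : ∀ x, ‖fderiv ℝ (fun _ : EuclideanSpace ℝ (Fin d) => (1 : ℝ)) x‖ = ‖(0 : ℝ)‖ :=
        fun x => by
          rw [fderiv_const_apply]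
          exact norm_zero.trans norm_zero.symm
      rw [eLpNorm_congr_norm_ae (g := fun _ => (0 : ℝ)) (Eventually.of_forall h0)]
      simp
  | insert j J hj ih =>
    intro e he
    obtain ⟨c, hc, hcj⟩ := hcv j (Finset.mem_insert_self _ _)
    obtain ⟨χ₁, s₁, I₁, ⟨δ₁, hδ₁, z₁⟩, n₁, g₁⟩ := exists_cutoff (hQ j (Finset.mem_insert_self _ _))
      (hQg j (Finset.mem_insert_self _ _)) hc hcj (half_pos he)
    obtain ⟨χ₂, s₂, I₂, ⟨δ₂, hδ₂, z₂⟩, n₂, g₂⟩ := ih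
      (fun i hi => hQ i (Finset.mem_insert_of_mem hi))
      (fun i hi => hQg i (Finset.mem_insert_of_mem hi))
      (fun i hi => hcv i (Finset.mem_insert_of_mem hi)) _ (half_pos he)
    have hee : ENNReal.ofReal e = ENNReal.ofReal (e / 2) + ENNReal.ofReal (e / 2) := by
      rw [← ENNReal.ofReal_add (by positivity) (by positivity), add_halves]
    refine ⟨fun x => χ₁ x * χ₂ x, s₁.mul s₂, fun x => ⟨mul_nonneg (I₁ x).1 (I₂ x).1,
      mul_le_one₀ (I₁ x).2 (I₂ x).1 (I₂ x).2⟩, ⟨min δ₁ δ₂, lt_min hδ₁ hδ₂, ?_⟩, ?_, ?_⟩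
    · intro i hi x hx
      change χ₁ x * χ₂ x = 0
      rcases Finset.mem_insert.1 hi with rfl | hi
      · rw [z₁ x (hx.trans (min_le_left _ _)), zero_mul]
      · rw [z₂ i hi x (hx.trans (min_le_right _ _)), mul_zero]
    · rw [hee]
      refine (eLpNorm_two_le_add_of_norm_le (a := fun x => χ₁ x - 1) (b := fun x => χ₂ x - 1)
        (s₁.continuous.sub continuous_const).aestronglyMeasurable
        (s₂.continuous.sub continuous_const).aestronglyMeasurable
        (Eventually.of_forall fun x => ?_)).trans (add_le_add n₁ n₂)
      have : χ₁ x * χ₂ x - 1 = (χ₁ x - 1) + χ₁ x * (χ₂ x - 1) := by ring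
      rw [this]
      refine (norm_add_le _ _).trans ?_
      gcongr
      rw [norm_mul]
      refine mul_le_of_le_one_left (norm_nonneg _) ?_
      rw [Real.norm_of_nonneg (I₁ x).1]
      exact (I₁ x).2
    · rw [hee]
      refine (eLpNorm_two_le_add_of_norm_le (a := fderiv ℝ χ₁) (b := fderiv ℝ χ₂)
        (s₁.continuous_fderiv (by simp)).aestronglyMeasurable
        (s₂.continuous_fderiv (by simp)).aestronglyMeasurable
        (Eventually.of_forall fun x => ?_)).trans (add_le_add g₁ g₂)
      rw [fderiv_fun_mul (s₁.differentiable (by simp) x) (s₂.differentiable (by simp) x), add_comm ‖fderiv ℝ χ₁ x‖]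
      refine (norm_add_le _ _).trans ?_
      rw [norm_smul, norm_smul, Real.norm_of_nonneg (I₁ x).1, Real.norm_of_nonneg (I₂ x).1]
      exact add_le_add (mul_le_of_le_one_left (norm_nonneg _) (I₁ x).2)
        (mul_le_of_le_one_left (norm_nonneg _) (I₂ x).2)

end Cutoff

/-! ### Interpolation estimate on the polytope -/

section PolytopeApproximation

variable {d : ℕ} {V : Finset (EuclideanSpace ℝ (Fin d))}

theorem norm_gradient (f : EuclideanSpace ℝ (Fin d) → ℝ) (x : EuclideanSpace ℝ (Fin d)) :
    ‖gradient f x‖ = ‖fderiv ℝ f x‖ :=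
  LinearIsometryEquiv.norm_map _ _

theorem isBounded_interior_convexHull :
    Bornology.IsBounded (interior (convexHull ℝ (V : Set (EuclideanSpace ℝ (Fin d))))) :=
  ((V.finite_toSet.isCompact_convexHull ℝ).isBounded).subset interior_subset

theorem norm_fderiv_sq_add_sq_le {n₁ n₂ : EuclideanSpace ℝ (Fin d)} (hn₁ : ‖n₁‖ = 1)
    (hn₂ : ‖n₂‖ = 1) (a₁ a₂ : ℝ) (x : EuclideanSpace ℝ (Fin d)) :
    ‖fderiv ℝ (fun x => (inner ℝ n₁ x - a₁) ^ 2 + (inner ℝ n₂ x - a₂) ^ 2) x‖ ^ 2 ≤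
      8 * ((inner ℝ n₁ x - a₁) ^ 2 + (inner ℝ n₂ x - a₂) ^ 2) := by
  have h : ∀ (n : EuclideanSpace ℝ (Fin d)) (a : ℝ), HasFDerivAt (fun x => (inner ℝ n x - a) ^ 2)
      ((2 * (inner ℝ n x - a)) • innerSL ℝ n) x := fun n a => by
    have := (((innerSL ℝ n).hasFDerivAt (x := x)).sub_const a).pow 2
    simpa using this
  rw [((h n₁ a₁).fun_add (h n₂ a₂)).fderiv]
  set s := inner ℝ n₁ x - a₁
  set t := inner ℝ n₂ x - a₂
  have h1 : ‖(2 * s) • innerSL ℝ n₁ + (2 * t) • innerSL ℝ n₂‖ ≤ 2 * |s| + 2 * |t| := by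
    refine (norm_add_le _ _).trans (le_of_eq ?_)
    rw [norm_smul, norm_smul, innerSL_apply_norm, innerSL_apply_norm, hn₁, hn₂]
    simp
  calc _ ≤ (2 * |s| + 2 * |t|) ^ 2 := by gcongr
    _ ≤ 8 * (|s| ^ 2 + |t| ^ 2) := by nlinarith [sq_nonneg (|s| - |t|)]
    _ = _ := by rw [sq_abs, sq_abs]

/-- Smooth cutoffs that are `H¹`-close to one and vanish wherever two facets are close. -/
theorem exists_polytope_cutoff (hd : 1 < d)
    (hne : (interior (convexHull ℝ (V : Set (EuclideanSpace ℝ (Fin d))))).Nonempty) {e : ℝ}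
    (he : 0 < e) :
    ∃ χ : EuclideanSpace ℝ (Fin d) → ℝ, ContDiff ℝ ∞ χ ∧ (∀ x, χ x ∈ Set.Icc (0 : ℝ) 1) ∧
      (∃ δ > 0, ∀ p ∈ facetFunctionals V, ∀ q ∈ facetFunctionals V, p ≠ q → ∀ x,
        (inner ℝ p.1 x - p.2) ^ 2 + (inner ℝ q.1 x - q.2) ^ 2 ≤ δ → χ x = 0) ∧
      eLpNorm (fun x => χ x - 1) 2
        (volume.restrict (interior (convexHull ℝ (V : Set (EuclideanSpace ℝ (Fin d)))))) ≤
          ENNReal.ofReal e ∧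
      eLpNorm (gradient χ) 2
        (volume.restrict (interior (convexHull ℝ (V : Set (EuclideanSpace ℝ (Fin d)))))) ≤
          ENNReal.ofReal e := by
  classical
  have hfin := finite_facetFunctionals hd hne
  let Q : (EuclideanSpace ℝ (Fin d) × ℝ) × (EuclideanSpace ℝ (Fin d) × ℝ) →
      EuclideanSpace ℝ (Fin d) → ℝ := fun j x =>
    (inner ℝ j.1.1 x - j.1.2) ^ 2 + (inner ℝ j.2.1 x - j.2.2) ^ 2
  have hmem : ∀ j ∈ hfin.toFinset.offDiag, j.1 ∈ facetFunctionals V ∧ j.2 ∈ facetFunctionals V ∧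
      j.1 ≠ j.2 := by
    intro j hj
    simpa [Finset.mem_offDiag] using hj
  obtain ⟨χ, hs, hI, ⟨δ, hδ, hz⟩, h1, h2⟩ := exists_cutoff_finset hfin.toFinset.offDiag
    (Ω := interior (convexHull ℝ (V : Set (EuclideanSpace ℝ (Fin d))))) (Q := Q)
    (fun j _ => (((contDiff_const.inner ℝ contDiff_id).sub contDiff_const).pow 2).add
      (((contDiff_const.inner ℝ contDiff_id).sub contDiff_const).pow 2))
    (fun j hj x => norm_fderiv_sq_add_sq_le (hmem j hj).1.1 (hmem j hj).2.1.1 _ _ x)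
    (fun j hj => exists_volume_wedge_le hd isBounded_interior_convexHull hne (hmem j hj).1.1
      (hmem j hj).2.1.1 (hmem j hj).2.2
      (fun x hx => (mem_interior_convexHull_iff hd hne).1 hx _ (hmem j hj).1)
      (fun x hx => (mem_interior_convexHull_iff hd hne).1 hx _ (hmem j hj).2.1)) e he
  refine ⟨χ, hs, hI, ⟨δ, hδ, fun p hp q hq hpq x hx => hz (p, q) ?_ x hx⟩, h1, ?_⟩
  · simp [Finset.mem_offDiag, hp, hq, hpq]
  · rwa [eLpNorm_congr_norm_ae (Eventually.of_forall (norm_gradient χ))]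

theorem exists_taylor_bound {U : EuclideanSpace ℝ (Fin d) → ℝ} (hU : ContDiff ℝ ∞ U)
    {K : Set (EuclideanSpace ℝ (Fin d))} (hK : IsCompact K) (hKc : Convex ℝ K) :
    ∃ M : ℝ, 0 ≤ M ∧ ∀ x ∈ K, ∀ a ∈ K,
      |U a - U x - inner ℝ (gradient U x) (a - x)| ≤ M * ‖a - x‖ ^ 2 := by
  have h2 : ContDiff ℝ 1 (fderiv ℝ U) := hU.fderiv_right (by norm_cast)
  obtain ⟨M, hM⟩ := hK.exists_bound_of_continuousOn (f := fderiv ℝ (fderiv ℝ U))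
    (h2.continuous_fderiv (by simp)).continuousOn
  refine ⟨|M|, abs_nonneg M, fun x hx a ha => ?_⟩
  have hlip : ∀ y ∈ K, ‖fderiv ℝ U y - fderiv ℝ U x‖ ≤ |M| * ‖y - x‖ := fun y hy =>
    hKc.norm_image_sub_le_of_norm_fderiv_le (fun z _ => h2.differentiable (by simp) z)
      (fun z hz => (hM z hz).trans (le_abs_self M)) hx hy
  have hs : Convex ℝ (K ∩ Metric.closedBall x ‖a - x‖) := hKc.inter (convex_closedBall _ _)
  have := hs.norm_image_sub_le_of_norm_fderiv_le' (f := U) (φ := fderiv ℝ U x)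
    (C := |M| * ‖a - x‖) (fun z _ => hU.differentiable (by simp) z)
    (fun z hz => (hlip z hz.1).trans (by
      have := mem_closedBall_iff_norm.1 hz.2
      gcongr)) (x := x) (y := a)
    ⟨hx, Metric.mem_closedBall_self (norm_nonneg _)⟩ ⟨ha, mem_closedBall_iff_norm.2 le_rfl⟩
  rw [inner_gradient_left]
  calc _ ≤ |M| * ‖a - x‖ * ‖a - x‖ := this
    _ = _ := by ring

/-- The nodes of a polytope that keep away from the facets they do not belong to are also separated
in the normal coordinates. -/
theorem exists_facet_gap (hd : 1 < d)
    (hne : (interior (convexHull ℝ (V : Set (EuclideanSpace ℝ (Fin d))))).Nonempty) {η : ℝ}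
    (hη : 0 < η) :
    ∃ η' : ℝ, 0 < η' ∧ ∀ (P : Finset (EuclideanSpace ℝ (Fin d))) (h : ℝ), 0 < h →
      (P : Set (EuclideanSpace ℝ (Fin d))) ⊆ convexHull ℝ (V : Set (EuclideanSpace ℝ (Fin d))) →
      (∀ A, IsFacet (interior (convexHull ℝ (V : Set (EuclideanSpace ℝ (Fin d))))) A →
        ∀ a ∈ P, ¬ (0 < Metric.infDist a A ∧ Metric.infDist a A < η * h)) →
      ∀ p ∈ facetFunctionals V, ∀ a ∈ P, inner ℝ p.1 a = p.2 ∨ p.2 + η' * h ≤ inner ℝ p.1 a := by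
  classical
  have hfin := finite_facetFunctionals hd hne
  have hex : ∀ p : facetFunctionals V, ∃ C : ℝ, 0 < C ∧
      ∀ x ∈ convexHull ℝ (V : Set (EuclideanSpace ℝ (Fin d))), Metric.infDist x
        {x | x ∈ convexHull ℝ (V : Set (EuclideanSpace ℝ (Fin d))) ∧ inner ℝ p.1.1 x = p.1.2} ≤
        C * (inner ℝ p.1.1 x - p.1.2) := fun p => exists_infDist_face_le hd p.2
  choose C hC hCd using hex
  have := hfin.fintype
  -- Distance to a facet is at most `C` times the height, so a distance of at least `ηh` forces a
  -- height of at least `ηh/S`, with one constant for all facets.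
  set S := 1 + ∑ p, C p with hS
  have hS0 : 0 < S := by
    have := Finset.sum_nonneg fun (p : facetFunctionals V) (_ : p ∈ Finset.univ) => (hC p).le
    positivity
  refine ⟨η / S, by positivity, fun P h hh hP hA p hp a ha => ?_⟩
  set A := {x | x ∈ convexHull ℝ (V : Set (EuclideanSpace ℝ (Fin d))) ∧ inner ℝ p.1 x = p.2}
    with hAdef
  have hfac : IsFacet (interior (convexHull ℝ (V : Set (EuclideanSpace ℝ (Fin d))))) A :=
    isFacet_of_mem_facetFunctionals hne hp
  have hAn : A.Nonempty := by
    rw [Set.nonempty_iff_ne_empty]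
    intro h0
    have := hfac.2
    rw [h0, vectorSpan_empty, finrank_bot] at this
    omega
  have hAc : IsClosed A := (V.finite_toSet.isClosed_convexHull ℝ).inter
    (isClosed_eq (by fun_prop) continuous_const)
  have hle : p.2 ≤ inner ℝ p.1 a := le_inner_of_mem_convexHull hp.2.1 (hP ha)
  by_cases h0 : Metric.infDist a A = 0
  · exact Or.inl ((hAc.mem_iff_infDist_zero hAn).2 h0).2
  · right
    have h1 : η * h ≤ Metric.infDist a A := by
      by_contra hlt
      exact hA A hfac a ha ⟨lt_of_le_of_ne Metric.infDist_nonneg (Ne.symm h0), not_le.1 hlt⟩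
    have h2 := hCd ⟨p, hp⟩ a (hP ha)
    have h3 : C ⟨p, hp⟩ ≤ S := by
      have := Finset.single_le_sum (f := C) (fun q _ => (hC q).le) (Finset.mem_univ ⟨p, hp⟩)
      linarith
    have h4 : η * h ≤ S * (inner ℝ p.1 a - p.2) :=
      h1.trans (h2.trans (mul_le_mul_of_nonneg_right h3 (sub_nonneg.2 hle)))
    have h5 : η / S * h ≤ inner ℝ p.1 a - p.2 := by
      rw [div_mul_eq_mul_div, div_le_iff₀ hS0]
      linarith
    linarith

/-- The nodal interpolant by the shape functions approximates a smooth function, except near the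
intersections of facets, with a weight that degenerates at the facets. -/
theorem exists_lme_interpolation_estimate (hd : 1 < d)
    (hne : (interior (convexHull ℝ (V : Set (EuclideanSpace ℝ (Fin d))))).Nonempty)
    {γ τ η M δ : ℝ} (hγ : 0 < γ) (hη : 0 < η) (hM : 0 ≤ M) (hδ : 0 < δ) :
    ∃ C h₀ : ℝ, 0 ≤ C ∧ 0 < h₀ ∧ ∀ (P : Finset (EuclideanSpace ℝ (Fin d))) (h : ℝ), 0 < h →
      h ≤ h₀ → interior (convexHull ℝ (P : Set (EuclideanSpace ℝ (Fin d)))) =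
        interior (convexHull ℝ (V : Set (EuclideanSpace ℝ (Fin d)))) →
      IsHCovering P h (interior (convexHull ℝ (V : Set (EuclideanSpace ℝ (Fin d))))) →
      HasHDensityLE P h τ →
      (∀ A, IsFacet (interior (convexHull ℝ (V : Set (EuclideanSpace ℝ (Fin d))))) A →
        ∀ a ∈ P, ¬ (0 < Metric.infDist a A ∧ Metric.infDist a A < η * h)) →
      ∀ (U : EuclideanSpace ℝ (Fin d) → ℝ) (D : EuclideanSpace ℝ (Fin d)),
      ∀ x ∈ interior (convexHull ℝ (V : Set (EuclideanSpace ℝ (Fin d)))),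
        (∀ a ∈ convexHull ℝ (V : Set (EuclideanSpace ℝ (Fin d))),
          |U a - U x - inner ℝ D (a - x)| ≤ M * ‖a - x‖ ^ 2) →
        |∑ a : P, U a * lmeShape (γ / h ^ 2) P a x - U x| ≤ C * h ^ 2 ∧
        ((∀ p ∈ facetFunctionals V, ∀ q ∈ facetFunctionals V, p ≠ q →
          δ < (inner ℝ p.1 x - p.2) ^ 2 + (inner ℝ q.1 x - q.2) ^ 2) →
          ‖gradient (fun z => ∑ a : P, U a * lmeShape (γ / h ^ 2) P a z) x - D‖ ^ 2 ≤
            (C * h) ^ 2 * (1 + ∑ᶠ p ∈ facetFunctionals V, 1 / √(inner ℝ p.1 x - p.2))) := by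
  classical
  obtain ⟨η', hη', hgap⟩ := exists_facet_gap hd hne hη
  have hfin := finite_facetFunctionals hd hne
  -- The bound `η'/2` ensures `t/h ≤ η'/2` whenever `t ≤ ρh`, as the degenerate estimate requires.
  set ρ := min 1 (η' / 2) with hρdef
  have hρ : 0 < ρ := lt_min one_pos (by positivity)
  obtain ⟨C, hC, hest⟩ := exists_pointwise_estimate d (τ := τ) hγ hη' hρ (min_le_left _ _)
    (min_le_right _ _) hM
  -- Here `5 = 1² + 2²`: a point closer than `ρh` to one facet hyperplane and `2ρh` to another would
  -- violate the separation by `δ`.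
  obtain ⟨h₁, hh₁, hh₁δ⟩ : ∃ h₁ : ℝ, 0 < h₁ ∧ 5 * (ρ * h₁) ^ 2 ≤ δ := by
    refine ⟨√(δ / 5) / ρ, by positivity, le_of_eq ?_⟩
    rw [mul_div_cancel₀ _ hρ.ne', Real.sq_sqrt (by positivity)]
    ring
  refine ⟨C, min 1 h₁, hC, lt_min one_pos hh₁, ?_⟩
  intro P h hh hh0 hconv hcov hdens hfacet U D x hx hU
  have hPn : (interior (convexHull ℝ (P : Set (EuclideanSpace ℝ (Fin d))))).Nonempty := by
    rwa [hconv]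
  have hcl : convexHull ℝ (P : Set (EuclideanSpace ℝ (Fin d))) =
      convexHull ℝ (V : Set (EuclideanSpace ℝ (Fin d))) := by
    rw [← closure_interior_convexHull hPn, hconv, closure_interior_convexHull hne]
  have hPV : (P : Set (EuclideanSpace ℝ (Fin d))) ⊆
      convexHull ℝ (V : Set (EuclideanSpace ℝ (Fin d))) := hcl ▸ subset_convexHull ℝ _
  have hg := hgap P h hh hPV hfacet
  have hx' : x ∈ interior (convexHull ℝ (P : Set (EuclideanSpace ℝ (Fin d)))) := hconv ▸ hx
  obtain ⟨e1, e2, e3⟩ := hest P h x D U hh hdens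
    (IsHCovering.isLocallyGenerated (hconv.symm ▸ hcov) hPn) hx' fun a ha => hU a (hPV ha)
  rw [hcl] at e2 e3
  refine ⟨e1, fun hsep => ?_⟩
  have hpos : ∀ p ∈ facetFunctionals V, 0 < inner ℝ p.1 x - p.2 := fun p hp =>
    sub_pos.2 ((mem_interior_convexHull_iff hd hne).1 hx p hp)
  have hsum0 : ∀ p ∈ hfin.toFinset, 0 ≤ 1 / √(inner ℝ p.1 x - p.2) := fun p _ => by positivity
  rw [finsum_mem_eq_finite_toFinset_sum _ hfin]
  have hρh : 0 < ρ * h := by positivity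
  have hρδ : 5 * (ρ * h) ^ 2 ≤ δ := by
    refine le_trans ?_ hh₁δ
    have : h ≤ h₁ := hh0.trans (min_le_right _ _)
    gcongr
  have hip : ∀ p ∈ facetFunctionals V, ∀ e : EuclideanSpace ℝ (Fin d), ‖e‖ = 1 →
      -1 ≤ inner ℝ p.1 e := by
    intro p hp e he
    have := abs_real_inner_le_norm p.1 e
    rw [hp.1, he, one_mul] at this
    exact (abs_le.1 this).1
  by_cases hint : ∀ p ∈ facetFunctionals V, ρ * h ≤ inner ℝ p.1 x - p.2
  · have h1 := e2 fun e he => (mem_convexHull_iff_facetFunctionals hne).2 fun p hp => by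
      rw [inner_add_right, real_inner_smul_right]
      have h3 := hint p hp
      have h4 := mul_le_mul_of_nonneg_left (hip p hp e he) hρh.le
      linarith
    calc _ ≤ (C * h) ^ 2 := by gcongr
      _ ≤ _ := by
        refine le_mul_of_one_le_right (by positivity) ?_
        linarith [Finset.sum_nonneg hsum0]
  · push Not at hint
    obtain ⟨p, hp, hpt⟩ := hint
    have ht := hpos p hp
    set t := inner ℝ p.1 x - p.2 with htdef
    have hq : ∀ q ∈ facetFunctionals V, q ≠ p → 2 * (ρ * h) ≤ inner ℝ q.1 x - q.2 := by
      intro q hq hqp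
      have h1 := hsep p hp q hq hqp.symm
      have h2 := hpos q hq
      by_contra hlt
      push Not at hlt
      nlinarith
    have h1 := e3 p.1 p.2 hp.1 (fun a ha => hg p hp a ha) ht hpt.le
      ((mem_convexHull_iff_facetFunctionals hne).2 fun q hq' => by
        rw [inner_add_right, real_inner_smul_right]
        by_cases hqp : q = p
        · subst hqp
          rw [real_inner_self_eq_norm_sq, hp.1]
          linarith
        · have h3 := hq q hq' hqp
          have h4 := mul_le_mul_of_nonneg_left (hip q hq' p.1 hp.1) hρh.le
          linarith)
      -- Descending to the facet and then moving tangentially by `ρh` lowers any other height by at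
      -- most `t + ρh ≤ 2ρh`, which `hq` allows.
      (fun e he hpe => (mem_convexHull_iff_facetFunctionals hne).2 fun q hq' => by
        rw [inner_add_right, inner_sub_right, real_inner_smul_right, real_inner_smul_right]
        by_cases hqp : q = p
        · subst hqp
          rw [real_inner_self_eq_norm_sq, hp.1, hpe]
          linarith
        · have h3 := hq q hq' hqp
          have h4 := mul_le_mul_of_nonneg_left (hip q hq' e he) hρh.le
          have h5 : inner ℝ q.1 p.1 ≤ 1 := by
            have := real_inner_le_norm q.1 p.1
            rwa [hq'.1, hp.1, one_mul] at this
          have h6 := mul_le_mul_of_nonneg_left h5 ht.le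
          linarith)
    -- With `h ≤ 1` the weight `1/√(t/h)` is dominated by `1/√t`, which no longer depends on `h`.
    have hth : t ≤ t / h := by
      rw [le_div_iff₀ hh]
      have : h ≤ 1 := hh0.trans (min_le_left _ _)
      nlinarith
    calc _ ≤ (C * h / √√(t / h)) ^ 2 := by gcongr
      _ = (C * h) ^ 2 * (1 / √(t / h)) := by
        rw [div_pow, Real.sq_sqrt (Real.sqrt_nonneg _)]
        ring
      _ ≤ (C * h) ^ 2 * (1 / √t) := by gcongr
      _ ≤ _ := by
        gcongr
        have := Finset.single_le_sum hsum0 (hfin.mem_toFinset.2 hp)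
        linarith

end PolytopeApproximation

/-! ### Approximation in `H¹` and the diagonal choice -/

section H1Approximation

variable {d : ℕ} {V : Finset (EuclideanSpace ℝ (Fin d))}

/-- The diagonal argument: the best level reachable at index `k` tends to zero. Since this infimum
need not be attained, `1/k` is added to it; at `k = 0` that term is `⊤`, and `htop` applies. -/
theorem exists_tendsto_zero_of_eventually {A : ℕ → ENNReal → Prop}
    (hmono : ∀ k r s, r ≤ s → A k r → A k s) (htop : ∀ k, A k ⊤)
    (hev : ∀ ε : ℝ, 0 < ε → ∀ᶠ k in atTop, A k (ENNReal.ofReal ε)) :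
    ∃ r : ℕ → ENNReal, Tendsto r atTop (𝓝 0) ∧ ∀ k, A k (r k) := by
  refine ⟨fun k => sInf {s | A k s} + (k : ENNReal)⁻¹, ?_, fun k => ?_⟩
  · have h1 : Tendsto (fun k => sInf {s | A k s}) atTop (𝓝 0) := by
      rw [ENNReal.tendsto_nhds_zero]
      intro ε hε
      obtain ⟨r, hr0, hr, hrε⟩ := ENNReal.lt_iff_exists_real_btwn.1 hε
      filter_upwards [hev r (ENNReal.ofReal_pos.1 hr)] with k hk
      exact (sInf_le hk).trans hrε.le
    simpa using h1.add ENNReal.tendsto_inv_nat_nhds_zero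
  · by_cases h : sInf {s | A k s} = ⊤
    · simpa only [h, top_add] using htop k
    · obtain ⟨s, hs, hlt⟩ := sInf_lt_iff.1
        (ENNReal.lt_add_right h (ENNReal.inv_ne_zero.2 (ENNReal.natCast_ne_top k)))
      exact hmono k s _ hlt.le hs

theorem gradient_fun_mul {f g : EuclideanSpace ℝ (Fin d) → ℝ} {x : EuclideanSpace ℝ (Fin d)}
    (hf : DifferentiableAt ℝ f x) (hg : DifferentiableAt ℝ g x) :
    gradient (fun y => f y * g y) x = f x • gradient g x + g x • gradient f x := by
  unfold gradient
  rw [fderiv_fun_mul hf hg, map_add, map_smul, map_smul]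

theorem hasH1Gradient_const {Ω : Set (EuclideanSpace ℝ (Fin d))} (hΩo : IsOpen Ω)
    (hΩb : Bornology.IsBounded Ω) (c : ℝ) : HasH1Gradient Ω (fun _ => c) fun _ => 0 := by
  have : IsFiniteMeasure (volume.restrict Ω) :=
    ⟨by rw [Measure.restrict_apply_univ]; exact hΩb.measure_lt_top⟩
  have := hasH1Gradient_of_contDiffOn hΩo (f := fun _ => c) contDiffOn_const (memLp_const c)
    (by rw [gradient_fun_const']; exact memLp_const 0)
  rwa [gradient_fun_const'] at this

/-- Finite distance to an `H¹` function gives square integrability of `f` and its gradient, so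
membership comes for free from the error estimates. -/
theorem HasH1Gradient.of_contDiffOn_of_eLpNorm_sub {Ω : Set (EuclideanSpace ℝ (Fin d))}
    (hΩ : IsOpen Ω) {u f : EuclideanSpace ℝ (Fin d) → ℝ}
    {g : EuclideanSpace ℝ (Fin d) → EuclideanSpace ℝ (Fin d)} (hu : HasH1Gradient Ω u g)
    (hf : ContDiffOn ℝ 1 f Ω) (h0 : eLpNorm (f - u) 2 (volume.restrict Ω) < ⊤)
    (h1 : eLpNorm (gradient f - g) 2 (volume.restrict Ω) < ⊤) :
    HasH1Gradient Ω f (gradient f) := by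
  have m0 : AEStronglyMeasurable f (volume.restrict Ω) :=
    hf.continuousOn.aestronglyMeasurable hΩ.measurableSet
  have m1 : AEStronglyMeasurable (gradient f) (volume.restrict Ω) :=
    (ContDiffOn.continuousOn_gradient hΩ hf).aestronglyMeasurable hΩ.measurableSet
  refine hasH1Gradient_of_contDiffOn hΩ hf ?_ ?_
  · have := (show MemLp (f - u) 2 (volume.restrict Ω) from
      ⟨m0.sub hu.memLp.aestronglyMeasurable, h0⟩).add hu.memLp
    rwa [sub_add_cancel] at this
  · have := (show MemLp (gradient f - g) 2 (volume.restrict Ω) from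
      ⟨m1.sub hu.memLp_gradient.aestronglyMeasurable, h1⟩).add hu.memLp_gradient
    rwa [sub_add_cancel] at this

theorem lintegral_facet_weight_lt_top (hd : 1 < d)
    (hne : (interior (convexHull ℝ (V : Set (EuclideanSpace ℝ (Fin d))))).Nonempty) :
    ∫⁻ x in interior (convexHull ℝ (V : Set (EuclideanSpace ℝ (Fin d)))),
      ENNReal.ofReal (1 + ∑ᶠ p ∈ facetFunctionals V, 1 / √(inner ℝ p.1 x - p.2)) < ⊤ := by
  have hfin := finite_facetFunctionals hd hne
  have e : ∀ x : EuclideanSpace ℝ (Fin d),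
      ENNReal.ofReal (1 + ∑ᶠ p ∈ facetFunctionals V, 1 / √(inner ℝ p.1 x - p.2)) =
        1 + ∑ p ∈ hfin.toFinset, ENNReal.ofReal (1 / √(inner ℝ p.1 x - p.2)) := by
    intro x
    rw [finsum_mem_eq_finite_toFinset_sum _ hfin, ENNReal.ofReal_add zero_le_one
      (Finset.sum_nonneg fun p _ => by positivity), ENNReal.ofReal_one,
      ENNReal.ofReal_sum_of_nonneg fun p _ => by positivity]
  simp only [e]
  rw [lintegral_add_left measurable_const, lintegral_finsetSum]
  · refine ENNReal.add_lt_top.2 ⟨by simpa using isBounded_interior_convexHull.measure_lt_top,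
      ENNReal.sum_lt_top.2 fun p hp => ?_⟩
    rw [hfin.mem_toFinset] at hp
    exact lintegral_inv_sqrt_lt_top (by omega) isBounded_interior_convexHull
      isOpen_interior.measurableSet hp.1 fun x hx => (mem_interior_convexHull_iff hd hne).1 hx p hp
  · intro p _
    fun_prop

theorem sum_mul_lmeShape_mem_lmeSpace (β : ℝ) (P : Finset (EuclideanSpace ℝ (Fin d)))
    (c : P → ℝ) : (fun x => ∑ a, c a * lmeShape β P a x) ∈ lmeSpace β P := by
  have : (fun x => ∑ a, c a * lmeShape β P a x) = ∑ a, c a • lmeShape β P a := by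
    ext x
    simp
  rw [this]
  exact Submodule.sum_mem _ fun a _ => Submodule.smul_mem _ _ (Submodule.subset_span ⟨a, rfl⟩)

/-- The order of choices matters: `U` depends on `ε`, the cutoff on the sup norms of `U` and its
gradient, and only then is `h` taken small, since the interpolation constants depend on both `U` and
the region where the cutoff vanishes. -/
theorem eventually_exists_lme_approximation (hd : 1 < d)
    (hne : (interior (convexHull ℝ (V : Set (EuclideanSpace ℝ (Fin d))))).Nonempty)
    {P : ℕ → Finset (EuclideanSpace ℝ (Fin d))} {h : ℕ → ℝ} {γ τ η : ℝ} (hγ : 0 < γ) (hη : 0 < η)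
    (hpos : ∀ k, 0 < h k) (hlim : Tendsto h atTop (𝓝 0))
    (hconv : ∀ k, interior (convexHull ℝ (P k : Set (EuclideanSpace ℝ (Fin d)))) =
      interior (convexHull ℝ (V : Set (EuclideanSpace ℝ (Fin d)))))
    (hcov : ∀ k, IsHCovering (P k) (h k)
      (interior (convexHull ℝ (V : Set (EuclideanSpace ℝ (Fin d))))))
    (hdens : ∀ k, HasHDensityLE (P k) (h k) τ)
    (hfacet : ∀ k, ∀ A,
      IsFacet (interior (convexHull ℝ (V : Set (EuclideanSpace ℝ (Fin d))))) A →
      ∀ a ∈ P k, ¬ (0 < Metric.infDist a A ∧ Metric.infDist a A < η * h k))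
    {u : EuclideanSpace ℝ (Fin d) → ℝ} {g : EuclideanSpace ℝ (Fin d) → EuclideanSpace ℝ (Fin d)}
    (hu : HasH1Gradient (interior (convexHull ℝ (V : Set (EuclideanSpace ℝ (Fin d))))) u g)
    {ε : ℝ} (hε : 0 < ε) :
    ∀ᶠ k in atTop, ∃ χ v : EuclideanSpace ℝ (Fin d) → ℝ, v ∈ lmeSpace (γ / h k ^ 2) (P k) ∧
      ContDiffOn ℝ 1 χ (interior (convexHull ℝ (V : Set (EuclideanSpace ℝ (Fin d))))) ∧
      ContDiffOn ℝ 1 v (interior (convexHull ℝ (V : Set (EuclideanSpace ℝ (Fin d))))) ∧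
      eLpNorm (fun x => χ x - 1) 2 (volume.restrict
        (interior (convexHull ℝ (V : Set (EuclideanSpace ℝ (Fin d)))))) ≤ ENNReal.ofReal ε ∧
      eLpNorm (gradient χ) 2 (volume.restrict
        (interior (convexHull ℝ (V : Set (EuclideanSpace ℝ (Fin d)))))) ≤ ENNReal.ofReal ε ∧
      eLpNorm ((fun x => χ x * v x) - u) 2 (volume.restrict
        (interior (convexHull ℝ (V : Set (EuclideanSpace ℝ (Fin d)))))) ≤ ENNReal.ofReal ε ∧
      eLpNorm (gradient (fun x => χ x * v x) - g) 2 (volume.restrict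
        (interior (convexHull ℝ (V : Set (EuclideanSpace ℝ (Fin d)))))) ≤ ENNReal.ofReal ε := by
  set Ω := interior (convexHull ℝ (V : Set (EuclideanSpace ℝ (Fin d)))) with hΩ
  have hΩo : IsOpen Ω := isOpen_interior
  have hΩb : Bornology.IsBounded Ω := isBounded_interior_convexHull
  have hK : IsCompact (convexHull ℝ (V : Set (EuclideanSpace ℝ (Fin d)))) :=
    V.finite_toSet.isCompact_convexHull ℝ
  have hKc := convex_convexHull ℝ (V : Set (EuclideanSpace ℝ (Fin d)))
  obtain ⟨U, hUs, hU0, hU1⟩ := HasH1Gradient.exists_contDiff_eLpNorm_sub_le hΩo hKc.interior hΩb hne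
    hu (by positivity : 0 < ε / 4)
  have hUc : Continuous U := hUs.continuous
  have hUd : Differentiable ℝ U := hUs.differentiable (by simp)
  have hgUc : Continuous (gradient U) :=
    (LinearIsometryEquiv.continuous _).comp (hUs.continuous_fderiv (by simp))
  obtain ⟨B₀, hB₀⟩ := hK.exists_bound_of_continuousOn hUc.continuousOn
  obtain ⟨B₁, hB₁⟩ := hK.exists_bound_of_continuousOn hgUc.continuousOn
  set B := |B₀| + |B₁| with hB
  have hB0 : 0 ≤ B := by positivity
  have hUB : ∀ x ∈ Ω, ‖U x‖ ≤ B := fun x hx => by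
    have := hB₀ x (interior_subset hx)
    linarith [le_abs_self B₀, abs_nonneg B₁]
  have hgUB : ∀ x ∈ Ω, ‖gradient U x‖ ≤ B := fun x hx => by
    have := hB₁ x (interior_subset hx)
    linarith [le_abs_self B₁, abs_nonneg B₀]
  -- `B + 1` also bounds `v` once the interpolation error is at most one; this controls the term `v
  -- ∇χ`.
  set e₁ := ε / (4 * (B + 1)) with he₁
  have he₁0 : 0 < e₁ := by positivity
  have he₁B : (B + 1) * e₁ = ε / 4 := by rw [he₁]; field_simp
  have he₁ε : e₁ ≤ ε := by nlinarith
  obtain ⟨χ, hχs, hχI, ⟨δ, hδ, hχ0⟩, hχ1, hχ2⟩ := exists_polytope_cutoff hd hne he₁0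
  have hχd : Differentiable ℝ χ := hχs.differentiable (by simp)
  have hgχc : Continuous (gradient χ) :=
    (LinearIsometryEquiv.continuous _).comp (hχs.continuous_fderiv (by simp))
  obtain ⟨M, hM, hTaylor⟩ := exists_taylor_bound hUs hK hKc
  obtain ⟨C, h₀, hC, hh₀, hest⟩ := exists_lme_interpolation_estimate (τ := τ) hd hne hγ hη hM hδ
  have hKW := lintegral_facet_weight_lt_top hd hne
  rw [← hΩ] at hest hKW hχ1 hχ2
  set W : EuclideanSpace ℝ (Fin d) → ℝ :=
    fun x => 1 + ∑ᶠ p ∈ facetFunctionals V, 1 / √(inner ℝ p.1 x - p.2) with hW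
  set I := ∫⁻ x in Ω, ENNReal.ofReal (W x) with hI
  have hvol : volume Ω < ⊤ := hΩb.measure_lt_top
  have hlim1 : Tendsto (fun k => C * h k ^ 2) atTop (𝓝 0) := by
    simpa using (hlim.pow 2).const_mul C
  have hlim2 : Tendsto (fun k => (C * h k ^ 2) ^ 2 * (volume Ω).toReal) atTop (𝓝 0) := by
    simpa using (hlim1.pow 2).mul_const (volume Ω).toReal
  have hlim3 : Tendsto (fun k => (C * h k) ^ 2 * I.toReal) atTop (𝓝 0) := by
    simpa using ((hlim.const_mul C).pow 2).mul_const I.toReal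
  have hε2 : (0 : ℝ) < (ε / 4) ^ 2 := by positivity
  filter_upwards [hlim.eventually (ge_mem_nhds hh₀), hlim1.eventually (ge_mem_nhds one_pos),
    hlim2.eventually (ge_mem_nhds hε2), hlim3.eventually (ge_mem_nhds hε2)] with k k0 k1 k2 k3
  have hβ : 0 < γ / h k ^ 2 := div_pos hγ (pow_pos (hpos k) 2)
  set v : EuclideanSpace ℝ (Fin d) → ℝ :=
    fun z => ∑ a : P k, U a * lmeShape (γ / h k ^ 2) (P k) a z with hv
  have hvs : ∀ x ∈ Ω, ContDiffAt ℝ ∞ v x := fun x hx =>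
    ContDiffAt.sum fun a _ => contDiffAt_const.mul (contDiffAt_lmeShape hβ (by rwa [hconv k]) a)
  have hvon : ContDiffOn ℝ 1 v Ω := fun x hx =>
    ((hvs x hx).of_le (by norm_cast)).contDiffWithinAt
  have hvd : ∀ x ∈ Ω, DifferentiableAt ℝ v x := fun x hx => (hvs x hx).differentiableAt (by simp)
  have hE := fun x hx => hest (P k) (h k) (hpos k) k0 (hconv k) (hcov k) (hdens k) (hfacet k) U
    (gradient U x) x hx fun a ha => hTaylor x (interior_subset hx) a ha
  have mv : AEStronglyMeasurable v (volume.restrict Ω) :=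
    hvon.continuousOn.aestronglyMeasurable hΩo.measurableSet
  have mgv : AEStronglyMeasurable (gradient v) (volume.restrict Ω) :=
    (ContDiffOn.continuousOn_gradient hΩo hvon).aestronglyMeasurable hΩo.measurableSet
  have mU : AEStronglyMeasurable U (volume.restrict Ω) := hUc.aestronglyMeasurable
  have mgU : AEStronglyMeasurable (gradient U) (volume.restrict Ω) := hgUc.aestronglyMeasurable
  have mχ : AEStronglyMeasurable χ (volume.restrict Ω) := hχs.continuous.aestronglyMeasurable
  have mgχ : AEStronglyMeasurable (gradient χ) (volume.restrict Ω) := hgχc.aestronglyMeasurable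
  have mu := hu.memLp.aestronglyMeasurable
  have mg := hu.memLp_gradient.aestronglyMeasurable
  have mχ1 : AEStronglyMeasurable (fun x => χ x - 1) (volume.restrict Ω) :=
    mχ.sub aestronglyMeasurable_const
  have hχabs : ∀ x, ‖χ x‖ ≤ 1 := fun x => by
    rw [Real.norm_of_nonneg (hχI x).1]
    exact (hχI x).2
  have hvU : eLpNorm (fun x => χ x * (v x - U x)) 2 (volume.restrict Ω) ≤
      ENNReal.ofReal (ε / 4) := by
    refine eLpNorm_two_le_ofReal (by positivity) ?_
    calc ∫⁻ x in Ω, ‖χ x * (v x - U x)‖ₑ ^ 2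
        ≤ ∫⁻ x in Ω, ENNReal.ofReal ((C * h k ^ 2) ^ 2) := by
          refine setLIntegral_mono' hΩo.measurableSet fun x hx => ?_
          rw [← ofReal_norm, ← ENNReal.ofReal_pow (norm_nonneg _), norm_mul]
          refine ENNReal.ofReal_le_ofReal ?_
          refine pow_le_pow_left₀ (by positivity) ?_ 2
          calc ‖χ x‖ * ‖v x - U x‖ ≤ 1 * (C * h k ^ 2) := by
                gcongr
                · exact hχabs x
                · exact (hE x hx).1
            _ = _ := one_mul _
      _ = ENNReal.ofReal ((C * h k ^ 2) ^ 2 * (volume Ω).toReal) := by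
          rw [lintegral_const, Measure.restrict_apply_univ, ENNReal.ofReal_mul (by positivity),
            ENNReal.ofReal_toReal hvol.ne]
      _ ≤ _ := ENNReal.ofReal_le_ofReal k2
  have hgvU : eLpNorm (fun x => χ x • (gradient v x - gradient U x)) 2 (volume.restrict Ω) ≤
      ENNReal.ofReal (ε / 4) := by
    refine eLpNorm_two_le_ofReal (by positivity) ?_
    calc ∫⁻ x in Ω, ‖χ x • (gradient v x - gradient U x)‖ₑ ^ 2
        ≤ ∫⁻ x in Ω, ENNReal.ofReal ((C * h k) ^ 2) * ENNReal.ofReal (W x) := by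
          refine setLIntegral_mono' hΩo.measurableSet fun x hx => ?_
          -- Either the cutoff kills the integrand, or the facets are separated at `x` and the
          -- weighted gradient bound applies.
          by_cases hx0 : χ x = 0
          · simp [hx0]
          have h1 := (hE x hx).2 fun p hp q hq hpq => by
            by_contra hcon
            exact hx0 (hχ0 p hp q hq hpq x (not_lt.1 hcon))
          rw [← ofReal_norm, ← ENNReal.ofReal_pow (norm_nonneg _), norm_smul,
            ← ENNReal.ofReal_mul (by positivity)]
          refine ENNReal.ofReal_le_ofReal (le_trans ?_ h1)
          gcongr
          exact mul_le_of_le_one_left (norm_nonneg _) (hχabs x)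
      _ = ENNReal.ofReal ((C * h k) ^ 2 * I.toReal) := by
          rw [lintegral_const_mul' _ _ ENNReal.ofReal_ne_top, ENNReal.ofReal_mul (by positivity),
            ENNReal.ofReal_toReal hKW.ne]
      _ ≤ _ := ENNReal.ofReal_le_ofReal k3
  have hscale : ∀ {F G : Type} [NormedAddCommGroup F] [NormedAddCommGroup G]
      {a : EuclideanSpace ℝ (Fin d) → F} {b : EuclideanSpace ℝ (Fin d) → G},
      eLpNorm b 2 (volume.restrict Ω) ≤ ENNReal.ofReal e₁ →
      (∀ x ∈ Ω, ‖a x‖ ≤ (B + 1) * ‖b x‖) →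
      eLpNorm a 2 (volume.restrict Ω) ≤ ENNReal.ofReal (ε / 4) := by
    intro F G _ _ a b hb hab
    refine (eLpNorm_le_mul_eLpNorm_of_ae_le_mul
      ((ae_restrict_mem hΩo.measurableSet).mono hab) 2).trans ?_
    rw [← he₁B, ENNReal.ofReal_mul (by positivity)]
    gcongr
  have hadd4 : ENNReal.ofReal (ε / 4) + ENNReal.ofReal (ε / 4) +
      (ENNReal.ofReal (ε / 4) + ENNReal.ofReal (ε / 4)) = ENNReal.ofReal ε := by
    rw [← ENNReal.ofReal_add (by positivity) (by positivity),
      ← ENNReal.ofReal_add (by positivity) (by positivity)]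
    congr 1
    ring
  refine ⟨χ, v, sum_mul_lmeShape_mem_lmeSpace _ _ _, (hχs.of_le (by norm_cast)).contDiffOn, hvon,
    hχ1.trans (ENNReal.ofReal_le_ofReal he₁ε), hχ2.trans (ENNReal.ofReal_le_ofReal he₁ε), ?_, ?_⟩
  · have hdec : (fun x => χ x * v x) - u = ((fun x => χ x * (v x - U x)) +
        (fun x => (χ x - 1) * U x)) + (U - u) := by
      ext x
      simp only [Pi.sub_apply, Pi.add_apply]
      ring
    rw [hdec]
    have m1 : AEStronglyMeasurable (fun x => χ x * (v x - U x)) (volume.restrict Ω) :=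
      mχ.mul (mv.sub mU)
    have m2 : AEStronglyMeasurable (fun x => (χ x - 1) * U x) (volume.restrict Ω) := mχ1.mul mU
    have hs : eLpNorm (fun x => (χ x - 1) * U x) 2 (volume.restrict Ω) ≤ ENNReal.ofReal (ε / 4) :=
      hscale hχ1 fun x hx => by
        rw [norm_mul, mul_comm]
        gcongr
        linarith [hUB x hx]
    refine (eLpNorm_add_le (m1.add m2) (mU.sub mu) (by norm_num)).trans ?_
    refine (add_le_add ((eLpNorm_add_le m1 m2 (by norm_num)).trans (add_le_add hvU hs))
      (hU0.trans le_self_add)).trans hadd4.le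
  · have m1 : AEStronglyMeasurable (fun x => χ x • (gradient v x - gradient U x))
        (volume.restrict Ω) := mχ.smul (mgv.sub mgU)
    have m2 : AEStronglyMeasurable (fun x => (χ x - 1) • gradient U x) (volume.restrict Ω) :=
      mχ1.smul mgU
    have m3 : AEStronglyMeasurable (fun x => v x • gradient χ x) (volume.restrict Ω) := mv.smul mgχ
    have hdec : gradient (fun x => χ x * v x) - g =ᵐ[volume.restrict Ω]
        ((fun x => χ x • (gradient v x - gradient U x)) + (fun x => (χ x - 1) • gradient U x)) +
          ((fun x => v x • gradient χ x) + (gradient U - g)) := by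
      filter_upwards [ae_restrict_mem hΩo.measurableSet] with x hx
      simp only [Pi.sub_apply, Pi.add_apply]
      rw [gradient_fun_mul (hχd x) (hvd x hx), smul_sub, sub_smul, one_smul]
      abel
    rw [eLpNorm_congr_ae hdec]
    have hs2 : eLpNorm (fun x => (χ x - 1) • gradient U x) 2 (volume.restrict Ω) ≤
        ENNReal.ofReal (ε / 4) :=
      hscale hχ1 fun x hx => by
        rw [norm_smul, mul_comm]
        gcongr
        linarith [hgUB x hx]
    have hs3 : eLpNorm (fun x => v x • gradient χ x) 2 (volume.restrict Ω) ≤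
        ENNReal.ofReal (ε / 4) :=
      hscale hχ2 fun x hx => by
        rw [norm_smul]
        gcongr
        have h1 : ‖v x - U x‖ ≤ 1 := (hE x hx).1.trans k1
        have h2 : ‖v x‖ ≤ ‖U x‖ + ‖v x - U x‖ := by
          have := norm_add_le (U x) (v x - U x)
          rwa [add_sub_cancel] at this
        linarith [hUB x hx]
    refine (eLpNorm_add_le (m1.add m2) (m3.add (mgU.sub mg)) (by norm_num)).trans ?_
    exact (add_le_add
      ((eLpNorm_add_le m1 m2 (by norm_num)).trans (add_le_add hgvU hs2))
      ((eLpNorm_add_le m3 (mgU.sub mg) (by norm_num)).trans (add_le_add hs3 hU1))).trans hadd4.le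

end H1Approximation

theorem mainTheorem10 (d : ℕ) (hd : 2 < d)
    (Ω : Set (EuclideanSpace ℝ (Fin d))) (hΩ : IsOpenPolytope Ω)
    (P : ℕ → Finset (EuclideanSpace ℝ (Fin d))) (h : ℕ → ℝ) (γ τ η : ℝ)
    (hγ : 0 < γ) (hτ : 0 < τ) (hη : 0 < η)
    (hpos : ∀ k, 0 < h k) (hlim : Tendsto h atTop (𝓝 0))
    (hconv : ∀ k, interior (convexHull ℝ (P k : Set (EuclideanSpace ℝ (Fin d)))) = Ω)
    (hcov : ∀ k, IsHCovering (P k) (h k) Ω)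
    (hdens : ∀ k, HasHDensityLE (P k) (h k) τ)
    (hfacet : ∀ k, ∀ A, IsFacet Ω A →
      ∀ a ∈ P k, ¬ (0 < Metric.infDist a A ∧ Metric.infDist a A < η * h k))
    (u : EuclideanSpace ℝ (Fin d) → ℝ) (hu : MemH1 Ω u) :
    ∃ (χ v : ℕ → EuclideanSpace ℝ (Fin d) → ℝ),
      (∀ k, v k ∈ lmeSpace (γ / h k ^ 2) (P k)) ∧
      TendstoH1 Ω χ (fun _ => 1) ∧
      TendstoH1 Ω (fun k x => χ k x * v k x) u := by
  obtain ⟨V, rfl⟩ := hΩ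
  set Ω := interior (convexHull ℝ (V : Set (EuclideanSpace ℝ (Fin d)))) with hΩ
  have hΩo : IsOpen Ω := isOpen_interior
  have hΩb : Bornology.IsBounded Ω := isBounded_interior_convexHull
  obtain ⟨g, hg⟩ := hu
  have h1 : HasH1Gradient Ω (fun _ => 1) fun _ => 0 := hasH1Gradient_const hΩo hΩb 1
  -- One level `r` measures all four distances at once, so a single null sequence of levels gives
  -- both convergences with the same cutoffs.
  let A : ℕ → ENNReal → Prop := fun k r =>
    ∃ (χ v : EuclideanSpace ℝ (Fin d) → ℝ)
      (G H : EuclideanSpace ℝ (Fin d) → EuclideanSpace ℝ (Fin d)),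
      v ∈ lmeSpace (γ / h k ^ 2) (P k) ∧ HasH1Gradient Ω χ G ∧
      HasH1Gradient Ω (fun x => χ x * v x) H ∧
      eLpNorm (χ - fun _ => 1) 2 (volume.restrict Ω) ≤ r ∧
      eLpNorm (G - fun _ => 0) 2 (volume.restrict Ω) ≤ r ∧
      eLpNorm ((fun x => χ x * v x) - u) 2 (volume.restrict Ω) ≤ r ∧
      eLpNorm (H - g) 2 (volume.restrict Ω) ≤ r
  have htriv : HasH1Gradient Ω (fun x => (fun _ => (1 : ℝ)) x *
      (0 : EuclideanSpace ℝ (Fin d) → ℝ) x) fun _ => 0 := by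
    simpa using hasH1Gradient_const hΩo hΩb 0
  obtain ⟨r, hr, hA⟩ := exists_tendsto_zero_of_eventually (A := A)
    (by
      rintro k r s hrs ⟨χ, v, G, H, hv, hG, hH, i1, i2, i3, i4⟩
      exact ⟨χ, v, G, H, hv, hG, hH, i1.trans hrs, i2.trans hrs, i3.trans hrs, i4.trans hrs⟩)
    (fun k => ⟨fun _ => 1, 0, fun _ => 0, fun _ => 0, Submodule.zero_mem _, h1, htriv, le_top,
      le_top, le_top, le_top⟩)
    (by
      intro ε hε
      -- A degenerate polytope has empty interior; then the restricted measure is zero and any pair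
      -- works.
      rcases Ω.eq_empty_or_nonempty with h0 | hne
      · have hz : volume.restrict Ω = 0 := by rw [h0, Measure.restrict_empty]
        refine Eventually.of_forall fun k => ⟨fun _ => 1, 0, fun _ => 0, fun _ => 0,
          Submodule.zero_mem _, h1, htriv, ?_, ?_, ?_, ?_⟩ <;> simp [hz]
      · filter_upwards [eventually_exists_lme_approximation (by omega) hne hγ hη hpos hlim hconv
          hcov hdens hfacet hg hε] with k hk
        obtain ⟨χ, v, hv, hχs, hvs, i1, i2, i3, i4⟩ := hk
        have i2' : eLpNorm (gradient χ - fun _ => 0) 2 (volume.restrict Ω) ≤ ENNReal.ofReal ε := by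
          have : (gradient χ - fun _ => 0) = gradient χ := sub_zero _
          rwa [this]
        exact ⟨χ, v, gradient χ, gradient fun x => χ x * v x, hv,
          h1.of_contDiffOn_of_eLpNorm_sub hΩo hχs (i1.trans_lt ENNReal.ofReal_lt_top)
            (i2'.trans_lt ENNReal.ofReal_lt_top),
          hg.of_contDiffOn_of_eLpNorm_sub hΩo (hχs.mul hvs) (i3.trans_lt ENNReal.ofReal_lt_top)
            (i4.trans_lt ENNReal.ofReal_lt_top), i1, i2', i3, i4⟩)
  choose χ v G H hv hG hH i1 i2 i3 i4 using hA
  have hsq : ∀ f : ℕ → ENNReal, (∀ k, f k ≤ r k) → Tendsto f atTop (𝓝 0) := fun f hf =>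
    tendsto_of_tendsto_of_tendsto_of_le_of_le tendsto_const_nhds hr (fun _ => zero_le) hf
  exact ⟨χ, v, hv, ⟨G, fun _ => 0, hG, h1, hsq _ i1, hsq _ i2⟩, ⟨H, g, hH, hg, hsq _ i3, hsq _ i4⟩⟩
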